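/- Let $\pi\colon E\to B$ be a smooth Banach bundle over a Banach manifold $B$: that is, $B$ is a Hausdorff smooth manifold without boundary modelled on a real Banach space, and $E$ is a smooth vector bundle over $B$ whose typical fiber is a real Banach space. Let $$S\colon [0,1]\times B\to E$$ be a map of class $C^2$ such that $S(t,\cdot)$ is a section of $E$ for every $t\in[0,1]$, and let $0_E\subset E$ denote the image of the zero section. At a zero $x$ of a section $\sigma$, the fiberwise differential of $\sigma$ at $x$ is the bounded linear map $T_xB\to E_x$ obtained by differentiating $\sigma$ at $x$ in a local trivialization of $E$ (it does not depend on the trivialization). Assume: (i) the set $S^{-1}(0_E)\subset[0,1]\times B$ is compact; (ii) for every $(t,x)\in S^{-1}(0_E)$ the fiberwise differential of the section $S(t,\cdot)$ at $x$ is a Fredholm operator of index $0$; (iii) there exists a unique $x_0\in B$ such that $S(0,x_0)\in 0_E$; (iv) the fiberwise differential of $S(0,\cdot)$ at $x_0$ is an isomorphism. Then the restriction of the projection $[0,1]\times B\to[0,1]$ to $S^{-1}(0_E)$ is surjective; that is, for every $t\in[0,1]$ there is $x\in B$ with $S(t,x)\in 0_E$. In particular, there exists at least one $x_1\in B$ such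 that $S(1,x_1)\in 0_E$. -/

import Mathlib

open Bundle Set
open scoped Manifold ContDiff Bundle Topology

/-- The index `dim ker T - dim coker T` of a continuous linear map (meaningful when `T` is
Fredholm). -/
noncomputable def fredholmIndex {X Y : Type*} [AddCommGroup X] [Module ℝ X] [TopologicalSpace X]
    [AddCommGroup Y] [Module ℝ Y] [TopologicalSpace Y] (T : X →L[ℝ] Y) : ℤ :=
  (Module.finrank ℝ T.ker : ℤ) - (Module.finrank ℝ (Y ⧸ T.range) : ℤ)

section FiberwiseDifferential

variable {EB : Type*} [NormedAddCommGroup EB] [NormedSpace ℝ EB]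
  {F : Type*} [NormedAddCommGroup F] [NormedSpace ℝ F]
  {B : Type*} [TopologicalSpace B] [ChartedSpace EB B]
  {E : B → Type*} [TopologicalSpace (TotalSpace F E)]
  [∀ x, AddCommGroup (E x)] [∀ x, Module ℝ (E x)] [∀ x, TopologicalSpace (E x)]
  [FiberBundle F E] [VectorBundle ℝ F E]

/-- The fiberwise differential `T_x B → E_x` at the point `x` of a section `σ` of the vector
bundle `E`: write `σ` near `x` as a function with values in the model fiber by means of a local
trivialization around `x`, differentiate this function at `x`, and read the result in the fiber
`E x` through the same trivialization. At a zero of `σ` the choice of the local trivialization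
is irrelevant, see `fiberwiseDifferential_eq`. -/
noncomputable def fiberwiseDifferential (σ : B → TotalSpace F E) (x : B) :
    TangentSpace 𝓘(ℝ, EB) x →L[ℝ] E x :=
  (((trivializationAt F E x).continuousLinearEquivAt ℝ x
      (mem_baseSet_trivializationAt F E x)).symm : F →L[ℝ] E x) ∘L
    (mfderiv 𝓘(ℝ, EB) 𝓘(ℝ, F) (fun y : B => (trivializationAt F E x (σ y)).2) x :
      TangentSpace 𝓘(ℝ, EB) x →L[ℝ] F)

/-- At a zero, the fiberwise differential of a differentiable section can be computed in any local
trivialization of the bundle. -/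
theorem fiberwiseDifferential_eq [IsManifold 𝓘(ℝ, EB) 1 B]
    [ContMDiffVectorBundle 1 F E 𝓘(ℝ, EB)] (σ : B → TotalSpace F E)
    (hσ : ∀ y, (σ y).proj = y) (x : B) (hx : σ x ∈ range (zeroSection F E))
    (hd : MDifferentiableAt 𝓘(ℝ, EB) (𝓘(ℝ, EB).prod 𝓘(ℝ, F)) σ x)
    (e : Trivialization F (π F E)) [MemTrivializationAtlas e] (hxe : x ∈ e.baseSet) :
    fiberwiseDifferential σ x =
      ((e.continuousLinearEquivAt ℝ x hxe).symm : F →L[ℝ] E x) ∘L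
        (mfderiv 𝓘(ℝ, EB) 𝓘(ℝ, F) (fun y : B => (e (σ y)).2) x :
          TangentSpace 𝓘(ℝ, EB) x →L[ℝ] F) := by
  set e₀ := trivializationAt F E x with he₀
  have hx₀ : x ∈ e₀.baseSet := mem_baseSet_trivializationAt F E x
  set v : B → F := fun y => (e₀ (σ y)).2 with hv
  set A : B → F →L[ℝ] F := fun y => (e₀.coordChangeL ℝ e y : F →L[ℝ] F) with hA
  have hA' : MDifferentiableAt 𝓘(ℝ, EB) 𝓘(ℝ, F →L[ℝ] F) A x :=
    (contMDiffAt_coordChangeL (IB := 𝓘(ℝ, EB)) (n := 1) hx₀ hxe).mdifferentiableAt one_ne_zero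
  have hv' : MDifferentiableAt 𝓘(ℝ, EB) 𝓘(ℝ, F) v x := by
    have h := ((mdifferentiableAt_totalSpace 𝓘(ℝ, EB) σ).1 hd).2
    rwa [hσ x] at h
  have hv0 : v x = 0 := by
    obtain ⟨y, hy⟩ := hx
    have hyx : y = x := by
      have := congrArg TotalSpace.proj hy
      rwa [hσ x] at this
    subst hyx
    simp only [hv, ← hy]
    exact congrArg Prod.snd (e₀.zeroSection ℝ hx₀)
  have hev : (fun y : B => (e (σ y)).2) =ᶠ[𝓝 x] fun y => A y (v y) := by
    filter_upwards [(e₀.open_baseSet.inter e.open_baseSet).mem_nhds ⟨hx₀, hxe⟩] with y hy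
    have h := e₀.coordChange_apply_snd e (p := σ y) (by rw [hσ y]; exact hy.1)
    rw [hσ y] at h
    rw [← h]
    exact (e₀.coordChangeL_apply' e hy (v y)).symm
  have hmf : ∀ w : EB, (mfderiv 𝓘(ℝ, EB) 𝓘(ℝ, F) (fun y : B => (e (σ y)).2) x : EB →L[ℝ] F) w =
      A x ((mfderiv 𝓘(ℝ, EB) 𝓘(ℝ, F) v x : EB →L[ℝ] F) w) := by
    intro w
    have h1 := hA'.hasMFDerivAt
    have h2 := hv'.hasMFDerivAt
    have h3 : HasMFDerivAt 𝓘(ℝ, EB) 𝓘(ℝ, F) (fun y => A y (v y)) x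
        ((A x) ∘L (mfderiv 𝓘(ℝ, EB) 𝓘(ℝ, F) v x : EB →L[ℝ] F)) := by
      refine ⟨h1.1.clm_apply h2.1, ?_⟩
      have h4 : HasFDerivWithinAt _ (_ : EB →L[ℝ] F) _ _ :=
        HasFDerivWithinAt.clm_apply h1.2 h2.2
      refine h4.congr_fderiv ?_
      have hl : ((extChartAt 𝓘(ℝ, EB) x).symm ((extChartAt 𝓘(ℝ, EB) x) x)) = x :=
        extChartAt_to_inv x
      have hvx : writtenInExtChartAt 𝓘(ℝ, EB) 𝓘(ℝ, F) x v ((extChartAt 𝓘(ℝ, EB) x) x) = 0 := by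
        simp only [writtenInExtChartAt, Function.comp_apply, hl, hv0]
        rfl
      have hAx : writtenInExtChartAt 𝓘(ℝ, EB) 𝓘(ℝ, F →L[ℝ] F) x A ((extChartAt 𝓘(ℝ, EB) x) x)
          = A x := by
        simp only [writtenInExtChartAt, Function.comp_apply, hl]
        rfl
      rw [hvx, hAx, map_zero, add_zero]
      rfl
    rw [hev.mfderiv_eq, h3.mfderiv]
    rfl
  ext w
  apply (e.continuousLinearEquivAt ℝ x hxe).injective
  refine Eq.trans ?_ ((hmf w).symm.trans
    ((e.continuousLinearEquivAt ℝ x hxe).apply_symm_apply _).symm)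
  exact (e₀.coordChangeL_apply e ⟨hx₀, hxe⟩ _).symm

end FiberwiseDifferential

/-!
The zeros of a family of sections whose fiberwise differentials have index zero can be counted
modulo `2`, and the count is invariant along homotopies with compact set of zeros. A single regular
zero at time `0` gives the count `1`, so the section at time `t` cannot be free of zeros. It is
enough to treat `t = 1`: the restriction of the family to `[0, t]`, reparametrized by a smooth
function on the real line, is again such a family (`exists_zero_at_one`).

*Finite dimension.* For a compact `C^2` homotopy `h` between open subsets of `ℝⁿ` with regular zeros
at both ends, let `φ` be a bump density near the origin. The integral of the pull-back of `φ dv`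
over an end is an integer multiple of `∫ φ`, the integer being congruent to the number of zeros
(`exists_int_setIntegral_det_eq`), and by Stokes' theorem on the slab `[0, 1] × ℝⁿ` the two
integrals agree (`integral_slab_faces_eq`, `ncard_zeros_homotopy`).

*Reduction.* Near a zero with differential of index zero, some operator `K` of finite rank makes
`f + K` a family of local diffeomorphisms, where `f` is a local representative. In the new
coordinate `u = f + K` the zeros lie in the finite-dimensional range of `K` and are cut out by a
`C^2` map with values there (`IsReductionDomain.exists_reduced_map`). Hence, within a single
reduction domain, zero sets are locally compact, Sard's theorem holds, and the parity of the number
of zeros is homotopy invariant.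

*Globalization.* A Banach space need not have smooth bump functions, so the reductions cannot be
patched together by a partition of unity. However, on the compact zero set `Z` the reduction at a
zero is an embedding into a finite-dimensional space, and a bump function there pulls back to a
cut-off `ρ` which is `C^2` at the points of `Z`, hence near `Z` (`exists_contMDiffAt_cutOff`). With
finitely many such cut-offs `ρ i` the family is perturbed by `∑ i, ρ i • v i`, with `v i` in the
range of the operator `K i` of the `i`-th reduction (`perturbedFamily`,
`exists_isPerturbationSystem`). For small `v`, as long as all zeros are regular, their number is
locally constant in `(t, v)`; parameters with only regular zeros are dense at each time, by
Sard's theorem applied where `ρ i = 1`, one index after the other. A change of a single block `v i`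
does not change the parity: zeros off the support of `ρ i` do not move, and the others stay in the
`i`-th reduction domain (`IsPerturbationSystem.ncard_update_eq`). These three facts imply that the
parity of the unperturbed family is the same at both ends (`eq_at_endpoints`): two good parameters
at the same time are connected by changes of single blocks, through nearby good parameters, and the
time interval is connected.
-/

/-! ### Counting regular zeros by an integral -/

section ZeroCounting

open MeasureTheory

/-- Near a point with invertible derivative a `C^1` map is injective, open, and its Jacobian
determinant keeps its sign. -/
theorem ContDiffAt.eventually_injOn_det_sign {E : Type*} [NormedAddCommGroup E] [NormedSpace ℝ E]
    [FiniteDimensional ℝ E] {g : E → E} {a : E} (hg : ContDiffAt ℝ 1 g a)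
    (ha : (fderiv ℝ g a).det ≠ 0) :
    ∃ V ∈ 𝓝 a, InjOn g V ∧ (∀ U ⊆ V, U ∈ 𝓝 a → g '' U ∈ 𝓝 (g a)) ∧
      ∃ s : ℤ, (s = 1 ∨ s = -1) ∧ ∀ x ∈ V, (fderiv ℝ g x).det = s * |(fderiv ℝ g x).det| := by
  have := FiniteDimensional.complete ℝ E
  let A : E ≃L[ℝ] E := (fderiv ℝ g a).toContinuousLinearEquivOfDetNeZero ha
  have hst : HasStrictFDerivAt g (A : E →L[ℝ] E) a := hg.hasStrictFDerivAt one_ne_zero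
  have hdet : ContinuousAt (fun x => (fderiv ℝ g x).det) a :=
    ContinuousLinearMap.continuous_det.continuousAt.comp
      (hg.fderiv_right (m := 0) (by norm_num)).continuousAt
  obtain ⟨s, hs, hev⟩ : ∃ s : ℤ, (s = 1 ∨ s = -1) ∧
      ∀ᶠ x in 𝓝 a, (fderiv ℝ g x).det = s * |(fderiv ℝ g x).det| := by
    rcases lt_or_gt_of_ne ha with h | h
    · refine ⟨-1, Or.inr rfl, ?_⟩
      filter_upwards [hdet.eventually_lt_const h] with x hx
      rw [abs_of_neg hx]; simp
    · refine ⟨1, Or.inl rfl, ?_⟩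
      filter_upwards [hdet.eventually_const_lt h] with x hx
      rw [abs_of_pos hx]; simp
  let Φ := hst.toOpenPartialHomeomorph g
  refine ⟨Φ.source ∩ {x | (fderiv ℝ g x).det = s * |(fderiv ℝ g x).det|},
    Filter.inter_mem (Φ.open_source.mem_nhds hst.mem_toOpenPartialHomeomorph_source) hev,
    Φ.injOn.mono inter_subset_left, fun U _ hU => ?_, s, hs, fun x hx => hx.2⟩
  rw [← hst.map_nhds_eq_of_equiv]
  exact Filter.image_mem_map hU

theorem ContDiffAt.finite_zeros_of_isCompact {E : Type*} [NormedAddCommGroup E] [NormedSpace ℝ E]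
    [FiniteDimensional ℝ E] {g : E → E} {L : Set E} (hL : IsCompact L)
    (hg : ∀ x ∈ L, ContDiffAt ℝ 1 g x) (hz : ∀ x ∈ L, g x = 0 → (fderiv ℝ g x).det ≠ 0) :
    {x ∈ L | g x = 0}.Finite := by
  have hc : ContinuousOn g L := fun x hx => (hg x hx).continuousAt.continuousWithinAt
  have hK : IsCompact {x ∈ L | g x = 0} :=
    hL.of_isClosed_subset (hc.preimage_isClosed_of_isClosed hL.isClosed isClosed_singleton)
      (sep_subset _ _)
  choose! V hV hinj _ using fun x (hx : x ∈ {x ∈ L | g x = 0}) =>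
    (hg x hx.1).eventually_injOn_det_sign (hz x hx.1 hx.2)
  obtain ⟨t, ht, hcov⟩ := hK.elim_nhds_subcover V hV
  refine t.finite_toSet.subset fun x hx => ?_
  obtain ⟨y, hy, hxy⟩ := mem_iUnion₂.1 (hcov hx)
  have : x = y := hinj y (ht y hy) hxy (mem_of_mem_nhds (hV y (ht y hy)))
    (hx.2.trans (ht y hy).2.symm)
  exact this ▸ hy

/-- The parity of the number of zeros of a `C^1` map on a compact set, all zeros being interior
and regular, is read off from the integral of the pull-back of any density concentrated near the
origin: each zero contributes the sign of the Jacobian determinant. -/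
theorem exists_int_setIntegral_det_eq {E : Type*} [NormedAddCommGroup E] [NormedSpace ℝ E]
    [FiniteDimensional ℝ E] [MeasurableSpace E] [BorelSpace E] (μ : Measure E)
    [μ.IsAddHaarMeasure] {g : E → E} {L : Set E} (hL : IsCompact L)
    (hg : ∀ x ∈ L, ContDiffAt ℝ 1 g x)
    (hz : ∀ x ∈ L, g x = 0 → x ∈ interior L ∧ (fderiv ℝ g x).det ≠ 0) :
    ∃ m : ℤ, (m : ZMod 2) = ({x ∈ L | g x = 0}.ncard : ZMod 2) ∧ ∃ ε > 0, ∀ φ : E → ℝ,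
      Continuous φ → (∀ v, ε ≤ ‖v‖ → φ v = 0) →
        ∫ x in L, φ (g x) * (fderiv ℝ g x).det ∂μ = m * ∫ v, φ v ∂μ := by
  have hfin := ContDiffAt.finite_zeros_of_isCompact hL hg fun x hx h0 => (hz x hx h0).2
  have hc : ContinuousOn g L := fun x hx => (hg x hx).continuousAt.continuousWithinAt
  have hdc : ContinuousOn (fun x => (fderiv ℝ g x).det) L := fun x hx =>
    (ContinuousLinearMap.continuous_det.continuousAt.comp
      ((hg x hx).fderiv_right (m := 0) (by norm_num)).continuousAt).continuousWithinAt
  choose! V hV hinj hopen s hs hsign using fun x (hx : x ∈ {x ∈ L | g x = 0}) =>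
    (hg x hx.1).eventually_injOn_det_sign (hz x hx.1 hx.2).2
  obtain ⟨D, hD, hdisj⟩ := hfin.t2_separation
  -- pairwise disjoint open neighbourhoods of the zeros on which all local statements hold
  let U : E → Set E := fun x => interior (V x) ∩ D x ∩ interior L
  have hUo : ∀ x, IsOpen (U x) := fun x => (isOpen_interior.inter (hD x).2).inter isOpen_interior
  have hUmem : ∀ x ∈ {x ∈ L | g x = 0}, x ∈ U x := fun x hx =>
    ⟨⟨mem_interior_iff_mem_nhds.2 (hV x hx), (hD x).1⟩, (hz x hx.1 hx.2).1⟩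
  have hUL : ∀ x, U x ⊆ L := fun x => inter_subset_right.trans interior_subset
  have hUV : ∀ x, U x ⊆ V x := fun x y hy => interior_subset hy.1.1
  -- away from these neighbourhoods `g` is bounded away from zero
  obtain ⟨c, hc0, hcb⟩ : ∃ c > 0, ∀ x ∈ L \ ⋃ y ∈ {x ∈ L | g x = 0}, U y, c ≤ ‖g x‖ := by
    have hcomp : IsCompact (L \ ⋃ y ∈ {x ∈ L | g x = 0}, U y) :=
      hL.diff (isOpen_biUnion fun y _ => hUo y)
    rcases (L \ ⋃ y ∈ {x ∈ L | g x = 0}, U y).eq_empty_or_nonempty with he | hne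
    · exact ⟨1, one_pos, fun x hx => absurd (he ▸ hx) (notMem_empty x)⟩
    · obtain ⟨x, hx, hmin⟩ := hcomp.exists_isMinOn hne (hc.mono sdiff_subset).norm
      refine ⟨‖g x‖, norm_pos_iff.2 fun h0 => hx.2 ?_, fun y hy => hmin hy⟩
      exact mem_biUnion (show x ∈ {x ∈ L | g x = 0} from ⟨hx.1, h0⟩) (hUmem x ⟨hx.1, h0⟩)
  -- a ball contained in the images of all these neighbourhoods
  obtain ⟨δ, hδ0, hδ⟩ : ∃ δ > 0, ∀ x ∈ {x ∈ L | g x = 0}, Metric.ball 0 δ ⊆ g '' U x := by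
    have : (⋂ x ∈ {x ∈ L | g x = 0}, g '' U x) ∈ 𝓝 (0 : E) :=
      (Filter.biInter_mem hfin).2 fun x hx => by
        have := hopen x hx (U x) (hUV x) ((hUo x).mem_nhds (hUmem x hx))
        rwa [hx.2] at this
    obtain ⟨δ, hδ0, hδ⟩ := Metric.mem_nhds_iff.1 this
    exact ⟨δ, hδ0, fun x hx => hδ.trans (biInter_subset_of_mem hx)⟩
  refine ⟨∑ x ∈ hfin.toFinset, s x, ?_, min c δ, lt_min hc0 hδ0, fun φ hφ hsupp => ?_⟩
  · rw [Set.ncard_eq_toFinset_card _ hfin, Int.cast_sum, Finset.card_eq_sum_ones, Nat.cast_sum]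
    refine Finset.sum_congr rfl fun x hx => ?_
    rcases hs x (hfin.mem_toFinset.1 hx) with h | h <;> rw [h] <;> rfl
  · set F : E → ℝ := fun x => φ (g x) * (fderiv ℝ g x).det with hF
    have hFint : IntegrableOn F L μ :=
      ((hφ.comp_continuousOn hc).mul hdc).integrableOn_compact hL
    have hUnion : (⋃ x ∈ hfin.toFinset, U x) ⊆ L := iUnion₂_subset fun x _ => hUL x
    have h1 : ∫ x in L, F x ∂μ = ∫ x in ⋃ x ∈ hfin.toFinset, U x, F x ∂μ := by
      refine setIntegral_eq_of_subset_of_forall_sdiff_eq_zero hL.measurableSet hUnion fun x hx => ?_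
      have : x ∈ L \ ⋃ y ∈ {x ∈ L | g x = 0}, U y := by
        simpa only [Finite.mem_toFinset] using hx
      simp only [hF, hsupp _ ((min_le_left _ _).trans (hcb x this)), zero_mul]
    rw [h1, integral_biUnion_finset _ (fun x _ => (hUo x).measurableSet) ?_
      fun x _ => hFint.mono_set (hUL x), Int.cast_sum, Finset.sum_mul]
    · refine Finset.sum_congr rfl fun x hx => ?_
      rw [Finite.mem_toFinset] at hx
      have h2 : ∫ v in g '' U x, φ v ∂μ = ∫ v, φ v ∂μ :=
        setIntegral_eq_integral_of_forall_compl_eq_zero fun v hv =>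
          hsupp v (le_of_not_gt fun h => hv (hδ x hx
            (mem_ball_zero_iff.2 (h.trans_le (min_le_right _ _)))))
      rw [← h2, integral_image_eq_integral_abs_det_fderiv_smul μ (hUo x).measurableSet
        (fun y hy =>
          (((hg y (hUL x hy)).differentiableAt one_ne_zero).hasFDerivAt).hasFDerivWithinAt)
        ((hinj x hx).mono (hUV x)), ← integral_const_mul]
      refine setIntegral_congr_fun (hUo x).measurableSet fun y hy => ?_
      simp only [hF, smul_eq_mul]
      nth_rewrite 1 [hsign x hx y (hUV x hy)]
      ring
    · intro x hx y hy hxy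
      exact (hdisj (hfin.mem_toFinset.1 hx) (hfin.mem_toFinset.1 hy) hxy).mono
        (fun z hz => hz.1.2) (fun z hz => hz.1.2)

end ZeroCounting

/-! ### Homotopy invariance of the parity of the number of zeros in finite dimension -/

section HomotopyParity

open MeasureTheory

/-- Stokes' theorem on the slab `[0, 1] × ℝⁿ` for a closed `n`-form that vanishes far away: its
integrals over the two faces coincide. -/
theorem integral_slab_faces_eq {n : ℕ}
    (η : (Fin (n + 1) → ℝ) → (Fin (n + 1) → ℝ) [⋀^Fin n]→L[ℝ] ℝ) {ρ : ℝ} (hρ : 0 < ρ)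
    (hd : ∀ p : Fin (n + 1) → ℝ, p 0 ∈ Icc (0 : ℝ) 1 → DifferentiableAt ℝ η p)
    (hclosed : ∀ p : Fin (n + 1) → ℝ, p 0 ∈ Icc (0 : ℝ) 1 → extDeriv η p = 0)
    (hsupp : ∀ p : Fin (n + 1) → ℝ, p 0 ∈ Icc (0 : ℝ) 1 → (∃ j : Fin n, ρ ≤ |p j.succ|) →
      η p = 0) :
    ∫ u : Fin n → ℝ, η (Fin.cons 0 u) (fun j => Pi.single j.succ 1) =
      ∫ u : Fin n → ℝ, η (Fin.cons 1 u) (fun j => Pi.single j.succ 1) := by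
  let e : Fin (n + 1) → (Fin (n + 1) → ℝ) := fun k => Pi.single k 1
  let a : Fin (n + 1) → ℝ := Fin.cons 0 fun _ => -ρ
  let b : Fin (n + 1) → ℝ := Fin.cons 1 fun _ => ρ
  have hab : a ≤ b := by
    intro i
    refine Fin.cases ?_ (fun j => ?_) i
    · simp [a, b]
    · simp only [a, b, Fin.cons_succ]; linarith
  let f : Fin (n + 1) → (Fin (n + 1) → ℝ) → ℝ := fun i p =>
    ((-1 : ℝ) ^ (i : ℕ)) • η p (i.removeNth e)
  have hslab : ∀ p ∈ Icc a b, p 0 ∈ Icc (0 : ℝ) 1 := fun p hp => ⟨hp.1 0, hp.2 0⟩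
  have hfd : ∀ i p, p 0 ∈ Icc (0 : ℝ) 1 → DifferentiableAt ℝ (f i) p := fun i p hp =>
    ((hd p hp).continuousAlternatingMap_apply_const (i.removeNth e)).const_smul
      ((-1 : ℝ) ^ (i : ℕ))
  have hdiv : ∀ p, p 0 ∈ Icc (0 : ℝ) 1 → ∑ i, fderiv ℝ (f i) p (e i) = 0 := by
    intro p hp
    have h := extDeriv_apply (hd p hp) e
    rw [hclosed p hp] at h
    refine Eq.trans ?_ h.symm
    refine Finset.sum_congr rfl fun i _ => ?_
    have : fderiv ℝ (f i) p = ((-1 : ℝ) ^ (i : ℕ)) • fderiv ℝ (fun p => η p (i.removeNth e)) p :=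
      fderiv_fun_const_smul ((hd p hp).continuousAlternatingMap_apply_const _) _
    rw [this, smul_apply, ← Int.cast_smul_eq_zsmul ℝ]
    push_cast
    rfl
  have key := integral_divergence_of_hasFDerivAt_off_countable' a b hab f
    (fun i p => fderiv ℝ (f i) p) ∅ countable_empty
    (fun i p hp => (hfd i p (hslab p hp)).continuousAt.continuousWithinAt)
    (fun p hp i => (hfd i p ⟨(hp.1 0 trivial).1.le, (hp.1 0 trivial).2.le⟩).hasFDerivAt)
    ((integrableOn_zero (ε' := ℝ)).congr_fun (fun p hp => (hdiv p (hslab p hp)).symm)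
      measurableSet_Icc)
  rw [setIntegral_congr_fun measurableSet_Icc (fun p hp => hdiv p (hslab p hp)),
    integral_zero, Fin.sum_univ_succ] at key
  have hlat : ∀ j : Fin n, ∀ c : ℝ, ρ ≤ |c| → ∀ x ∈ Icc (a ∘ Fin.succAbove j.succ)
      (b ∘ Fin.succAbove j.succ), f j.succ (Fin.insertNth j.succ c x) = 0 := by
    intro j c hc x hx
    have h0 : (Fin.insertNth j.succ c x : Fin (n + 1) → ℝ) 0 ∈ Icc (0 : ℝ) 1 := by
      cases n with
      | zero => exact j.elim0
      | succ n =>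
        have h := Fin.insertNth_apply_succAbove (α := fun _ => ℝ) j.succ c x 0
        rw [Fin.succ_succAbove_zero] at h
        rw [h]
        have h1 := hx.1 0
        have h2 := hx.2 0
        simp only [Function.comp, Fin.succ_succAbove_zero] at h1 h2
        exact ⟨h1, h2⟩
    have := hsupp _ h0 ⟨j, by rw [Fin.insertNth_apply_same]; exact hc⟩
    simp [f, this]
  have hsum : ∑ j : Fin n, ((∫ x in Icc (a ∘ Fin.succAbove j.succ) (b ∘ Fin.succAbove j.succ),
      f j.succ (Fin.insertNth j.succ (b j.succ) x)) -
      ∫ x in Icc (a ∘ Fin.succAbove j.succ) (b ∘ Fin.succAbove j.succ),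
        f j.succ (Fin.insertNth j.succ (a j.succ) x)) = 0 := by
    refine Finset.sum_eq_zero fun j _ => ?_
    rw [setIntegral_congr_fun measurableSet_Icc (hlat j _ (by simp [b, abs_of_pos hρ])),
      setIntegral_congr_fun measurableSet_Icc (hlat j _ (by simp [a, abs_of_pos hρ]))]
    simp
  rw [hsum, add_zero] at key
  have hface : ∀ c ∈ Icc (0 : ℝ) 1, ∫ x in Icc (a ∘ Fin.succAbove 0) (b ∘ Fin.succAbove 0),
      f 0 (Fin.insertNth 0 c x) =
        ∫ u : Fin n → ℝ, η (Fin.cons c u) (fun j => Pi.single j.succ 1) := by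
    intro c hc
    have : ∀ x : Fin n → ℝ, f 0 (Fin.insertNth 0 c x) =
        η (Fin.cons c x) (fun j => Pi.single j.succ 1) := by
      intro x
      simp only [f, Fin.insertNth_zero', Fin.val_zero, pow_zero, one_smul]
      rfl
    simp only [this]
    refine setIntegral_eq_integral_of_forall_compl_eq_zero fun x hx => ?_
    have hx' : ∃ j, ρ ≤ |x j| := by
      by_contra! h
      exact hx ⟨fun j => by simpa [a] using (abs_lt.1 (h j)).1.le,
        fun j => by simpa [b] using (abs_lt.1 (h j)).2.le⟩
    rw [hsupp _ (by simpa using hc) (by simpa using hx')]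
    rfl
  have h0 := hface 0 (by simp)
  have h1 := hface 1 (by simp)
  rw [← h0, ← h1]
  have ha0 : a 0 = 0 := rfl
  have hb0 : b 0 = 1 := rfl
  rw [ha0, hb0] at key
  linarith

/-- The determinant as a continuous alternating map, that is, the standard volume form. -/
def stdVolumeForm (n : ℕ) : (Fin n → ℝ) [⋀^Fin n]→L[ℝ] ℝ :=
  { (Matrix.detRowAlternating : (Fin n → ℝ) [⋀^Fin n]→ₗ[ℝ] ℝ) with
    cont := Continuous.matrix_det (n := Fin n) (A := fun v : Fin n → Fin n → ℝ => v) continuous_id }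

theorem stdVolumeForm_apply_eq_det {n : ℕ} (T : (Fin n → ℝ) →L[ℝ] (Fin n → ℝ)) :
    stdVolumeForm n (fun j => T (Pi.single j 1)) = T.det := by
  change Matrix.det (fun j => T (Pi.single j 1)) = LinearMap.det (T : (Fin n → ℝ) →ₗ[ℝ] _)
  rw [← LinearMap.det_toMatrix', ← Matrix.det_transpose]
  congr 1

/-- A top-degree form has vanishing exterior derivative. -/
theorem extDeriv_eq_zero_of_top_degree {n : ℕ}
    (η : (Fin n → ℝ) → (Fin n → ℝ) [⋀^Fin n]→L[ℝ] ℝ) (x : Fin n → ℝ) : extDeriv η x = 0 := by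
  ext v
  refine (extDeriv η x).toAlternatingMap.map_linearDependent v fun h => ?_
  have := h.fintype_card_le_finrank
  simp at this

/-- The derivative of a map restricted to a slice with fixed zeroth coordinate. -/
theorem hasFDerivAt_comp_cons {n : ℕ} {G : Type*} [NormedAddCommGroup G] [NormedSpace ℝ G]
    {H : (Fin (n + 1) → ℝ) → G} {c : ℝ} {u : Fin n → ℝ}
    (hH : DifferentiableAt ℝ H (Fin.cons c u)) :
    ∃ T : (Fin n → ℝ) →L[ℝ] G, HasFDerivAt (fun u : Fin n → ℝ => H (Fin.cons c u)) T u ∧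
      ∀ j, T (Pi.single j 1) = fderiv ℝ H (Fin.cons c u) (Pi.single j.succ 1) := by
  let J : (Fin n → ℝ) →L[ℝ] (Fin (n + 1) → ℝ) :=
    ContinuousLinearMap.pi (Fin.cons 0 fun j => ContinuousLinearMap.proj j)
  have hJ : HasFDerivAt (fun u : Fin n → ℝ => (Fin.cons c u : Fin (n + 1) → ℝ)) J u := by
    refine hasFDerivAt_pi.2 fun i => ?_
    refine Fin.cases ?_ (fun j => ?_) i
    · simpa using hasFDerivAt_const c u
    · simpa using hasFDerivAt_apply j u
  refine ⟨(fderiv ℝ H (Fin.cons c u)) ∘L J, HasFDerivAt.comp u hH.hasFDerivAt hJ, fun j => ?_⟩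
  rw [ContinuousLinearMap.comp_apply]
  congr 1
  ext i
  refine Fin.cases ?_ (fun k => ?_) i
  · simp [J]
  · simp [J, Pi.single_apply]

/-- Parity of the number of zeros along a compact homotopy, in coordinates; the zeroth coordinate
is the time. -/
theorem ncard_zeros_homotopy_fin {n : ℕ} (H : (Fin (n + 1) → ℝ) → (Fin n → ℝ))
    {O : Set (Fin (n + 1) → ℝ)} (hO : IsOpen O) (hH : ∀ p ∈ O, ContDiffAt ℝ 2 H p)
    (hcomp : IsCompact {p ∈ O | p 0 ∈ Icc (0 : ℝ) 1 ∧ H p = 0})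
    (hreg : ∀ c : ℝ, c = 0 ∨ c = 1 → ∀ u : Fin n → ℝ, Fin.cons c u ∈ O → H (Fin.cons c u) = 0 →
      (fderiv ℝ (fun u : Fin n → ℝ => H (Fin.cons c u)) u).det ≠ 0) :
    ({u : Fin n → ℝ | Fin.cons 0 u ∈ O ∧ H (Fin.cons 0 u) = 0}.ncard : ZMod 2) =
      ({u : Fin n → ℝ | Fin.cons 1 u ∈ O ∧ H (Fin.cons 1 u) = 0}.ncard : ZMod 2) := by
  obtain ⟨L, hLc, hZL, hLO⟩ := exists_compact_between hcomp hO fun p hp => hp.1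
  have hconsc : ∀ c : ℝ, Continuous fun u : Fin n → ℝ => (Fin.cons c u : Fin (n + 1) → ℝ) :=
    fun c => continuous_pi fun i => Fin.cases continuous_const (fun j => continuous_apply j) i
  have hslabc : IsClosed {p : Fin (n + 1) → ℝ | p 0 ∈ Icc (0 : ℝ) 1} :=
    isClosed_Icc.preimage (continuous_apply 0)
  have hHc : ContinuousOn H L := fun p hp => (hH p (hLO hp)).continuousAt.continuousWithinAt
  -- on the boundary of `L` in the slab, `H` is bounded away from zero
  obtain ⟨c₀, hc₀, hbd⟩ : ∃ c > 0, ∀ p ∈ (L \ interior L) ∩ {p | p 0 ∈ Icc (0 : ℝ) 1},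
      c ≤ ‖H p‖ := by
    have hcomp : IsCompact ((L \ interior L) ∩ {p | p 0 ∈ Icc (0 : ℝ) 1}) :=
      (hLc.diff isOpen_interior).inter_right hslabc
    rcases ((L \ interior L) ∩ {p | p 0 ∈ Icc (0 : ℝ) 1}).eq_empty_or_nonempty with he | hne
    · exact ⟨1, one_pos, fun x hx => absurd (he ▸ hx) (notMem_empty x)⟩
    · obtain ⟨x, hx, hmin⟩ := hcomp.exists_isMinOn hne
        (hHc.mono (inter_subset_left.trans sdiff_subset)).norm
      exact ⟨‖H x‖, norm_pos_iff.2 fun h0 => hx.1.2 (hZL ⟨hLO hx.1.1, hx.2, h0⟩),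
        fun y hy => hmin hy⟩
  -- the count on each face as an integral
  have hface : ∀ c : ℝ, c = 0 ∨ c = 1 → ∃ m : ℤ,
      (m : ZMod 2) = ({u : Fin n → ℝ | Fin.cons c u ∈ O ∧ H (Fin.cons c u) = 0}.ncard : ZMod 2) ∧
      ∃ ε > 0, ∀ φ : (Fin n → ℝ) → ℝ, Continuous φ → (∀ v, ε ≤ ‖v‖ → φ v = 0) →
        ∫ u in {u : Fin n → ℝ | Fin.cons c u ∈ L}, φ (H (Fin.cons c u)) *
          (fderiv ℝ (fun u : Fin n → ℝ => H (Fin.cons c u)) u).det = m * ∫ v, φ v := by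
    intro c hc
    have hc01 : c ∈ Icc (0 : ℝ) 1 := by rcases hc with rfl | rfl <;> simp
    have hcl : Topology.IsClosedEmbedding
        fun u : Fin n → ℝ => (Fin.cons c u : Fin (n + 1) → ℝ) := by
      refine Topology.IsClosedEmbedding.of_continuous_injective_isClosedMap (hconsc c)
        (Fin.cons_right_injective (α := fun _ => ℝ) c) fun s hs => ?_
      have : (fun u : Fin n → ℝ => (Fin.cons c u : Fin (n + 1) → ℝ)) '' s =
          {p | p 0 = c} ∩ (fun p : Fin (n + 1) → ℝ => Fin.tail p) ⁻¹' s := by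
        ext p
        constructor
        · rintro ⟨u, hu, rfl⟩
          exact ⟨rfl, hu⟩
        · rintro ⟨rfl, hp⟩
          exact ⟨Fin.tail p, hp, Fin.cons_self_tail p⟩
      rw [this]
      exact (isClosed_singleton.preimage (continuous_apply 0)).inter
        (hs.preimage (continuous_pi fun j => continuous_apply j.succ))
    have hset : {u : Fin n → ℝ | Fin.cons c u ∈ O ∧ H (Fin.cons c u) = 0} =
        {u ∈ {u : Fin n → ℝ | Fin.cons c u ∈ L} | H (Fin.cons c u) = 0} := by
      ext u
      exact ⟨fun h => ⟨(interior_subset (hZL ⟨h.1, hc01, h.2⟩) : _ ∈ L), h.2⟩,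
        fun h => ⟨hLO h.1, h.2⟩⟩
    have hcd : ContDiff ℝ 1 fun u : Fin n → ℝ => (Fin.cons c u : Fin (n + 1) → ℝ) :=
      contDiff_pi.2 fun i => Fin.cases contDiff_const (fun j => contDiff_apply ℝ ℝ j) i
    rw [hset]
    refine exists_int_setIntegral_det_eq volume (hcl.isCompact_preimage hLc) (fun u hu => ?_)
      fun u hu h0 => ⟨?_, hreg c hc u (hLO hu) h0⟩
    · exact ((hH _ (hLO hu)).of_le (by norm_num)).comp u hcd.contDiffAt
    · exact preimage_interior_subset_interior_preimage (hconsc c) (hZL ⟨hLO hu, hc01, h0⟩)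
  obtain ⟨m₀, hm₀, ε₀, hε₀, hint₀⟩ := hface 0 (Or.inl rfl)
  obtain ⟨m₁, hm₁, ε₁, hε₁, hint₁⟩ := hface 1 (Or.inr rfl)
  have hε : 0 < min (c₀ / 2) (min ε₀ ε₁) := lt_min (half_pos hc₀) (lt_min hε₀ hε₁)
  let φ : ContDiffBump (0 : Fin n → ℝ) := ⟨min (c₀ / 2) (min ε₀ ε₁) / 2, _, half_pos hε,
    half_lt_self hε⟩
  have hφ0 : ∀ v, min (c₀ / 2) (min ε₀ ε₁) ≤ ‖v‖ → φ v = 0 := fun v hv =>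
    φ.zero_of_le_dist (by rw [dist_zero_right]; exact hv)
  -- the pull-back of the volume form with density `φ`, cut off outside `L`
  let η₁ : (Fin (n + 1) → ℝ) → (Fin (n + 1) → ℝ) [⋀^Fin n]→L[ℝ] ℝ := fun p =>
    (φ (H p) • stdVolumeForm n).compContinuousLinearMap (fderiv ℝ H p)
  let η := L.indicator η₁
  have hφd : Differentiable ℝ φ := (φ.contDiff (n := 1)).differentiable one_ne_zero
  have hη₁ : ∀ p ∈ O, DifferentiableAt ℝ η₁ p ∧ extDeriv η₁ p = 0 := by
    intro p hp
    have hH2 := hH p hp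
    have hHd : DifferentiableAt ℝ H p := hH2.differentiableAt (by norm_num)
    have hvd : Differentiable ℝ fun v => φ v • stdVolumeForm n :=
      fun v => (hφd v).smul_const _
    refine ⟨?_, ?_⟩
    · refine DifferentiableAt.continuousAlternatingMapCompContinuousLinearMap
        (DifferentiableAt.comp p (hvd (H p)) hHd) ?_
      exact (hH2.fderiv_right (m := 1) (by norm_num)).differentiableAt one_ne_zero
    · refine (extDeriv_pullback (show DifferentiableAt ℝ (fun v => φ v • stdVolumeForm n) (H p)
        from hvd (H p)) hH2 (by simp)).trans ?_
      rw [extDeriv_eq_zero_of_top_degree]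
      rfl
  have hη : ∀ p : Fin (n + 1) → ℝ, p 0 ∈ Icc (0 : ℝ) 1 → η =ᶠ[𝓝 p] 0 ∨
      p ∈ O ∧ η =ᶠ[𝓝 p] η₁ := by
    intro p hp
    by_cases hpL : p ∈ L
    · by_cases hpi : p ∈ interior L
      · refine Or.inr ⟨hLO hpL, ?_⟩
        filter_upwards [isOpen_interior.mem_nhds hpi] with q hq
        exact indicator_of_mem (interior_subset hq) _
      · refine Or.inl ?_
        have h1 : c₀ / 2 < ‖H p‖ := (half_lt_self hc₀).trans_le (hbd p ⟨⟨hpL, hpi⟩, hp⟩)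
        filter_upwards [(hH p (hLO hpL)).continuousAt.norm.eventually_const_lt h1] with q hq
        by_cases hqL : q ∈ L
        · refine (indicator_of_mem hqL _).trans ?_
          simp only [η₁, hφ0 _ ((min_le_left _ _).trans hq.le), zero_smul]
          rfl
        · exact indicator_of_notMem hqL _
    · refine Or.inl ?_
      filter_upwards [hLc.isClosed.isOpen_compl.mem_nhds hpL] with q hq
      exact indicator_of_notMem hq _
  obtain ⟨ρ, hρ0, hρ⟩ := hLc.isBounded.exists_pos_norm_lt
  have hst := integral_slab_faces_eq η hρ0
    (fun p hp => by
      rcases hη p hp with h | ⟨hpO, h⟩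
      · exact h.differentiableAt_iff.2 (differentiableAt_const _)
      · exact h.differentiableAt_iff.2 (hη₁ p hpO).1)
    (fun p hp => by
      rcases hη p hp with h | ⟨hpO, h⟩
      · rw [h.extDeriv_eq]
        ext v
        refine (extDeriv_apply (show DifferentiableAt ℝ (0 : (Fin (n + 1) → ℝ) →
          (Fin (n + 1) → ℝ) [⋀^Fin n]→L[ℝ] ℝ) p from differentiableAt_const _) v).trans ?_
        simp
      · rw [h.extDeriv_eq, (hη₁ p hpO).2])
    (fun p _ ⟨j, hj⟩ => indicator_of_notMem (fun hpL =>
      absurd (hρ p hpL) (not_lt.2 (hj.trans (norm_le_pi_norm p j.succ)))) _)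
  have hηint : ∀ c : ℝ, ∫ u : Fin n → ℝ, η (Fin.cons c u) (fun j => Pi.single j.succ 1) =
      ∫ u in {u : Fin n → ℝ | Fin.cons c u ∈ L}, φ (H (Fin.cons c u)) *
          (fderiv ℝ (fun u : Fin n → ℝ => H (Fin.cons c u)) u).det := by
    intro c
    have hM : MeasurableSet {u : Fin n → ℝ | (Fin.cons c u : Fin (n + 1) → ℝ) ∈ L} :=
      (hLc.isClosed.preimage (hconsc c)).measurableSet
    rw [← integral_indicator hM]
    refine integral_congr_ae (Filter.Eventually.of_forall fun u => ?_)
    by_cases hu : (Fin.cons c u : Fin (n + 1) → ℝ) ∈ L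
    · obtain ⟨T, hT, hTe⟩ := hasFDerivAt_comp_cons
        ((hH _ (hLO hu)).differentiableAt (by norm_num))
      rw [indicator_of_mem (show u ∈ {u : Fin n → ℝ | Fin.cons c u ∈ L} from hu)]
      simp only [η, indicator_of_mem hu]
      rw [hT.fderiv, ← stdVolumeForm_apply_eq_det]
      simp only [hTe]
      rfl
    · rw [indicator_of_notMem (show u ∉ {u : Fin n → ℝ | Fin.cons c u ∈ L} from hu)]
      simp only [η, indicator_of_notMem hu]
      rfl
  rw [hηint, hηint, hint₀ φ φ.continuous fun v hv => hφ0 v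
      (((min_le_right _ _).trans (min_le_left _ _)).trans hv),
    hint₁ φ φ.continuous fun v hv => hφ0 v
      (((min_le_right _ _).trans (min_le_right _ _)).trans hv)] at hst
  have hmm : (m₀ : ℝ) = m₁ := mul_right_cancel₀ (φ.integral_pos (μ := volume)).ne' hst
  rw [← hm₀, ← hm₁, Int.cast_injective hmm]

/-- Homotopy invariance of the parity of the number of zeros: if the zeros of a `C^2` homotopy
`h` of maps between open subsets of a finite-dimensional space form a compact set over the time
interval `[0, 1]`, and all zeros at the times `0` and `1` are regular, then these two times have
the same number of zeros modulo `2`. The domain may vary with time. -/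
theorem ncard_zeros_homotopy {R : Type*} [NormedAddCommGroup R] [NormedSpace ℝ R]
    [FiniteDimensional ℝ R] (h : ℝ × R → R) {O : Set (ℝ × R)} (hO : IsOpen O)
    (hh : ∀ p ∈ O, ContDiffAt ℝ 2 h p)
    (hcomp : IsCompact {p ∈ O | p.1 ∈ Icc (0 : ℝ) 1 ∧ h p = 0})
    (hreg : ∀ c : ℝ, c = 0 ∨ c = 1 → ∀ u : R, (c, u) ∈ O → h (c, u) = 0 →
      Function.Injective (fderiv ℝ (fun u => h (c, u)) u)) :
    ({u : R | (0, u) ∈ O ∧ h (0, u) = 0}.ncard : ZMod 2) =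
      ({u : R | (1, u) ∈ O ∧ h (1, u) = 0}.ncard : ZMod 2) := by
  let n := Module.finrank ℝ R
  let e : R ≃L[ℝ] (Fin n → ℝ) := (Module.finBasis ℝ R).equivFunL
  let ψ : (Fin (n + 1) → ℝ) → ℝ × R := fun p => (p 0, e.symm (Fin.tail p))
  have hψ : ContDiff ℝ 2 ψ := (contDiff_apply ℝ ℝ 0).prodMk
    (e.symm.contDiff.comp (contDiff_pi.2 fun j => contDiff_apply ℝ ℝ j.succ))
  let χ : ℝ × R → (Fin (n + 1) → ℝ) := fun q => Fin.cons q.1 (e q.2)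
  have hχ : Continuous χ := continuous_pi fun i => Fin.cases continuous_fst
    (fun j => (continuous_apply j).comp (e.continuous.comp continuous_snd)) i
  have hψχ : ∀ q, ψ (χ q) = q := fun q => by
    simp only [ψ, χ, Fin.cons_zero, Fin.tail_cons, e.symm_apply_apply]
  have hχψ : ∀ p, χ (ψ p) = p := fun p => by
    simp only [ψ, χ, e.apply_symm_apply, Fin.cons_self_tail]
  have hψcons : ∀ c (u : Fin n → ℝ), ψ (Fin.cons c u) = (c, e.symm u) := fun c u => by
    simp only [ψ, Fin.cons_zero, Fin.tail_cons]
  have hcard : ∀ c, {u : R | (c, u) ∈ O ∧ h (c, u) = 0}.ncard =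
      {u : Fin n → ℝ | Fin.cons c u ∈ ψ ⁻¹' O ∧ e (h (ψ (Fin.cons c u))) = 0}.ncard := by
    intro c
    rw [← Set.ncard_image_of_injective _ e.injective]
    congr 1
    ext u
    simp only [mem_image, mem_ofPred_eq, mem_preimage, hψcons, map_eq_zero_iff e e.injective]
    constructor
    · rintro ⟨v, hv, rfl⟩
      simpa using hv
    · exact fun hu => ⟨e.symm u, hu, e.apply_symm_apply u⟩
  rw [hcard, hcard]
  refine ncard_zeros_homotopy_fin (fun p => e (h (ψ p))) (hO.preimage hψ.continuous)
    (fun p hp => e.contDiff.contDiffAt.comp p ((hh _ hp).comp p hψ.contDiffAt)) ?_ ?_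
  · convert hcomp.image hχ using 1
    ext p
    constructor
    · intro hp
      exact ⟨ψ p, ⟨hp.1, hp.2.1, by simpa using hp.2.2⟩, hχψ p⟩
    · rintro ⟨q, hq, rfl⟩
      refine ⟨by rw [mem_preimage, hψχ]; exact hq.1, hq.2.1, ?_⟩
      simp only [hψχ, hq.2.2, map_zero]
  · intro c hc u hu h0
    simp only [mem_preimage, hψcons, map_eq_zero_iff e e.injective] at hu h0
    have hd : DifferentiableAt ℝ (fun v : R => h (c, v)) (e.symm u) :=
      ((hh _ hu).differentiableAt (by norm_num)).comp _
        ((differentiableAt_const c).prodMk differentiableAt_id)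
    have hfd : HasFDerivAt (fun u : Fin n → ℝ => e (h (ψ (Fin.cons c u))))
        ((e : R →L[ℝ] _) ∘L (fderiv ℝ (fun v : R => h (c, v)) (e.symm u) ∘L
          (e.symm : (Fin n → ℝ) →L[ℝ] R))) u := by
      simp only [hψcons]
      exact e.hasFDerivAt.comp u (hd.hasFDerivAt.comp u e.symm.hasFDerivAt)
    rw [hfd.fderiv]
    intro hdet
    have hker := LinearMap.bot_lt_ker_of_det_eq_zero hdet
    refine hker.ne' (LinearMap.ker_eq_bot.2 ?_)
    exact e.injective.comp ((hreg c hc _ hu h0).comp e.symm.injective)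

end HomotopyParity

/-! ### Operators of index zero -/

section IndexZero

/-- A Fredholm operator of index zero becomes bijective after adding a suitable operator of finite
rank, namely one that maps the kernel isomorphically onto a complement of the range. The operator
`T` is read in a normed space through the isomorphism `e`. -/
theorem exists_finiteRank_bijective_add {X Y F : Type*} [NormedAddCommGroup X] [NormedSpace ℝ X]
    [AddCommGroup Y] [Module ℝ Y] [TopologicalSpace Y] [NormedAddCommGroup F] [NormedSpace ℝ F]
    (T : X →L[ℝ] Y) (hT : T.IsFredholm) (hindex : fredholmIndex T = 0) (e : Y ≃L[ℝ] F) :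
    ∃ K : X →L[ℝ] F, FiniteDimensional ℝ K.range ∧
      Function.Bijective ((e : Y →L[ℝ] F) ∘L T + K) := by
  have := hT.finite_ker
  have : Module.Finite ℝ (Y ⧸ T.range) := hT.finite_coker
  obtain ⟨p, hp⟩ := hT.closedComplemented_ker
  obtain ⟨C, hC⟩ := T.range.exists_isCompl
  let q : (Y ⧸ T.range) ≃ₗ[ℝ] C := T.range.quotientEquivOfIsCompl C hC
  have : FiniteDimensional ℝ C := Module.Finite.equiv q
  have hdim : Module.finrank ℝ T.ker = Module.finrank ℝ C := by
    rw [← q.finrank_eq]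
    simpa [fredholmIndex, sub_eq_zero] using hindex
  let i : T.ker ≃ₗ[ℝ] C := LinearEquiv.ofFinrankEq _ _ hdim
  let κ : T.ker →L[ℝ] F :=
    LinearMap.toContinuousLinearMap ((e : Y →ₗ[ℝ] F) ∘ₗ C.subtype ∘ₗ (i : T.ker →ₗ[ℝ] C))
  have hκ : ∀ k, κ k = e (i k) := fun k => rfl
  refine ⟨κ ∘L p, ?_, ?_⟩
  · refine Submodule.finiteDimensional_of_le (S₂ := LinearMap.range (κ : T.ker →ₗ[ℝ] F)) ?_
    rintro _ ⟨x, rfl⟩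
    exact ⟨p x, rfl⟩
  have happ : ∀ x, ((e : Y →L[ℝ] F) ∘L T + κ ∘L p) x = e (T x + i (p x)) := fun x => by
    rw [map_add]; rfl
  constructor
  · refine (injective_iff_map_eq_zero _).2 fun x hx => ?_
    rw [happ, map_eq_zero_iff e e.injective] at hx
    have h1 : T x ∈ T.range ⊓ C := ⟨⟨x, rfl⟩, by
      rw [eq_neg_of_add_eq_zero_left hx]; exact C.neg_mem (i (p x)).2⟩
    rw [hC.inf_eq_bot, Submodule.mem_bot] at h1
    rw [h1, zero_add] at hx
    have h2 : p x = 0 := i.injective (by rw [map_zero]; exact Subtype.ext hx)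
    have h3 := hp ⟨x, h1⟩
    rw [h2] at h3
    exact (congrArg Subtype.val h3).symm
  · intro y
    obtain ⟨_, ⟨x, rfl⟩, c, hc, hy⟩ := Submodule.mem_sup.1
      (hC.sup_eq_top ▸ Submodule.mem_top : e.symm y ∈ T.range ⊔ C)
    refine ⟨x - p x + i.symm ⟨c, hc⟩, ?_⟩
    have h1 : T (x - p x + i.symm ⟨c, hc⟩) = T x := by
      rw [map_add, map_sub, show T (p x) = 0 from (p x).2,
        show T (i.symm ⟨c, hc⟩) = 0 from (i.symm ⟨c, hc⟩).2, sub_zero, add_zero]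
    have h2 : p (x - p x + i.symm ⟨c, hc⟩) = i.symm ⟨c, hc⟩ := by
      rw [map_add, map_sub, hp, hp, sub_self, zero_add]
    rw [happ, h1, h2, i.apply_symm_apply]
    exact (congrArg e hy).trans (e.apply_symm_apply y)

/-- Reduction of the bijectivity of `A - K` to a finite-dimensional space containing the range of
`K`, where `A` is invertible. -/
theorem bijective_sub_iff_injective_restrict {X F : Type*} [AddCommGroup X] [Module ℝ X]
    [AddCommGroup F] [Module ℝ F] (A : X ≃ₗ[ℝ] F) (K : X →ₗ[ℝ] F) (R : Submodule ℝ F)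
    [FiniteDimensional ℝ R] (hK : ∀ x, K x ∈ R) :
    Function.Bijective (fun x => A x - K x) ↔
      Function.Injective (fun r : R => (r : F) - K (A.symm r)) := by
  constructor
  · intro h r r' hr
    have := h.1 (a₁ := A.symm r) (a₂ := A.symm r') (by simpa using hr)
    exact Subtype.ext (A.symm.injective this)
  · intro h
    let G : R →ₗ[ℝ] R := LinearMap.id - (K ∘ₗ (A.symm : F →ₗ[ℝ] X) ∘ₗ R.subtype).codRestrict R
      fun r => hK _
    have hG : ∀ r : R, (G r : F) = r - K (A.symm r) := fun r => rfl
    have hGi : Function.Injective G := fun r r' hr =>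
      h (by simpa only [← hG] using congrArg Subtype.val hr)
    constructor
    · intro x x' hx
      have hx0 : A (x - x') = K (x - x') := by
        rw [map_sub, map_sub]
        have : A x - K x = A x' - K x' := hx
        rw [sub_eq_sub_iff_add_eq_add] at this ⊢
        rw [this, add_comm]
      have h0 : (⟨A (x - x'), hx0 ▸ hK _⟩ : R) = 0 := hGi (by
        refine Subtype.ext ?_
        rw [hG, map_zero]
        simp only [A.symm_apply_apply]
        rw [hx0, sub_self]; rfl)
      have h1 : A (x - x') = 0 := congrArg Subtype.val h0
      exact sub_eq_zero.1 ((map_eq_zero_iff A A.injective).1 h1)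
    · intro y
      obtain ⟨r, hr⟩ := (LinearMap.injective_iff_surjective.1 hGi) ⟨K (A.symm y), hK _⟩
      have hr' := congrArg Subtype.val hr
      rw [hG] at hr'
      refine ⟨A.symm (y + r), ?_⟩
      simp only [A.apply_symm_apply, map_add]
      simp only at hr'
      rw [← hr']
      abel

end IndexZero

/-! ### Families of maps between Banach spaces and their reduction to finite dimension -/

section BanachFamilies

variable {Q X F : Type*} [NormedAddCommGroup Q] [NormedSpace ℝ Q] [NormedAddCommGroup X]
  [NormedSpace ℝ X] [NormedAddCommGroup F] [NormedSpace ℝ F]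

/-- The partial derivative of `f : Q × X → F` in the second variable. -/
noncomputable def fiberDeriv (f : Q × X → F) (p : Q × X) : X →L[ℝ] F :=
  fderiv ℝ f p ∘L ContinuousLinearMap.inr ℝ Q X

/-- The map over the parameter space `Q` defined by a family `f` of maps `X → F`. -/
def fiberMap (f : Q × X → F) (p : Q × X) : Q × F := (p.1, f p)

theorem hasFDerivAt_fiberDeriv {f : Q × X → F} {p : Q × X} (hf : DifferentiableAt ℝ f p) :
    HasFDerivAt (fun x => f (p.1, x)) (fiberDeriv f p) p.2 := by
  have h : HasFDerivAt (fun x : X => (p.1, x)) (ContinuousLinearMap.inr ℝ Q X) p.2 :=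
    hasFDerivAt_prodMk_right p.1 p.2
  exact HasFDerivAt.comp p.2 (f := fun x : X => (p.1, x)) hf.hasFDerivAt h

theorem continuousAt_fiberDeriv {f : Q × X → F} {p : Q × X} (hf : ContDiffAt ℝ 2 f p) :
    ContinuousAt (fiberDeriv f) p :=
  ((hf.fderiv_right (m := 0) (by norm_num)).continuousAt).clm_comp continuousAt_const

theorem contDiffAt_fiberMap {f : Q × X → F} {p : Q × X} (hf : ContDiffAt ℝ 2 f p) :
    ContDiffAt ℝ 2 (fiberMap f) p :=
  contDiffAt_fst.prodMk hf

variable [CompleteSpace X] [CompleteSpace F]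

/-- Invertibility of the partial derivative is an open condition. -/
theorem eventually_bijective_fiberDeriv {f : Q × X → F} {p : Q × X} (hf : ContDiffAt ℝ 2 f p)
    (hb : Function.Bijective (fiberDeriv f p)) :
    ∀ᶠ p' in 𝓝 p, Function.Bijective (fiberDeriv f p') := by
  let A := ContinuousLinearEquiv.ofBijective (fiberDeriv f p)
    (LinearMap.ker_eq_bot.2 hb.1) (LinearMap.range_eq_top.2 hb.2)
  have hA : (A : X →L[ℝ] F) = fiberDeriv f p := by ext; rfl
  have := (continuousAt_fiberDeriv hf).eventually (hA ▸ A.nhds)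
  filter_upwards [this] with p' hp'
  obtain ⟨A', hA'⟩ := hp'
  have : (fiberDeriv f p' : X → F) = A' := by rw [← hA']; rfl
  rw [this]
  exact A'.bijective

variable [CompleteSpace Q]

theorem exists_equiv_hasFDerivAt_fiberMap {f : Q × X → F} {p : Q × X}
    (hf : DifferentiableAt ℝ f p) (hb : Function.Bijective (fiberDeriv f p)) :
    ∃ A : (Q × X) ≃L[ℝ] (Q × F), HasFDerivAt (fiberMap f) (A : (Q × X) →L[ℝ] (Q × F)) p := by
  let T : (Q × X) →L[ℝ] (Q × F) := (ContinuousLinearMap.fst ℝ Q X).prod (fderiv ℝ f p)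
  have hT : ∀ q x, T (q, x) = (q, fderiv ℝ f p (q, 0) + fiberDeriv f p x) := fun q x => by
    have : ((q, x) : Q × X) = (q, 0) + (0, x) := by simp
    change (q, fderiv ℝ f p (q, x)) = _
    rw [this, map_add]
    rfl
  have hi : Function.Injective T := by
    rintro ⟨q, x⟩ ⟨q', x'⟩ h
    rw [hT, hT, Prod.mk.injEq] at h
    obtain ⟨rfl, h⟩ := h
    rw [hb.1 (add_left_cancel h)]
  have hs : Function.Surjective T := by
    rintro ⟨q, y⟩
    obtain ⟨x, hx⟩ := hb.2 (y - fderiv ℝ f p (q, 0))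
    exact ⟨(q, x), by rw [hT, hx, add_sub_cancel]⟩
  refine ⟨ContinuousLinearEquiv.ofBijective T (LinearMap.ker_eq_bot.2 hi)
    (LinearMap.range_eq_top.2 hs), ?_⟩
  exact hasFDerivAt_fst.prodMk hf.hasFDerivAt

theorem exists_mem_nhds_injOn_fiberMap {f : Q × X → F} {p : Q × X} (hf : ContDiffAt ℝ 2 f p)
    (hb : Function.Bijective (fiberDeriv f p)) : ∃ U ∈ 𝓝 p, InjOn (fiberMap f) U := by
  obtain ⟨A, hA⟩ := exists_equiv_hasFDerivAt_fiberMap (hf.differentiableAt (by norm_num)) hb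
  let Φ := (contDiffAt_fiberMap hf).toOpenPartialHomeomorph _ hA (by norm_num)
  exact ⟨Φ.source, Φ.open_source.mem_nhds
    (ContDiffAt.mem_toOpenPartialHomeomorph_source _ hA (by norm_num)), Φ.injOn⟩

/-- Near a regular zero, the zeros of a family form the graph of a continuous function of the
parameter. -/
theorem exists_local_zero_graph {f : Q × X → F} {p : Q × X} (hf : ContDiffAt ℝ 2 f p)
    (hb : Function.Bijective (fiberDeriv f p)) (h0 : f p = 0) :
    ∃ g : Q → X, ContinuousAt g p.1 ∧ g p.1 = p.2 ∧
      ∀ᶠ p' in 𝓝 p, f p' = 0 ↔ p'.2 = g p'.1 := by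
  obtain ⟨A, hA⟩ := exists_equiv_hasFDerivAt_fiberMap (hf.differentiableAt (by norm_num)) hb
  let Φ := (contDiffAt_fiberMap hf).toOpenPartialHomeomorph _ hA (by norm_num)
  have hp : p ∈ Φ.source := ContDiffAt.mem_toOpenPartialHomeomorph_source _ hA (by norm_num)
  have hΦ : ∀ p', Φ p' = (p'.1, f p') := fun _ => rfl
  have hΦp : Φ p = (p.1, 0) := by rw [hΦ, h0]
  have ht : ((p.1, 0) : Q × F) ∈ Φ.target := hΦp ▸ Φ.map_source hp
  have hsymm : Φ.symm (p.1, 0) = p := by rw [← hΦp, Φ.left_inv hp]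
  have hc : Continuous fun q : Q => ((q, 0) : Q × F) := by fun_prop
  refine ⟨fun q => (Φ.symm (q, 0)).2, ?_, by simp only [hsymm], ?_⟩
  · exact continuousAt_snd.comp
      (ContinuousAt.comp (f := fun q : Q => ((q, 0) : Q × F)) (Φ.continuousAt_symm ht)
        hc.continuousAt)
  · have h1 : ∀ᶠ p' in 𝓝 p, ((p'.1, 0) : Q × F) ∈ Φ.target :=
      (hc.comp continuous_fst).continuousAt.eventually (Φ.open_target.mem_nhds ht)
    filter_upwards [h1, Φ.open_source.mem_nhds hp] with p' hp't hp's
    constructor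
    · intro hz
      have : Φ p' = (p'.1, 0) := by rw [hΦ, hz]
      rw [← this, Φ.left_inv hp's]
    · intro hz
      have h2 := Φ.right_inv hp't
      rw [hΦ, Prod.mk.injEq] at h2
      have : Φ.symm (p'.1, 0) = p' := Prod.ext h2.1 hz.symm
      rw [← this]
      exact h2.2

/-- An injective family of local diffeomorphisms has an inverse family on an open set. -/
theorem exists_fiberwise_inverse {Ψ : Q × X → F} {D : Set (Q × X)} (hD : IsOpen D)
    (hΨ : ∀ p ∈ D, ContDiffAt ℝ 2 Ψ p) (hb : ∀ p ∈ D, Function.Bijective (fiberDeriv Ψ p))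
    (hinj : InjOn (fiberMap Ψ) D) :
    IsOpen (fiberMap Ψ '' D) ∧ ∃ Y : Q × F → X, (∀ p ∈ D, Y (fiberMap Ψ p) = p.2) ∧
      (∀ w ∈ fiberMap Ψ '' D, ContDiffAt ℝ 2 Y w) ∧
      ∀ p ∈ D, ∀ v, fiberDeriv Y (fiberMap Ψ p) (fiberDeriv Ψ p v) = v := by
  have hopen : IsOpen (fiberMap Ψ '' D) := by
    refine isOpen_iff_mem_nhds.2 ?_
    rintro _ ⟨p, hp, rfl⟩
    obtain ⟨A, hA⟩ :=
      exists_equiv_hasFDerivAt_fiberMap ((hΨ p hp).differentiableAt (by norm_num)) (hb p hp)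
    rw [← ((contDiffAt_fiberMap (hΨ p hp)).hasStrictFDerivAt' hA
      (by norm_num)).map_nhds_eq_of_equiv]
    exact Filter.image_mem_map (hD.mem_nhds hp)
  have hleft : ∀ p ∈ D, (Function.invFunOn (fiberMap Ψ) D (fiberMap Ψ p)) = p := fun p hp =>
    hinj.leftInvOn_invFunOn hp
  have hsm : ∀ w ∈ fiberMap Ψ '' D,
      ContDiffAt ℝ 2 (fun w => (Function.invFunOn (fiberMap Ψ) D w).2) w := by
    rintro _ ⟨p, hp, rfl⟩
    obtain ⟨A, hA⟩ :=
      exists_equiv_hasFDerivAt_fiberMap ((hΨ p hp).differentiableAt (by norm_num)) (hb p hp)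
    have hc := contDiffAt_fiberMap (hΨ p hp)
    have hst := hc.hasStrictFDerivAt' hA (by norm_num)
    refine contDiffAt_snd.comp _ ((hc.to_localInverse hA (by norm_num)).congr_of_eventuallyEq ?_)
    have h1 : ∀ᶠ w in 𝓝 (fiberMap Ψ p), hst.localInverse (fiberMap Ψ) A p w ∈ D :=
      hst.localInverse_tendsto.eventually (hD.mem_nhds hp)
    filter_upwards [h1, hst.eventually_right_inverse] with w hwD hw
    have := hleft _ hwD
    rw [hw] at this
    exact this
  refine ⟨hopen, fun w => (Function.invFunOn (fiberMap Ψ) D w).2,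
    fun p hp => congrArg Prod.snd (hleft p hp), hsm, fun p hp v => ?_⟩
  have hY := hasFDerivAt_fiberDeriv
    ((hsm _ (mem_image_of_mem _ hp)).differentiableAt (by norm_num))
  have hcomp := HasFDerivAt.comp p.2 hY
    (hasFDerivAt_fiberDeriv ((hΨ p hp).differentiableAt (by norm_num)))
  have hid : (fun x : X => (Function.invFunOn (fiberMap Ψ) D (p.1, Ψ (p.1, x))).2)
      =ᶠ[𝓝 p.2] id := by
    have : ∀ᶠ x in 𝓝 p.2, ((p.1, x) : Q × X) ∈ D :=
      (Continuous.prodMk_right p.1).continuousAt.eventually (hD.mem_nhds hp)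
    filter_upwards [this] with x hx
    exact congrArg Prod.snd (hleft _ hx)
  have := hcomp.unique ((hasFDerivAt_id p.2).congr_of_eventuallyEq hid)
  exact congrArg (fun T : X →L[ℝ] X => T v) this

/-- An open set `D` on which the family `f` becomes, after adding the fixed operator `K`, an
injective family of local diffeomorphisms. When `K` has finite rank, the zeros of `f` in `D` are
described by finitely many equations in finitely many unknowns. -/
structure IsReductionDomain (f : Q × X → F) (K : X →L[ℝ] F) (D : Set (Q × X)) : Prop where
  isOpen : IsOpen D
  contDiffAt : ∀ p ∈ D, ContDiffAt ℝ 2 f p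
  bijective : ∀ p ∈ D, Function.Bijective (fiberDeriv f p + K)
  injOn : InjOn (fun p : Q × X => (p.1, f p + K p.2)) D

omit [CompleteSpace X] [CompleteSpace F] [CompleteSpace Q] in
theorem fiberDeriv_add_clm {f : Q × X → F} (K : X →L[ℝ] F) {p : Q × X}
    (hf : DifferentiableAt ℝ f p) :
    fiberDeriv (fun p => f p + K p.2) p = fiberDeriv f p + K := by
  have h : HasFDerivAt (fun p : Q × X => f p + K p.2)
      (fderiv ℝ f p + K ∘L ContinuousLinearMap.snd ℝ Q X) p :=
    hf.hasFDerivAt.add (K.hasFDerivAt.comp p hasFDerivAt_snd)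
  ext v
  simp [fiberDeriv, h.fderiv]

/-- Lyapunov–Schmidt reduction. On a reduction domain take `u = f + K` as the new coordinate. The
zeros of `f` are the points with `u = K x`, so they have `u ∈ R`, where `R` is a finite-dimensional
space containing the range of `K`; in the coordinate `u ∈ R` they are the zeros of a `C^2` map with
values in `R`, and regular zeros correspond to regular zeros. -/
theorem IsReductionDomain.exists_reduced_map {f : Q × X → F} {K : X →L[ℝ] F} {D : Set (Q × X)}
    (hD : IsReductionDomain f K D) (R : Submodule ℝ F) [FiniteDimensional ℝ R]
    (hK : ∀ x, K x ∈ R) :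
    IsOpen {w : Q × R | ∃ p ∈ D, p.1 = w.1 ∧ f p + K p.2 = w.2} ∧
    ∃ (Y : Q × R → X) (h : Q × R → R),
      (∀ w : Q × R, (∃ p ∈ D, p.1 = w.1 ∧ f p + K p.2 = w.2) →
        ContinuousAt Y w ∧ ContDiffAt ℝ 2 h w) ∧
      ∀ p ∈ D, ∀ r : R, f p + K p.2 = r → Y (p.1, r) = p.2 ∧ (h (p.1, r) : F) = f p ∧
        (Function.Bijective (fiberDeriv f p) ↔ Function.Injective (fiberDeriv h (p.1, r))) := by
  let Ψ : Q × X → F := fun p => f p + K p.2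
  have hΨd : ∀ p ∈ D, fiberDeriv Ψ p = fiberDeriv f p + K := fun p hp =>
    fiberDeriv_add_clm K ((hD.contDiffAt p hp).differentiableAt (by norm_num))
  obtain ⟨hopen, Y, hY, hYc, hYd⟩ := exists_fiberwise_inverse (Ψ := Ψ) hD.isOpen
    (fun p hp => (hD.contDiffAt p hp).add (K.contDiff.contDiffAt.comp p contDiffAt_snd))
    (fun p hp => by rw [hΨd p hp]; exact hD.bijective p hp) hD.injOn
  let J : Q × R →L[ℝ] Q × F :=
    (ContinuousLinearMap.fst ℝ Q R).prod (R.subtypeL ∘L ContinuousLinearMap.snd ℝ Q R)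
  have hJ : ∀ w : Q × R, J w = (w.1, (w.2 : F)) := fun _ => rfl
  have hset : {w : Q × R | ∃ p ∈ D, p.1 = w.1 ∧ f p + K p.2 = w.2} = J ⁻¹' (fiberMap Ψ '' D) := by
    ext w
    simp only [mem_ofPred_eq, mem_preimage, mem_image, hJ, fiberMap, Prod.mk.injEq, Ψ]
  let K' : X →L[ℝ] R := K.codRestrict R hK
  let h : Q × R → R := fun w => w.2 - K' (Y (J w))
  have hYJ : ∀ w : Q × R, (∃ p ∈ D, p.1 = w.1 ∧ f p + K p.2 = w.2) →
      ContDiffAt ℝ 2 (fun w => Y (J w)) w := by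
    intro w hw
    have : J w ∈ fiberMap Ψ '' D := by
      have h1 : w ∈ {w : Q × R | ∃ p ∈ D, p.1 = w.1 ∧ f p + K p.2 = w.2} := hw
      rwa [hset] at h1
    exact (hYc _ this).comp w J.contDiff.contDiffAt
  refine ⟨hset ▸ hopen.preimage J.continuous, fun w => Y (J w), h,
    fun w hw => ⟨(hYJ w hw).continuousAt,
      contDiffAt_snd.sub (K'.contDiff.contDiffAt.comp w (hYJ w hw))⟩, fun p hp r hr => ?_⟩
  have hJp : J (p.1, r) = fiberMap Ψ p := by
    rw [hJ]
    exact Prod.ext rfl hr.symm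
  have hYp : Y (J (p.1, r)) = p.2 := by rw [hJp, hY p hp]
  refine ⟨hYp, ?_, ?_⟩
  · change (r : F) - K (Y (J (p.1, r))) = f p
    rw [hYp, ← hr, add_sub_cancel_right]
  let A : X ≃ₗ[ℝ] F := LinearEquiv.ofBijective (fiberDeriv f p + K : X →ₗ[ℝ] F)
    (hD.bijective p hp)
  have hA : ∀ v, A v = fiberDeriv f p v + K v := fun _ => rfl
  have hAsymm : ∀ y, fiberDeriv Y (fiberMap Ψ p) y = A.symm y := by
    intro y
    have := hYd p hp (A.symm y)
    rw [hΨd p hp] at this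
    rw [← this]
    congr 1
    exact (A.apply_symm_apply y).symm
  have hw : ∃ p' ∈ D, p'.1 = ((p.1, r) : Q × R).1 ∧ f p' + K p'.2 = ((p.1, r) : Q × R).2 :=
    ⟨p, hp, rfl, hr⟩
  have hhd : ∀ v : R, ((fiberDeriv h (p.1, r) v : R) : F) = v - K (A.symm v) := by
    intro v
    have h1 : HasFDerivAt (fun w => Y (J w)) (fderiv ℝ Y (fiberMap Ψ p) ∘L J) (p.1, r) := by
      have := ((hYc _ (mem_image_of_mem _ hp)).differentiableAt (by norm_num)).hasFDerivAt
      rw [← hJp] at this ⊢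
      exact this.comp _ J.hasFDerivAt
    have h2 : HasFDerivAt h (ContinuousLinearMap.snd ℝ Q R -
        K' ∘L (fderiv ℝ Y (fiberMap Ψ p) ∘L J)) (p.1, r) :=
      hasFDerivAt_snd.sub (K'.hasFDerivAt.comp _ h1)
    rw [← hAsymm]
    simp only [fiberDeriv, h2.fderiv]
    rfl
  have hb := bijective_sub_iff_injective_restrict A (K : X →ₗ[ℝ] F) R hK
  have h3 : (fun x => A x - (K : X →ₗ[ℝ] F) x) = fiberDeriv f p := by
    ext x
    rw [hA]
    exact add_sub_cancel_right _ _
  have h4 : (fun r : R => (r : F) - (K : X →ₗ[ℝ] F) (A.symm r)) =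
      Subtype.val ∘ fiberDeriv h (p.1, r) := by
    ext v
    exact (hhd v).symm
  rw [h3, h4] at hb
  exact hb.trans ⟨fun h => Function.Injective.of_comp h,
    fun h => Subtype.val_injective.comp h⟩

end BanachFamilies

section ReductionConsequences

variable {Q X F : Type*} [NormedAddCommGroup Q] [NormedSpace ℝ Q] [NormedAddCommGroup X]
  [NormedSpace ℝ X] [NormedAddCommGroup F] [NormedSpace ℝ F] [CompleteSpace X] [CompleteSpace F]

/-- The zero set of a family is locally compact in a reduction domain. -/
theorem IsReductionDomain.exists_isCompact_zeros [FiniteDimensional ℝ Q] {f : Q × X → F}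
    {K : X →L[ℝ] F} {D : Set (Q × X)} (hD : IsReductionDomain f K D)
    [FiniteDimensional ℝ K.range] {p : Q × X} (hp : p ∈ D) (h0 : f p = 0) :
    ∃ C, IsCompact C ∧ C ⊆ {p ∈ D | f p = 0} ∧ ∃ O ∈ 𝓝 p, ∀ p' ∈ O, f p' = 0 → p' ∈ C := by
  have := FiniteDimensional.complete ℝ Q
  have := FiniteDimensional.proper_real (Q × K.range)
  obtain ⟨hΩ, Y, h, hYh, hred⟩ := hD.exists_reduced_map K.range fun x => ⟨x, rfl⟩
  let K' : X →L[ℝ] K.range := K.codRestrict K.range fun x => ⟨x, rfl⟩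
  have hz : ∀ p ∈ D, f p = 0 → f p + K p.2 = K' p.2 := fun p _ h => by rw [h, zero_add]; rfl
  have hmem : ((p.1, K' p.2) : Q × K.range) ∈
      {w : Q × K.range | ∃ p ∈ D, p.1 = w.1 ∧ f p + K p.2 = w.2} := ⟨p, hp, rfl, hz p hp h0⟩
  obtain ⟨N, hN, hNΩ, hNc⟩ := local_compact_nhds (hΩ.mem_nhds hmem)
  have hhc : ContinuousOn h N := fun w hw =>
    (hYh w (hNΩ hw)).2.continuousAt.continuousWithinAt
  have hYc : ContinuousOn Y N := fun w hw => (hYh w (hNΩ hw)).1.continuousWithinAt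
  have hC : IsCompact {w ∈ N | h w = 0} := hNc.of_isClosed_subset
    (hhc.preimage_isClosed_of_isClosed hNc.isClosed isClosed_singleton) (sep_subset _ _)
  refine ⟨(fun w : Q × K.range => (w.1, Y w)) '' {w ∈ N | h w = 0},
    hC.image_of_continuousOn (continuousOn_fst.prodMk (hYc.mono (sep_subset _ _))), ?_,
    D ∩ (fun p : Q × X => (p.1, K' p.2)) ⁻¹' N, Filter.inter_mem (hD.isOpen.mem_nhds hp) ?_, ?_⟩
  · rintro _ ⟨w, ⟨hwN, hw0⟩, rfl⟩
    obtain ⟨p, hpD, hp1, hp2⟩ := hNΩ hwN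
    obtain ⟨hY, hf, -⟩ := hred p hpD w.2 hp2
    have hw : (p.1, w.2) = w := Prod.ext hp1 rfl
    rw [hw] at hY hf
    have : (w.1, Y w) = p := Prod.ext hp1.symm hY
    simp only [this]
    exact ⟨hpD, by rw [← hf, hw0]; rfl⟩
  · have : Continuous fun p : Q × X => (p.1, K' p.2) := by fun_prop
    exact this.continuousAt hN
  · rintro p' ⟨hpD, hpN⟩ hp0
    obtain ⟨hY, hf, -⟩ := hred p' hpD (K' p'.2) (hz p' hpD hp0)
    exact ⟨(p'.1, K' p'.2), ⟨hpN, Subtype.ext (hf.trans hp0)⟩, Prod.ext rfl hY⟩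

/-- Homotopy invariance of the parity of the number of zeros in a reduction domain. -/
theorem IsReductionDomain.ncard_zeros_eq {f : ℝ × X → F} {K : X →L[ℝ] F} {D : Set (ℝ × X)}
    (hD : IsReductionDomain f K D) [FiniteDimensional ℝ K.range]
    (hcomp : IsCompact {p ∈ D | p.1 ∈ Icc (0 : ℝ) 1 ∧ f p = 0})
    (hreg : ∀ c : ℝ, c = 0 ∨ c = 1 → ∀ x : X, (c, x) ∈ D → f (c, x) = 0 →
      Function.Bijective (fiberDeriv f (c, x))) :
    ({x : X | (0, x) ∈ D ∧ f (0, x) = 0}.ncard : ZMod 2) =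
      ({x : X | (1, x) ∈ D ∧ f (1, x) = 0}.ncard : ZMod 2) := by
  obtain ⟨hΩ, Y, h, hYh, hred⟩ := hD.exists_reduced_map K.range fun x => ⟨x, rfl⟩
  let K' : X →L[ℝ] K.range := K.codRestrict K.range fun x => ⟨x, rfl⟩
  have hz : ∀ p ∈ D, f p = 0 → f p + K p.2 = K' p.2 := fun p _ h => by rw [h, zero_add]; rfl
  -- zeros of the reduced map come from zeros of `f`
  have hback : ∀ w : ℝ × K.range, (∃ p ∈ D, p.1 = w.1 ∧ f p + K p.2 = w.2) → h w = 0 →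
      ∃ p ∈ D, f p = 0 ∧ (p.1, K' p.2) = w := by
    rintro w ⟨p, hpD, hp1, hp2⟩ hw
    obtain ⟨hY, hf, -⟩ := hred p hpD w.2 hp2
    rw [show (p.1, w.2) = w from Prod.ext hp1 rfl] at hf
    have h0 : f p = 0 := by rw [← hf, hw]; rfl
    rw [h0, zero_add] at hp2
    exact ⟨p, hpD, h0, Prod.ext hp1 (Subtype.ext hp2)⟩
  have hforth : ∀ p ∈ D, f p = 0 → (∃ p' ∈ D, p'.1 = ((p.1, K' p.2) : ℝ × K.range).1 ∧
      f p' + K p'.2 = ((p.1, K' p.2) : ℝ × K.range).2) ∧ h (p.1, K' p.2) = 0 := fun p hpD hp0 =>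
    ⟨⟨p, hpD, rfl, hz p hpD hp0⟩,
      Subtype.ext ((hred p hpD _ (hz p hpD hp0)).2.1.trans hp0)⟩
  have hcard : ∀ c : ℝ, {x : X | (c, x) ∈ D ∧ f (c, x) = 0}.ncard =
      {u : K.range | ((c, u) : ℝ × K.range) ∈
        {w : ℝ × K.range | ∃ p ∈ D, p.1 = w.1 ∧ f p + K p.2 = w.2} ∧ h (c, u) = 0}.ncard := by
    intro c
    rw [← Set.InjOn.ncard_image (f := K') (s := {x : X | (c, x) ∈ D ∧ f (c, x) = 0})]
    · congr 1
      ext u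
      constructor
      · rintro ⟨x, ⟨hxD, hx0⟩, rfl⟩
        exact hforth (c, x) hxD hx0
      · rintro ⟨hu, hu0⟩
        obtain ⟨p, hpD, hp0, hp⟩ := hback _ hu hu0
        rw [Prod.mk.injEq] at hp
        obtain ⟨rfl, rfl⟩ := hp
        exact ⟨p.2, ⟨hpD, hp0⟩, rfl⟩
    · intro x hx x' hx' hxx
      have := hD.injOn hx.1 hx'.1 (Prod.ext rfl (by
        simp only [hx.2, hx'.2, zero_add]
        exact congrArg Subtype.val hxx))
      exact congrArg Prod.snd this
  rw [hcard, hcard]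
  refine ncard_zeros_homotopy h hΩ (fun w hw => (hYh w hw).2) ?_ ?_
  · have hc : Continuous fun p : ℝ × X => (p.1, K' p.2) := by fun_prop
    convert hcomp.image hc using 1
    ext w
    constructor
    · rintro ⟨hw, hw1, hw0⟩
      obtain ⟨p, hpD, hp0, rfl⟩ := hback w hw hw0
      exact ⟨p, ⟨hpD, hw1, hp0⟩, rfl⟩
    · rintro ⟨p, ⟨hpD, hp1, hp0⟩, rfl⟩
      exact ⟨(hforth p hpD hp0).1, hp1, (hforth p hpD hp0).2⟩
  · intro c hc u hu hu0
    have hd := hasFDerivAt_fiberDeriv ((hYh _ hu).2.differentiableAt (by norm_num))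
    rw [hd.fderiv]
    obtain ⟨p, hpD, hp0, hp⟩ := hback _ hu hu0
    rw [← hp]
    refine ((hred p hpD _ (hz p hpD hp0)).2.2).1 ?_
    have hpc : p.1 = c := congrArg Prod.fst hp
    exact hreg p.1 (hpc ▸ hc) p.2 hpD hp0

/-- Sard's theorem in a reduction domain: for a dense set of constants `r` in the range of `K`,
all zeros of `f + r` are regular. -/
theorem IsReductionDomain.dense_regular_values [CompleteSpace Q] {f : Q × X → F} {K : X →L[ℝ] F}
    {D : Set (Q × X)} (hD : IsReductionDomain f K D) [FiniteDimensional ℝ K.range] (q : Q) :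
    Dense {r : K.range | ∀ x, (q, x) ∈ D → f (q, x) + r = 0 →
      Function.Bijective (fiberDeriv f (q, x))} := by
  obtain ⟨hΩ, Y, h, hYh, hred⟩ := hD.exists_reduced_map K.range fun x => ⟨x, rfl⟩
  let K' : X →L[ℝ] K.range := K.codRestrict K.range fun x => ⟨x, rfl⟩
  let : MeasurableSpace K.range := borel K.range
  have : BorelSpace K.range := ⟨rfl⟩
  let μ : MeasureTheory.Measure K.range := MeasureTheory.Measure.addHaar
  let S : Set K.range := {u | (∃ p ∈ D, p.1 = q ∧ f p + K p.2 = u) ∧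
    (fiberDeriv h (q, u)).det = 0}
  have hS : μ ((fun u => h (q, u)) '' S) = 0 := by
    refine MeasureTheory.addHaar_image_eq_zero_of_det_fderivWithin_eq_zero μ
      (f' := fun u => fiberDeriv h (q, u)) (fun u hu => ?_) fun u hu => hu.2
    exact (hasFDerivAt_fiberDeriv (p := (q, u))
      ((hYh (q, u) hu.1).2.differentiableAt (by norm_num))).hasFDerivWithinAt
  have hS' : ∀ᵐ r ∂μ, -r ∉ (fun u => h (q, u)) '' S := by
    have := (MeasureTheory.Measure.measurePreserving_neg μ).quasiMeasurePreserving.ae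
      (MeasureTheory.measure_eq_zero_iff_ae_notMem.1 hS)
    exact this
  refine (MeasureTheory.Measure.dense_of_ae hS').mono fun r hr x hxD hx0 => ?_
  have hu : f (q, x) + K x = ((K' x - r : K.range) : F) := by
    rw [eq_neg_of_add_eq_zero_left hx0, neg_add_eq_sub]; rfl
  obtain ⟨-, hf, hb⟩ := hred (q, x) hxD _ hu
  rw [hb]
  by_contra hni
  refine hr ⟨K' x - r, ⟨⟨(q, x), hxD, rfl, hu⟩, ?_⟩, ?_⟩
  · by_contra hdet
    refine hni (LinearEquiv.injective
      (((fiberDeriv h (q, K' x - r)).toContinuousLinearEquivOfDetNeZero hdet).toLinearEquiv))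
  · refine Subtype.ext ?_
    simp only at hf ⊢
    rw [hf, eq_neg_of_add_eq_zero_left hx0]; rfl

end ReductionConsequences

/-! ### Sections of the bundle in local coordinates -/

section LocalRepresentatives

set_option linter.unusedSectionVars false

variable {Q : Type*} [NormedAddCommGroup Q] [NormedSpace ℝ Q]
  {EB : Type*} [NormedAddCommGroup EB] [NormedSpace ℝ EB]
  {F : Type*} [NormedAddCommGroup F] [NormedSpace ℝ F]
  {B : Type*} [TopologicalSpace B] [ChartedSpace EB B]
  {E : B → Type*} [TopologicalSpace (TotalSpace F E)]
  [∀ x, AddCommGroup (E x)] [∀ x, Module ℝ (E x)] [∀ x, TopologicalSpace (E x)]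
  [FiberBundle F E] [VectorBundle ℝ F E]

variable (EB F E) in
/-- The domain on which both the preferred chart and the preferred trivialization at `c` are
defined. -/
def coordDomain (c : B) : Set B := (chartAt EB c).source ∩ (trivializationAt F E c).baseSet

variable (F) in
/-- A family of sections as a map to the total space. -/
def totalFamily (s : Q → ∀ x, E x) (p : Q × B) : TotalSpace F E := ⟨p.2, s p.1 p.2⟩

variable (EB F) in
/-- The family of sections `s` written in the preferred chart and trivialization at `c`. -/
noncomputable def localRep (c : B) (s : Q → ∀ x, E x) (p : Q × EB) : F :=
  (trivializationAt F E c (totalFamily F s (p.1, (chartAt EB c).symm p.2))).2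

theorem isOpen_coordDomain (c : B) : IsOpen (coordDomain EB F E c) :=
  (chartAt EB c).open_source.inter (trivializationAt F E c).open_baseSet

theorem mem_coordDomain_self (c : B) : c ∈ coordDomain EB F E c :=
  ⟨mem_chart_source EB c, mem_baseSet_trivializationAt F E c⟩

theorem localRep_chart (c : B) (s : Q → ∀ x, E x) (q : Q) {x : B}
    (hx : x ∈ coordDomain EB F E c) :
    localRep EB F c s (q, chartAt EB c x) =
      (trivializationAt F E c).continuousLinearEquivAt ℝ x hx.2 (s q x) := by
  simp only [localRep, (chartAt EB c).left_inv hx.1]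
  rfl

theorem localRep_chart_eq_zero_iff (c : B) (s : Q → ∀ x, E x) (q : Q) {x : B}
    (hx : x ∈ coordDomain EB F E c) :
    localRep EB F c s (q, chartAt EB c x) = 0 ↔ s q x = 0 := by
  rw [localRep_chart c s q hx]
  exact map_eq_zero_iff _ (ContinuousLinearEquiv.injective _)

theorem mem_range_zeroSection_iff {x : B} {v : E x} :
    (⟨x, v⟩ : TotalSpace F E) ∈ range (zeroSection F E) ↔ v = 0 := by
  constructor
  · rintro ⟨y, hy⟩
    obtain rfl : y = x := congrArg TotalSpace.proj hy
    exact (eq_of_heq (TotalSpace.mk.inj hy).2).symm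
  · rintro rfl
    exact ⟨x, rfl⟩

/-- The model with corners of `Q × B`. -/
local notation "𝓘Q" => ModelWithCorners.prod 𝓘(ℝ, Q) 𝓘(ℝ, EB)

variable [IsManifold 𝓘(ℝ, EB) 2 B] [ContMDiffVectorBundle 2 F E 𝓘(ℝ, EB)]

theorem contDiffAt_localRep {c : B} {s : Q → ∀ x, E x} {q : Q} {x : B}
    (hx : x ∈ coordDomain EB F E c)
    (hs : ContMDiffAt 𝓘Q (𝓘(ℝ, EB).prod 𝓘(ℝ, F)) 2 (totalFamily F s) (q, x)) :
    ContDiffAt ℝ 2 (localRep EB F c s) (q, chartAt EB c x) := by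
  have h1 : ContMDiffAt 𝓘Q 𝓘(ℝ, F) 2
      (fun p => (trivializationAt F E c (totalFamily F s p)).2) (q, x) :=
    (((trivializationAt F E c).contMDiffAt_iff (IB := 𝓘(ℝ, EB)) (n := 2)
      ((trivializationAt F E c).mem_source.2 hx.2)).1 hs).2
  have h2 : ContMDiffAt (𝓘(ℝ, Q).prod 𝓘(ℝ, EB)) 𝓘Q 2
      (fun p : Q × EB => (p.1, (chartAt EB c).symm p.2)) (q, chartAt EB c x) := by
    refine contMDiffAt_fst.prodMk ?_
    refine ContMDiffAt.comp (I' := 𝓘(ℝ, EB)) (q, chartAt EB c x) ?_ contMDiffAt_snd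
    exact (contMDiffOn_chart_symm (I := 𝓘(ℝ, EB)) (n := 2)).contMDiffAt
      ((chartAt EB c).open_target.mem_nhds ((chartAt EB c).map_source hx.1))
  have h3 : ((q, (chartAt EB c).symm (chartAt EB c x)) : Q × B) = (q, x) := by
    rw [(chartAt EB c).left_inv hx.1]
  have h4 := ContMDiffAt.comp (q, chartAt EB c x)
    (g := fun p => (trivializationAt F E c (totalFamily F s p)).2)
    (f := fun p : Q × EB => (p.1, (chartAt EB c).symm p.2)) (h3 ▸ h1) h2
  rw [← modelWithCornersSelf_prod, chartedSpaceSelf_prod] at h4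
  exact h4.contDiffAt

/-- At a zero, the partial derivative of a local representative is the fiberwise differential read
in the chart and in the trivialization. -/
theorem fiberDeriv_localRep {c : B} {s : Q → ∀ x, E x} {q : Q} {x : B}
    (hx : x ∈ coordDomain EB F E c)
    (hs : ContMDiffAt 𝓘Q (𝓘(ℝ, EB).prod 𝓘(ℝ, F)) 2 (totalFamily F s) (q, x))
    (h0 : s q x = 0) :
    ∃ A : EB ≃L[ℝ] EB, ∀ v, fiberDeriv (localRep EB F c s) (q, chartAt EB c x) v =
      (trivializationAt F E c).continuousLinearEquivAt ℝ x hx.2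
        ((fiberwiseDifferential (fun y => totalFamily F s (q, y)) x : EB →L[ℝ] E x) (A v)) := by
  have : IsManifold 𝓘(ℝ, EB) 1 B := IsManifold.of_le (n := 2) (by norm_num)
  have : ContMDiffVectorBundle 1 F E 𝓘(ℝ, EB) := ContMDiffVectorBundle.of_le (n := 2) (by norm_num)
  let σ : B → TotalSpace F E := fun y => totalFamily F s (q, y)
  let e := trivializationAt F E c
  let φ := chartAt EB c
  have hσ : MDifferentiableAt 𝓘(ℝ, EB) (𝓘(ℝ, EB).prod 𝓘(ℝ, F)) σ x :=
    (hs.comp (I := 𝓘(ℝ, EB)) x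
      (contMDiffAt_const.prodMk contMDiffAt_id)).mdifferentiableAt (by norm_num)
  have hu : MDifferentiableAt 𝓘(ℝ, EB) 𝓘(ℝ, F) (fun y => (e (σ y)).2) x := by
    have h1 : ContMDiffAt 𝓘Q 𝓘(ℝ, F) 2
        (fun p => (e (totalFamily F s p)).2) (q, x) :=
      ((e.contMDiffAt_iff (IB := 𝓘(ℝ, EB)) (n := 2) (e.mem_source.2 hx.2)).1 hs).2
    exact (h1.comp (I := 𝓘(ℝ, EB)) x
      (contMDiffAt_const.prodMk contMDiffAt_id)).mdifferentiableAt (by norm_num)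
  have hfd := fiberwiseDifferential_eq σ (fun _ => rfl) x (mem_range_zeroSection_iff.2 h0) hσ e hx.2
  have hφt : φ x ∈ φ.symm.source := φ.map_source hx.1
  have hφs : φ.symm (φ x) = x := φ.left_inv hx.1
  let A : EB ≃L[ℝ] EB :=
    (mdifferentiable_chart (I := 𝓘(ℝ, EB)) c).symm.mfderiv hφt
  have hA : ∀ v, A v = mfderiv 𝓘(ℝ, EB) 𝓘(ℝ, EB) φ.symm (φ x) v := fun v => rfl
  have hcomp : HasFDerivAt (fun y => (e (σ (φ.symm y))).2)
      ((mfderiv 𝓘(ℝ, EB) 𝓘(ℝ, F) (fun y => (e (σ y)).2) x : EB →L[ℝ] F) ∘L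
        (A : EB →L[ℝ] EB)) (φ x) := by
    refine hasMFDerivAt_iff_hasFDerivAt.1 ?_
    refine HasMFDerivAt.comp (g := fun y => (e (σ y)).2) (φ x) ?_
      ((mdifferentiable_chart (I := 𝓘(ℝ, EB)) c).symm.mdifferentiableAt hφt).hasMFDerivAt
    rw [hφs]
    exact hu.hasMFDerivAt
  refine ⟨A, fun v => ?_⟩
  have h1 := hasFDerivAt_fiberDeriv
    ((contDiffAt_localRep hx hs).differentiableAt (by norm_num))
  rw [h1.unique hcomp, hfd]
  exact ((e.continuousLinearEquivAt ℝ x hx.2).apply_symm_apply _).symm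

/-- Regularity of a zero can be tested in any local representative. -/
theorem bijective_fiberDeriv_localRep_iff {c : B} {s : Q → ∀ x, E x} {q : Q} {x : B}
    (hx : x ∈ coordDomain EB F E c)
    (hs : ContMDiffAt 𝓘Q (𝓘(ℝ, EB).prod 𝓘(ℝ, F)) 2 (totalFamily F s) (q, x))
    (h0 : s q x = 0) :
    Function.Bijective (fiberDeriv (localRep EB F c s) (q, chartAt EB c x)) ↔
      Function.Bijective
        (fiberwiseDifferential (fun y => totalFamily F s (q, y)) x : EB →L[ℝ] E x) := by
  obtain ⟨A, hA⟩ := fiberDeriv_localRep hx hs h0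
  let e := (trivializationAt F E c).continuousLinearEquivAt ℝ x hx.2
  have : (fiberDeriv (localRep EB F c s) (q, chartAt EB c x) : EB → F) =
      e ∘ (fiberwiseDifferential (fun y => totalFamily F s (q, y)) x : EB →L[ℝ] E x) ∘ A :=
    funext hA
  rw [this]
  exact (Function.Bijective.of_comp_iff' e.bijective _).trans
    (Function.Bijective.of_comp_iff _ A.bijective)

end LocalRepresentatives

/-! ### Cut-off functions near a compact set -/

section CutOff

/-- Cut-off functions near a compact set `Z` which is embedded, near `z`, into a finite-dimensional
space by a smooth map `P`. A Banach manifold need not carry smooth bump functions, nor be regular as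
a topological space, but a bump function of `P`, extended by zero, is smooth at the points of `Z`,
and this is all that matters for the zeros of sections close to `Z`. -/
theorem exists_contMDiffAt_cutOff {V : Type*} [NormedAddCommGroup V] [NormedSpace ℝ V]
    {H : Type*} [TopologicalSpace H] (I : ModelWithCorners ℝ V H) {X : Type*} [TopologicalSpace X]
    [ChartedSpace H X] [T2Space X] {G : Type*} [NormedAddCommGroup G] [NormedSpace ℝ G]
    [FiniteDimensional ℝ G] {Z D : Set X} (hZ : IsCompact Z) (hD : IsOpen D) {z : X} (hzZ : z ∈ Z)
    (hzD : z ∈ D) (P : X → G) (hP : ∀ x ∈ D, ContMDiffAt I 𝓘(ℝ, G) 2 P x)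
    (hinj : InjOn P (Z ∩ D)) :
    ∃ ρ : X → ℝ, (∀ x ∈ Z, ContMDiffAt I 𝓘(ℝ, ℝ) 2 ρ x) ∧ Z ∩ tsupport ρ ⊆ D ∧
      ρ =ᶠ[𝓝 z] fun _ => 1 := by
  classical
  obtain ⟨D₁, U, hD₁, hU, hzD₁, hZU, hdisj⟩ : SeparatedNhds {z} (Z \ D) :=
    SeparatedNhds.of_isCompact_isCompact isCompact_singleton (hZ.diff hD) (by simp [hzD])
  rw [singleton_subset_iff] at hzD₁
  have hCD : Z \ U ⊆ D := fun w hw => by_contra fun h => hw.2 (hZU ⟨hw.1, h⟩)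
  -- on the part of `Z` that leaves `D₁` inside `D`, the map `P` stays away from `P z`
  obtain ⟨r, hr0, hr⟩ : ∃ r > 0, ∀ w ∈ (Z \ U) \ D₁, r < dist (P w) (P z) := by
    have hcomp : IsCompact ((Z \ U) \ D₁) := (hZ.diff hU).diff hD₁
    rcases ((Z \ U) \ D₁).eq_empty_or_nonempty with he | hne
    · exact ⟨1, one_pos, fun x hx => absurd (he ▸ hx) (notMem_empty x)⟩
    · have hc : ContinuousOn (fun w => dist (P w) (P z)) ((Z \ U) \ D₁) := fun w hw =>
        (hP w (hCD hw.1)).continuousAt.continuousWithinAt.dist continuousWithinAt_const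
      obtain ⟨w, hw, hmin⟩ := hcomp.exists_isMinOn hne hc
      have hpos : 0 < dist (P w) (P z) := dist_pos.2 fun h => hw.2 (by
        rw [hinj ⟨hw.1.1, hCD hw.1⟩ ⟨hzZ, hzD⟩ h]; exact hzD₁)
      exact ⟨dist (P w) (P z) / 2, half_pos hpos,
        fun y hy => (half_lt_self hpos).trans_le (hmin hy)⟩
  let b : ContDiffBump (P z) := ⟨r / 2, r, half_pos hr0, half_lt_self hr0⟩
  let ρ : X → ℝ := (D₁ ∩ D).indicator fun w => b (P w)
  have hin : ∀ w ∈ D₁ ∩ D, ρ =ᶠ[𝓝 w] fun w => b (P w) := fun w hw => by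
    filter_upwards [(hD₁.inter hD).mem_nhds hw] with y hy
    exact indicator_of_mem hy _
  have hUz : ∀ w ∈ U, ρ =ᶠ[𝓝 w] fun _ => 0 := fun w hw => by
    filter_upwards [hU.mem_nhds hw] with y hy
    exact indicator_of_notMem (fun h => disjoint_left.1 hdisj h.1 hy) _
  refine ⟨ρ, fun w hw => ?_, fun w hw => ?_, ?_⟩
  · by_cases hwU : w ∈ U
    · exact contMDiffAt_const.congr_of_eventuallyEq (hUz w hwU)
    have hwD := hCD ⟨hw, hwU⟩
    by_cases hw1 : w ∈ D₁
    · exact (b.contDiff.contMDiff.contMDiffAt.comp w (hP w hwD)).congr_of_eventuallyEq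
        (hin w ⟨hw1, hwD⟩)
    · refine (contMDiffAt_const (c := (0 : ℝ))).congr_of_eventuallyEq ?_
      filter_upwards [((hP w hwD).continuousAt.dist continuousAt_const).eventually_const_lt
        (hr w ⟨⟨hw, hwU⟩, hw1⟩)] with y hy
      by_cases hyD : y ∈ D₁ ∩ D
      · exact (indicator_of_mem hyD _).trans (b.zero_of_le_dist hy.le)
      · exact indicator_of_notMem hyD _
  · by_contra hwD
    exact notMem_tsupport_iff_eventuallyEq.2 (hUz w (hZU ⟨hw.1, hwD⟩)) hw.2
  · refine (hin z ⟨hzD₁, hzD⟩).trans ?_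
    exact (hP z hzD).continuousAt.eventually b.eventuallyEq_one

end CutOff

/-! ### Locally constant functions of a block parameter -/

section BlockParameters

/-- A function of blocks of parameters which is locally constant on a dense set `G` of a ball, and
which does not change when a single block is changed within `G`, is constant on `G`. -/
theorem eq_of_agree_off {ι : Type*} [Fintype ι] [DecidableEq ι] {R : ι → Type*}
    [∀ i, NormedAddCommGroup (R i)] {α : Type*} {r : ℝ} {G : Set (∀ i, R i)} {f : (∀ i, R i) → α}
    (hr : 0 < r)
    (hloc : ∀ v ∈ G, ‖v‖ < r → ∀ᶠ w in 𝓝 v, w ∈ G ∧ f w = f v)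
    (hdense : ∀ v, ‖v‖ < r → ∃ᶠ w in 𝓝 v, w ∈ G)
    (hmove : ∀ v ∈ G, ∀ i (a : R i), ‖v‖ < r → Function.update v i a ∈ G →
      ‖Function.update v i a‖ < r → f (Function.update v i a) = f v)
    (T : Finset ι) : ∀ v ∈ G, ∀ v' ∈ G, ‖v‖ < r → ‖v'‖ < r → (∀ i ∉ T, v i = v' i) →
      f v = f v' := by
  induction T using Finset.induction_on with
  | empty =>
    intro v _ v' _ _ _ h
    rw [funext fun i => h i (by simp)]
  | insert i T hi ih =>
    intro v hv v' hv' hvr hvr' h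
    have hvi := (pi_norm_lt_iff hr).1 hvr
    have hvi' := (pi_norm_lt_iff hr).1 hvr'
    -- the hybrid vector `u`, perturbed to a good vector `w`
    let u := Function.update v i (v' i)
    have hu : ‖u‖ < r := (pi_norm_lt_iff hr).2 fun j => by
      by_cases hj : j = i
      · subst hj; simpa [u] using hvi' j
      · simpa [u, hj] using hvi j
    let A : (∀ i, R i) → ∀ i, R i := fun w => Function.update w i (v i)
    let A' : (∀ i, R i) → ∀ i, R i := fun w j => if j ∈ T then v' j else w j
    have hAc : Continuous A := continuous_id.update i continuous_const
    have hA'c : Continuous A' := continuous_pi fun j => by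
      by_cases hj : j ∈ T
      · simpa [A', hj] using continuous_const
      · simpa [A', hj] using continuous_apply j
    have hAu : A u = v := by simp [A, u]
    have hA'u : A' u = v' := by
      ext j
      by_cases hj : j ∈ T
      · simp [A', hj]
      · by_cases hji : j = i
        · subst hji; simp [A', u, hj]
        · simp only [A', hj, if_false, u, Function.update_of_ne hji]
          exact h j (by simp [hj, hji])
    have h1 : ∀ᶠ w in 𝓝 u, (A w ∈ G ∧ f (A w) = f v) ∧ ‖A w‖ < r :=
      (hAc.continuousAt (x := u)).eventually (by
        rw [hAu]
        exact (hloc v hv hvr).and (continuous_norm.continuousAt.eventually_lt_const hvr))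
    have h2 : ∀ᶠ w in 𝓝 u, (A' w ∈ G ∧ f (A' w) = f v') ∧ ‖A' w‖ < r :=
      (hA'c.continuousAt (x := u)).eventually (by
        rw [hA'u]
        exact (hloc v' hv' hvr').and (continuous_norm.continuousAt.eventually_lt_const hvr'))
    obtain ⟨w, hwG, ⟨⟨hAG, hAf⟩, hAr⟩, ⟨hA'G, hA'f⟩, hA'r, hwr⟩ := ((hdense u hu).and_eventually
      (h1.and ((h2.and (continuous_norm.continuousAt.eventually_lt_const hu)).mono
        fun w hw => (⟨hw.1.1, hw.1.2, hw.2⟩ : _ ∧ _ ∧ _)))).exists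
    have h3 : f (A w) = f w := hmove w hwG i (v i) hwr hAG hAr
    have h4 : f w = f (A' w) := ih w hwG (A' w) hA'G hwr hA'r fun j hj => by simp [A', hj]
    rw [← hAf, h3, h4, hA'f]

/-- Invariance along a time interval, from invariance under changes of single blocks of auxiliary
parameters at fixed times. -/
theorem eq_at_endpoints {ι : Type*} [Fintype ι] [DecidableEq ι] {R : ι → Type*}
    [∀ i, NormedAddCommGroup (R i)] {α : Type*} {r : ℝ} (hr : 0 < r)
    {G : Set (ℝ × ∀ i, R i)} {f : (ℝ × ∀ i, R i) → α}
    (hloc : ∀ t ∈ Icc (0 : ℝ) 1, ∀ v, (t, v) ∈ G → ‖v‖ < r →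
      ∀ᶠ q in 𝓝 (t, v), q.1 ∈ Icc (0 : ℝ) 1 → q ∈ G ∧ f q = f (t, v))
    (hdense : ∀ t ∈ Icc (0 : ℝ) 1, ∀ v, ‖v‖ < r → ∃ᶠ w in 𝓝 v, (t, w) ∈ G)
    (hmove : ∀ t ∈ Icc (0 : ℝ) 1, ∀ v, (t, v) ∈ G → ∀ i (a : R i), ‖v‖ < r →
      (t, Function.update v i a) ∈ G → ‖Function.update v i a‖ < r →
        f (t, Function.update v i a) = f (t, v))
    (h0 : ((0, 0) : ℝ × ∀ i, R i) ∈ G) (h1 : ((1, 0) : ℝ × ∀ i, R i) ∈ G) :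
    f (0, 0) = f (1, 0) := by
  have hconst : ∀ t ∈ Icc (0 : ℝ) 1, ∀ v v', (t, v) ∈ G → (t, v') ∈ G → ‖v‖ < r → ‖v'‖ < r →
      f (t, v) = f (t, v') := by
    intro t ht v v' hv hv' hvr hvr'
    refine eq_of_agree_off (G := {v | (t, v) ∈ G}) (f := fun v => f (t, v)) hr
      (fun v hv hvr => ?_) (hdense t ht) (fun v hv i a hvr => hmove t ht v hv i a hvr)
      Finset.univ v hv v' hv' hvr hvr' (by simp)
    exact ((Continuous.prodMk_right t).continuousAt.eventually (hloc t ht v hv hvr)).mono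
      fun w hw => hw ht
  have hex : ∀ t : Icc (0 : ℝ) 1, ∃ v, ((t : ℝ), v) ∈ G ∧ ‖v‖ < r := fun t => by
    obtain ⟨v, hv, hvr⟩ := ((hdense t t.2 0 (by simpa using hr)).and_eventually
      (continuous_norm.continuousAt.eventually_lt_const (by simpa using hr))).exists
    exact ⟨v, hv, hvr⟩
  choose v hv hvr using hex
  have hlc : IsLocallyConstant fun t : Icc (0 : ℝ) 1 => f (t, v t) := by
    refine (IsLocallyConstant.iff_eventually_eq _).2 fun t => ?_
    have hc : Continuous fun t' : Icc (0 : ℝ) 1 => ((t' : ℝ), v t) := by fun_prop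
    filter_upwards [hc.continuousAt.eventually (hloc t t.2 (v t) (hv t) (hvr t))] with t' ht'
    obtain ⟨hG, hf⟩ := ht' t'.2
    rw [← hf]
    exact hconst t' t'.2 _ _ (hv t') hG (hvr t') (hvr t)
  have := hlc.apply_eq_of_preconnectedSpace ⟨0, by simp⟩ ⟨1, by simp⟩
  have h00 : ‖(0 : ∀ i, R i)‖ < r := by simpa using hr
  rw [hconst 0 (by simp) 0 _ h0 (hv ⟨0, by simp⟩) h00 (hvr _),
    hconst 1 (by simp) 0 _ h1 (hv ⟨1, by simp⟩) h00 (hvr _)]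
  exact this

theorem pi_norm_update_zero_le {ι : Type*} [Fintype ι] [DecidableEq ι] {R : ι → Type*}
    [∀ i, NormedAddCommGroup (R i)] (v : ∀ i, R i) (i : ι) : ‖Function.update v i 0‖ ≤ ‖v‖ := by
  refine (pi_norm_le_iff_of_nonneg (norm_nonneg v)).2 fun j => ?_
  by_cases hj : j = i
  · subst hj
    simp
  · rw [Function.update_of_ne hj]
    exact norm_le_pi_norm v j

theorem pi_norm_update_lt {ι : Type*} [Fintype ι] [DecidableEq ι] {R : ι → Type*}
    [∀ i, NormedAddCommGroup (R i)] {v : ∀ i, R i} {i : ι} {a b : R i} {r : ℝ}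
    (ha : ‖Function.update v i a‖ < r) (hb : ‖b‖ < r) : ‖Function.update v i b‖ < r := by
  have hr : 0 < r := (norm_nonneg _).trans_lt ha
  rw [pi_norm_lt_iff hr] at ha ⊢
  intro j
  by_cases hj : j = i
  · subst hj
    simpa using hb
  · have := ha j
    rwa [Function.update_of_ne hj] at this ⊢

end BlockParameters

/-! ### Finite-dimensional perturbations of a family of sections -/

section PerturbedFamily

set_option linter.unusedSectionVars false

variable {EB : Type*} [NormedAddCommGroup EB] [NormedSpace ℝ EB]
  {F : Type*} [NormedAddCommGroup F] [NormedSpace ℝ F]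
  {B : Type*} [TopologicalSpace B] [ChartedSpace EB B]
  {E : B → Type*} [TopologicalSpace (TotalSpace F E)]
  [∀ x, AddCommGroup (E x)] [∀ x, Module ℝ (E x)] [∀ x, TopologicalSpace (E x)]
  [FiberBundle F E] [VectorBundle ℝ F E]
  {ι : Type*} [Fintype ι]

/-- The family `s` of sections perturbed by the local sections which are constant, with value in
`R i`, in the preferred trivialization at `c i`, cut off by `ρ i`. -/
noncomputable def perturbedFamily (s : ℝ → ∀ x, E x) (c : ι → B) (R : ι → Submodule ℝ F)
    (ρ : ι → ℝ × B → ℝ) (q : ℝ × ∀ i, R i) (x : B) : E x :=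
  s q.1 x + ∑ i, ρ i (q.1, x) • (trivializationAt F E (c i)).symmL ℝ x (q.2 i : F)

variable {s : ℝ → ∀ x, E x} {c : ι → B} {R : ι → Submodule ℝ F} {ρ : ι → ℝ × B → ℝ}

theorem perturbedFamily_zero (t : ℝ) (x : B) : perturbedFamily s c R ρ (t, 0) x = s t x := by
  simp [perturbedFamily]

theorem perturbedFamily_update_of_notMem [DecidableEq ι] {t : ℝ} {x : B} {i : ι}
    (h : (t, x) ∉ tsupport (ρ i)) (v : ∀ i, R i) (a : R i) :
    perturbedFamily s c R ρ (t, Function.update v i a) x = perturbedFamily s c R ρ (t, v) x := by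
  unfold perturbedFamily
  congr 1
  refine Finset.sum_congr rfl fun j _ => ?_
  by_cases hj : j = i
  · subst hj
    simp [image_eq_zero_of_notMem_tsupport h]
  · simp [Function.update_of_ne hj]

theorem perturbedFamily_update_of_eq_one [DecidableEq ι] {t : ℝ} {x : B} {i : ι}
    (h : ρ i (t, x) = 1) (v : ∀ i, R i) (a : R i) :
    perturbedFamily s c R ρ (t, Function.update v i a) x =
      perturbedFamily s c R ρ (t, Function.update v i 0) x +
        (trivializationAt F E (c i)).symmL ℝ x (a : F) := by
  unfold perturbedFamily
  rw [add_assoc]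
  congr 1
  rw [← Finset.add_sum_erase _ _ (Finset.mem_univ i),
    ← Finset.add_sum_erase _ _ (Finset.mem_univ i), add_comm]
  simp only [h, Function.update_self, one_smul, ZeroMemClass.coe_zero, map_zero, zero_add]
  congr 1
  refine Finset.sum_congr rfl fun j hj => ?_
  rw [Function.update_of_ne (Finset.ne_of_mem_erase hj),
    Function.update_of_ne (Finset.ne_of_mem_erase hj)]

variable [IsManifold 𝓘(ℝ, EB) 2 B] [ContMDiffVectorBundle 2 F E 𝓘(ℝ, EB)]
  [∀ i, FiniteDimensional ℝ (R i)]

theorem contMDiffAt_perturbedFamily {q : ℝ × ∀ i, R i} {x : B}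
    (hs : ContMDiffAt (𝓘(ℝ, ℝ).prod 𝓘(ℝ, EB)) (𝓘(ℝ, EB).prod 𝓘(ℝ, F)) 2 (totalFamily F s) (q.1, x))
    (hρ : ∀ i, ContMDiffAt (𝓘(ℝ, ℝ).prod 𝓘(ℝ, EB)) 𝓘(ℝ, ℝ) 2 (ρ i) (q.1, x))
    (hsupp : ∀ i, (q.1, x) ∈ tsupport (ρ i) → x ∈ (trivializationAt F E (c i)).baseSet) :
    ContMDiffAt (𝓘(ℝ, ℝ × ∀ i, R i).prod 𝓘(ℝ, EB)) (𝓘(ℝ, EB).prod 𝓘(ℝ, F)) 2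
      (totalFamily F (perturbedFamily s c R ρ)) (q, x) := by
  let IQ := 𝓘(ℝ, ℝ × ∀ i, R i).prod 𝓘(ℝ, EB)
  let e := trivializationAt F E x
  have hx : x ∈ e.baseSet := mem_baseSet_trivializationAt F E x
  rw [contMDiffAt_totalSpace]
  refine ⟨contMDiffAt_snd, ?_⟩
  -- the projection that forgets the perturbation parameters
  have hpr : ContMDiffAt IQ (𝓘(ℝ, ℝ).prod 𝓘(ℝ, EB)) 2
      (fun p : (ℝ × ∀ i, R i) × B => (p.1.1, p.2)) (q, x) :=
    ((contDiff_fst (𝕜 := ℝ) (E := ℝ) (F := ∀ i, R i)).contMDiff.contMDiffAt.comp (q, x)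
      contMDiffAt_fst).prodMk contMDiffAt_snd
  have h1 : ContMDiffAt IQ 𝓘(ℝ, F) 2
      (fun p : (ℝ × ∀ i, R i) × B => (e (totalFamily F s (p.1.1, p.2))).2) (q, x) := by
    have := (contMDiffAt_totalSpace.1 hs).2
    exact ContMDiffAt.comp (q, x) (f := fun p : (ℝ × ∀ i, R i) × B => (p.1.1, p.2)) this hpr
  have h2 : ∀ i, ContMDiffAt IQ 𝓘(ℝ, F) 2 (fun p : (ℝ × ∀ i, R i) × B => ρ i (p.1.1, p.2) •
      (e ⟨p.2, (trivializationAt F E (c i)).symmL ℝ p.2 (p.1.2 i : F)⟩).2) (q, x) := by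
    intro i
    by_cases hi : (q.1, x) ∈ tsupport (ρ i)
    · have hxi := hsupp i hi
      let e' := trivializationAt F E (c i)
      have h3 : ContMDiffAt IQ 𝓘(ℝ, ℝ) 2
          (fun p : (ℝ × ∀ i, R i) × B => ρ i (p.1.1, p.2)) (q, x) :=
        ContMDiffAt.comp (q, x) (f := fun p : (ℝ × ∀ i, R i) × B => (p.1.1, p.2)) (hρ i) hpr
      have h4 : ContMDiffAt IQ 𝓘(ℝ, F →L[ℝ] F) 2
          (fun p : (ℝ × ∀ i, R i) × B => (e'.coordChangeL ℝ e p.2 : F →L[ℝ] F)) (q, x) :=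
        ContMDiffAt.comp (q, x) (contMDiffAt_coordChangeL (IB := 𝓘(ℝ, EB)) hxi hx) contMDiffAt_snd
      have h5 : ContMDiffAt IQ 𝓘(ℝ, F) 2
          (fun p : (ℝ × ∀ i, R i) × B => (p.1.2 i : F)) (q, x) := by
        have : ContDiff ℝ 2 fun q : ℝ × ∀ i, R i => (q.2 i : F) :=
          ((R i).subtypeL ∘L ContinuousLinearMap.proj (φ := fun i => R i) i ∘L
            ContinuousLinearMap.snd ℝ ℝ (∀ i, R i)).contDiff
        exact this.contMDiff.contMDiffAt.comp (q, x) contMDiffAt_fst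
      refine (h3.smul (h4.clm_apply h5)).congr_of_eventuallyEq ?_
      have hev : ∀ᶠ p : (ℝ × ∀ i, R i) × B in 𝓝 (q, x), p.2 ∈ e'.baseSet ∩ e.baseSet :=
        continuous_snd.continuousAt.eventually
          ((e'.open_baseSet.inter e.open_baseSet).mem_nhds ⟨hxi, hx⟩)
      filter_upwards [hev] with p hp
      change _ = ρ i (p.1.1, p.2) • e'.coordChangeL ℝ e p.2 (p.1.2 i : F)
      rw [Trivialization.coordChangeL_apply _ _ hp, e'.symmL_apply hp.1]
    · refine (contMDiffAt_const (c := (0 : F))).congr_of_eventuallyEq ?_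
      have hev : ∀ᶠ p : (ℝ × ∀ i, R i) × B in 𝓝 (q, x), (p.1.1, p.2) ∉ tsupport (ρ i) := by
        have : Continuous fun p : (ℝ × ∀ i, R i) × B => (p.1.1, p.2) := by fun_prop
        exact this.continuousAt (x := (q, x)) ((isClosed_tsupport (ρ i)).isOpen_compl.mem_nhds hi)
      filter_upwards [hev] with p hp
      rw [image_eq_zero_of_notMem_tsupport hp, zero_smul]
  refine (h1.add (contMDiffAt_finsetSum (t := Finset.univ) fun i _ => h2 i)).congr_of_eventuallyEq
    ?_
  have hev : ∀ᶠ p : (ℝ × ∀ i, R i) × B in 𝓝 (q, x), p.2 ∈ e.baseSet :=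
    continuous_snd.continuousAt.eventually (e.open_baseSet.mem_nhds hx)
  filter_upwards [hev] with p hp
  have hlin : ∀ w : E p.2, (e ⟨p.2, w⟩).2 = e.continuousLinearEquivAt ℝ p.2 hp w := fun _ => rfl
  change (e ⟨p.2, perturbedFamily s c R ρ p.1 p.2⟩).2 = _
  simp only [Pi.add_apply, totalFamily]
  rw [hlin, perturbedFamily, map_add, map_sum]
  simp only [map_smul]
  rfl

end PerturbedFamily

/-! ### Reduction domains on the manifold -/

section ManifoldReduction

set_option linter.unusedSectionVars false

variable {Q : Type*} [NormedAddCommGroup Q] [NormedSpace ℝ Q]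
  {EB : Type*} [NormedAddCommGroup EB] [NormedSpace ℝ EB]
  {F : Type*} [NormedAddCommGroup F] [NormedSpace ℝ F]
  {B : Type*} [TopologicalSpace B] [ChartedSpace EB B]
  {E : B → Type*} [TopologicalSpace (TotalSpace F E)]
  [∀ x, AddCommGroup (E x)] [∀ x, Module ℝ (E x)] [∀ x, TopologicalSpace (E x)]
  [FiberBundle F E] [VectorBundle ℝ F E]

theorem continuousAt_prodMap_chart {c : B} {q : Q} {x : B} (hx : x ∈ coordDomain EB F E c) :
    ContinuousAt (fun p : Q × B => (p.1, chartAt EB c p.2)) (q, x) :=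
  continuousAt_fst.prodMk (((chartAt EB c).continuousAt hx.1).comp continuousAt_snd)

/-- The coordinate `u = f + K` of the Lyapunov–Schmidt reduction, over the parameter space, for a
family of sections written in coordinates at `c`. -/
noncomputable def reductionMap (c : B) (s : Q → ∀ x, E x) (K : EB →L[ℝ] F) (p : Q × B) : Q × F :=
  (p.1, localRep EB F c s (p.1, chartAt EB c p.2) + K (chartAt EB c p.2))

theorem reductionMap_of_eq_zero {c : B} {s : Q → ∀ x, E x} (K : EB →L[ℝ] F) {p : Q × B}
    (hp : p.2 ∈ coordDomain EB F E c) (h0 : s p.1 p.2 = 0) :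
    reductionMap c s K p = (p.1, K (chartAt EB c p.2)) := by
  rw [reductionMap, (localRep_chart_eq_zero_iff c s p.1 hp).2 h0, zero_add]

variable [IsManifold 𝓘(ℝ, EB) 2 B] [ContMDiffVectorBundle 2 F E 𝓘(ℝ, EB)]

theorem continuousAt_reductionMap {c : B} {s : Q → ∀ x, E x} (K : EB →L[ℝ] F) {q : Q} {x : B}
    (hx : x ∈ coordDomain EB F E c)
    (hs : ContMDiffAt (𝓘(ℝ, Q).prod 𝓘(ℝ, EB)) (𝓘(ℝ, EB).prod 𝓘(ℝ, F)) 2 (totalFamily F s) (q, x)) :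
    ContinuousAt (reductionMap c s K) (q, x) := by
  have h : ContinuousAt (fun p : Q × EB => (p.1, localRep EB F c s p + K p.2))
      (q, chartAt EB c x) :=
    continuousAt_fst.prodMk ((contDiffAt_localRep hx hs).continuousAt.add
      (K.continuous.continuousAt.comp continuousAt_snd))
  exact ContinuousAt.comp (f := fun p : Q × B => (p.1, chartAt EB c p.2)) (x := (q, x)) h
    (continuousAt_prodMap_chart hx)

variable [CompleteSpace Q] [CompleteSpace EB] [CompleteSpace F]

theorem eventually_bijective_localRep_add {c : B} {s : Q → ∀ x, E x} {K : EB →L[ℝ] F} {q : Q}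
    {x : B} (hx : x ∈ coordDomain EB F E c)
    (hs : ContMDiffAt (𝓘(ℝ, Q).prod 𝓘(ℝ, EB)) (𝓘(ℝ, EB).prod 𝓘(ℝ, F)) 2 (totalFamily F s) (q, x))
    (hb : Function.Bijective (fiberDeriv (localRep EB F c s) (q, chartAt EB c x) + K)) :
    (∀ᶠ p in 𝓝 (q, x), Function.Bijective
      (fiberDeriv (localRep EB F c s) (p.1, chartAt EB c p.2) + K)) ∧
    ∃ U ∈ 𝓝 (q, x), InjOn (reductionMap c s K) U := by
  have hf := contDiffAt_localRep hx hs
  have hΨ : ContDiffAt ℝ 2 (fun p : Q × EB => localRep EB F c s p + K p.2) (q, chartAt EB c x) :=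
    hf.add (K.contDiff.contDiffAt.comp _ contDiffAt_snd)
  have hb' : Function.Bijective (fiberDeriv (fun p : Q × EB => localRep EB F c s p + K p.2)
      (q, chartAt EB c x)) := by
    rw [fiberDeriv_add_clm K (hf.differentiableAt (by norm_num))]
    exact hb
  have hc : Filter.Tendsto (fun p : Q × B => (p.1, chartAt EB c p.2)) (𝓝 (q, x))
      (𝓝 (q, chartAt EB c x)) := continuousAt_prodMap_chart hx
  constructor
  · have hev := (eventually_bijective_fiberDeriv hΨ hb').and
      (hf.eventually (by simp))
    filter_upwards [hc.eventually hev] with p hp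
    rw [fiberDeriv_add_clm K (hp.2.differentiableAt (by norm_num))] at hp
    exact hp.1
  · obtain ⟨U, hU, hinj⟩ := exists_mem_nhds_injOn_fiberMap hΨ hb'
    refine ⟨{p : Q × B | p.2 ∈ (chartAt EB c).source} ∩
      (fun p : Q × B => (p.1, chartAt EB c p.2)) ⁻¹' U, Filter.inter_mem ?_ (hc hU), ?_⟩
    · exact continuous_snd.continuousAt.preimage_mem_nhds
        ((chartAt EB c).open_source.mem_nhds hx.1)
    · rintro p ⟨hp1, hp2⟩ p' ⟨hp1', hp2'⟩ h
      have h2 := hinj hp2 hp2' h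
      rw [Prod.mk.injEq] at h2
      exact Prod.ext h2.1 ((chartAt EB c).injOn hp1 hp1' h2.2)

/-- Near a zero with fiberwise differential of index zero, a suitable operator `K` of finite rank
defines a Lyapunov–Schmidt reduction. -/
theorem exists_reduction_at_zero {s : Q → ∀ x, E x} {q : Q} {x : B}
    (hs : ContMDiffAt (𝓘(ℝ, Q).prod 𝓘(ℝ, EB)) (𝓘(ℝ, EB).prod 𝓘(ℝ, F)) 2 (totalFamily F s) (q, x))
    (h0 : s q x = 0)
    (hfred : (fiberwiseDifferential (EB := EB) (fun y => totalFamily F s (q, y)) x).IsFredholm)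
    (hindex : fredholmIndex
      (fiberwiseDifferential (EB := EB) (fun y => totalFamily F s (q, y)) x) = 0) :
    ∃ K : EB →L[ℝ] F, FiniteDimensional ℝ K.range ∧ ∃ D : Set (Q × B), IsOpen D ∧ (q, x) ∈ D ∧
      (∀ p ∈ D, p.2 ∈ coordDomain EB F E x) ∧
      (∀ p ∈ D, Function.Bijective
        (fiberDeriv (localRep EB F x s) (p.1, chartAt EB x p.2) + K)) ∧
      InjOn (reductionMap x s K) D := by
  have hx : x ∈ coordDomain EB F E x := mem_coordDomain_self x
  let e := (trivializationAt F E x).continuousLinearEquivAt ℝ x hx.2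
  obtain ⟨A, hA⟩ := fiberDeriv_localRep hx hs h0
  obtain ⟨K, hK, hKb⟩ := exists_finiteRank_bijective_add (X := EB)
    (fiberwiseDifferential (fun y => totalFamily F s (q, y)) x) hfred hindex e
  have hb : Function.Bijective (fiberDeriv (localRep EB F x s) (q, chartAt EB x x) +
      K ∘L (A : EB →L[ℝ] EB)) := by
    convert hKb.comp A.bijective using 1
    ext v
    rw [add_apply, hA]
    rfl
  obtain ⟨hev, U, hU, hinj⟩ := eventually_bijective_localRep_add hx hs hb
  have hdom : ∀ᶠ p : Q × B in 𝓝 (q, x), p.2 ∈ coordDomain EB F E x :=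
    continuous_snd.continuousAt.eventually ((isOpen_coordDomain x).mem_nhds hx)
  obtain ⟨D, hDsub, hD, hqD⟩ := mem_nhds_iff.1 (Filter.inter_mem hU (hev.and hdom))
  refine ⟨K ∘L (A : EB →L[ℝ] EB), ?_, D, hD, hqD, fun p hp => (hDsub hp).2.2,
    fun p hp => (hDsub hp).2.1, hinj.mono fun p hp => (hDsub hp).1⟩
  refine Submodule.finiteDimensional_of_le (S₂ := K.range) ?_
  rintro _ ⟨v, rfl⟩
  exact ⟨A v, rfl⟩

/-- An open set of `Q × B` contained in a coordinate domain, in coordinates. -/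
def chartImage (c : B) (O : Set (Q × B)) : Set (Q × EB) :=
  {p | p.2 ∈ (chartAt EB c).target ∧ (p.1, (chartAt EB c).symm p.2) ∈ O}

theorem isOpen_chartImage (c : B) {O : Set (Q × B)} (hO : IsOpen O) :
    IsOpen (chartImage (EB := EB) c O) := by
  have h : ContinuousOn (fun p : Q × EB => (p.1, (chartAt EB c).symm p.2))
      (Prod.snd ⁻¹' (chartAt EB c).target) :=
    continuousOn_fst.prodMk ((chartAt EB c).continuousOn_symm.comp continuousOn_snd fun _ h => h)
  exact h.isOpen_inter_preimage ((chartAt EB c).open_target.preimage continuous_snd) hO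

theorem mem_chartImage {c : B} {O : Set (Q × B)} {q : Q} {x : B}
    (hx : x ∈ (chartAt EB c).source) :
    (q, chartAt EB c x) ∈ chartImage c O ↔ (q, x) ∈ O := by
  simp only [chartImage, mem_ofPred_eq, (chartAt EB c).left_inv hx, (chartAt EB c).map_source hx,
    true_and]

theorem isReductionDomain_chartImage {c : B} {s : Q → ∀ x, E x} {K : EB →L[ℝ] F}
    {O : Set (Q × B)} (hO : IsOpen O) (hdom : ∀ p ∈ O, p.2 ∈ coordDomain EB F E c)
    (hs : ∀ p ∈ O, ContMDiffAt (𝓘(ℝ, Q).prod 𝓘(ℝ, EB)) (𝓘(ℝ, EB).prod 𝓘(ℝ, F)) 2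
      (totalFamily F s) p)
    (hb : ∀ p ∈ O, Function.Bijective
      (fiberDeriv (localRep EB F c s) (p.1, chartAt EB c p.2) + K))
    (hinj : InjOn (reductionMap c s K) O) :
    IsReductionDomain (localRep EB F c s) K (chartImage c O) := by
  have hφ : ∀ p ∈ chartImage (EB := EB) c O, chartAt EB c ((chartAt EB c).symm p.2) = p.2 :=
    fun p hp => (chartAt EB c).right_inv hp.1
  refine ⟨isOpen_chartImage c hO, fun p hp => ?_, fun p hp => ?_, fun p hp p' hp' h => ?_⟩
  · have := contDiffAt_localRep (hdom _ hp.2) (hs _ hp.2)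
    rwa [hφ p hp] at this
  · have := hb _ hp.2
    simp only [hφ p hp] at this
    exact this
  · have h1 := hinj hp.2 hp'.2 (by
      simp only [reductionMap, hφ p hp, hφ p' hp']
      exact h)
    rw [Prod.mk.injEq] at h1
    exact Prod.ext h1.1 ((chartAt EB c).symm.injOn hp.1 hp'.1 h1.2)

end ManifoldReduction

/-! ### Perturbation systems -/

section PerturbationSystem

set_option linter.unusedSectionVars false

variable {EB : Type*} [NormedAddCommGroup EB] [NormedSpace ℝ EB]
  {F : Type*} [NormedAddCommGroup F] [NormedSpace ℝ F]
  {B : Type*} [TopologicalSpace B] [ChartedSpace EB B]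
  {E : B → Type*} [TopologicalSpace (TotalSpace F E)]
  [∀ x, AddCommGroup (E x)] [∀ x, Module ℝ (E x)] [∀ x, TopologicalSpace (E x)]
  [FiberBundle F E] [VectorBundle ℝ F E]

/-- The data of a Lyapunov–Schmidt reduction and of a cut-off function at a zero `z` of the family
`s` of sections, where `Z` is the set of all zeros. -/
structure IsReductionDatum (s : ℝ → ∀ x, E x) (Z : Set (ℝ × B)) (z : ℝ × B) (K : EB →L[ℝ] F)
    (D : Set (ℝ × B)) (ρ : ℝ × B → ℝ) : Prop where
  finiteDimensional : FiniteDimensional ℝ K.range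
  isOpen : IsOpen D
  mem_coordDomain : ∀ p ∈ D, p.2 ∈ coordDomain EB F E z.2
  bijective : ∀ p ∈ D, Function.Bijective
    (fiberDeriv (localRep EB F z.2 s) (p.1, chartAt EB z.2 p.2) + K)
  injOn : InjOn (reductionMap z.2 s K) D
  contMDiffAt : ∀ p ∈ Z, ContMDiffAt (𝓘(ℝ, ℝ).prod 𝓘(ℝ, EB)) 𝓘(ℝ, ℝ) 2 ρ p
  tsupport : Z ∩ tsupport ρ ⊆ D
  eq_one : ρ =ᶠ[𝓝 z] fun _ => 1

variable [IsManifold 𝓘(ℝ, EB) 2 B] [ContMDiffVectorBundle 2 F E 𝓘(ℝ, EB)]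
  [CompleteSpace EB] [CompleteSpace F]

theorem exists_isReductionDatum [T2Space B] {s : ℝ → ∀ x, E x} {Z : Set (ℝ × B)}
    (hs : ContMDiff (𝓘(ℝ, ℝ).prod 𝓘(ℝ, EB)) (𝓘(ℝ, EB).prod 𝓘(ℝ, F)) 2 (totalFamily F s))
    (hZ : IsCompact Z) (hZ0 : ∀ p ∈ Z, s p.1 p.2 = 0)
    {z : ℝ × B} (hz : z ∈ Z)
    (hfred : (fiberwiseDifferential (EB := EB) (fun y => totalFamily F s (z.1, y)) z.2).IsFredholm)
    (hindex : fredholmIndex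
      (fiberwiseDifferential (EB := EB) (fun y => totalFamily F s (z.1, y)) z.2) = 0) :
    ∃ (K : EB →L[ℝ] F) (D : Set (ℝ × B)) (ρ : ℝ × B → ℝ), IsReductionDatum s Z z K D ρ := by
  obtain ⟨K, hK, D, hD, hzD, hdom, hb, hinj⟩ :=
    exists_reduction_at_zero (hs (z.1, z.2)) (hZ0 z hz) hfred hindex
  let K' : EB →L[ℝ] K.range := K.codRestrict K.range fun x => ⟨x, rfl⟩
  let P : ℝ × B → ℝ × K.range := fun p => (p.1, K' (chartAt EB z.2 p.2))
  have hP : ∀ p ∈ D, ContMDiffAt (𝓘(ℝ, ℝ).prod 𝓘(ℝ, EB)) 𝓘(ℝ, ℝ × K.range) 2 P p := by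
    intro p hp
    refine contMDiffAt_fst.prodMk_space ?_
    refine K'.contDiff.contMDiff.contMDiffAt.comp p ?_
    exact ContMDiffAt.comp p ((contMDiffOn_chart (I := 𝓘(ℝ, EB)) (n := 2)).contMDiffAt
      ((chartAt EB z.2).open_source.mem_nhds (hdom p hp).1)) contMDiffAt_snd
  have hPinj : InjOn P (Z ∩ D) := by
    intro p hp p' hp' h
    refine hinj hp.2 hp'.2 ?_
    rw [reductionMap_of_eq_zero K (hdom p hp.2) (hZ0 p hp.1),
      reductionMap_of_eq_zero K (hdom p' hp'.2) (hZ0 p' hp'.1)]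
    rw [Prod.mk.injEq] at h ⊢
    exact ⟨h.1, congrArg Subtype.val h.2⟩
  obtain ⟨ρ, h1, h2, h3⟩ := exists_contMDiffAt_cutOff (𝓘(ℝ, ℝ).prod 𝓘(ℝ, EB)) hZ hD hz hzD P hP
    hPinj
  exact ⟨K, D, ρ, hK, hD, hdom, hb, hinj, h1, h2, h3⟩

variable {ι : Type*} [Fintype ι]

/-- The parameter space of the perturbations with values in the ranges of the operators `K i`. -/
abbrev ParamSpace (K : ι → EB →L[ℝ] F) : Type _ := ℝ × ∀ i, (K i).range

/-- The perturbed family with values in the ranges of the operators `K i`. -/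
noncomputable abbrev perturbation (s : ℝ → ∀ x, E x) (c : ι → B) (K : ι → EB →L[ℝ] F)
    (ρ : ι → ℝ × B → ℝ) : ParamSpace K → ∀ x, E x :=
  perturbedFamily s c (fun i => (K i).range) ρ

/-- A finite-dimensional perturbation of the family `s` over `[0, 1]` which is under control for
parameters of norm less than `r` over the open set `V` of `ℝ × B`: wherever the `i`-th perturbation
acts, `O i` is the domain of a Lyapunov–Schmidt reduction with the operator `K i`; every point is
reached by the full strength of one of the perturbations; and the zeros form the compact set `C`. -/
structure IsPerturbationSystem (s : ℝ → ∀ x, E x) (c : ι → B) (K : ι → EB →L[ℝ] F)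
    (ρ : ι → ℝ × B → ℝ) (V : Set (ℝ × B)) (O : ι → Set (ParamSpace K × B)) (r : ℝ)
    (C : Set (ParamSpace K × B)) : Prop where
  finiteDimensional : ∀ i, FiniteDimensional ℝ (K i).range
  isOpen : IsOpen V
  pos : 0 < r
  contMDiffAt : ∀ (q : ParamSpace K) (x : B), (q.1, x) ∈ V →
    ContMDiffAt (𝓘(ℝ, ParamSpace K).prod 𝓘(ℝ, EB)) (𝓘(ℝ, EB).prod 𝓘(ℝ, F)) 2
      (totalFamily F (perturbation s c K ρ)) (q, x)
  isOpen_domain : ∀ i, IsOpen (O i)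
  mem_coordDomain : ∀ i, ∀ p ∈ O i, p.2 ∈ coordDomain EB F E (c i)
  isReductionDomain : ∀ i, IsReductionDomain (localRep EB F (c i) (perturbation s c K ρ)) (K i)
    (chartImage (c i) (O i))
  mem_domain : ∀ i (q : ParamSpace K) (x : B), (q.1, x) ∈ V → ‖q.2‖ < r →
    (q.1, x) ∈ tsupport (ρ i) → (q, x) ∈ O i
  exists_eq_one : ∀ p ∈ V, ∃ i, ρ i =ᶠ[𝓝 p] fun _ => 1
  isCompact : IsCompact C
  eq_zero : ∀ p ∈ C, perturbation s c K ρ p.1 p.2 = 0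
  mem_of_eq_zero : ∀ (q : ParamSpace K) (x : B), (q.1, x) ∈ V → ‖q.2‖ < r →
    perturbation s c K ρ q x = 0 → (q, x) ∈ C
  mem_of_mem : ∀ (q : ParamSpace K) (x : B), q.1 ∈ Icc (0 : ℝ) 1 → ‖q.2‖ < r → (q, x) ∈ C →
    (q.1, x) ∈ V
  mem_of_zero : ∀ t ∈ Icc (0 : ℝ) 1, ∀ x, s t x = 0 → (t, x) ∈ V

theorem fiberDeriv_localRep_perturbation_zero {s : ℝ → ∀ x, E x} {c : ι → B}
    {K : ι → EB →L[ℝ] F} {ρ : ι → ℝ × B → ℝ} {t : ℝ} {x b : B} (hx : x ∈ coordDomain EB F E b)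
    [∀ i, FiniteDimensional ℝ (K i).range]
    (hs : ContMDiffAt (𝓘(ℝ, ℝ).prod 𝓘(ℝ, EB)) (𝓘(ℝ, EB).prod 𝓘(ℝ, F)) 2 (totalFamily F s) (t, x))
    (hp : ContMDiffAt (𝓘(ℝ, ParamSpace K).prod 𝓘(ℝ, EB)) (𝓘(ℝ, EB).prod 𝓘(ℝ, F)) 2
      (totalFamily F (perturbation s c K ρ)) ((t, 0), x)) :
    fiberDeriv (localRep EB F b (perturbation s c K ρ)) ((t, 0), chartAt EB b x) =
      fiberDeriv (localRep EB F b s) (t, chartAt EB b x) := by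
  have h1 := hasFDerivAt_fiberDeriv ((contDiffAt_localRep hx hs).differentiableAt (by norm_num))
  have h2 := hasFDerivAt_fiberDeriv ((contDiffAt_localRep hx hp).differentiableAt (by norm_num))
  refine h2.unique ?_
  convert h1 using 1
  ext y
  simp only [localRep, totalFamily, perturbedFamily_zero]

/-- Near the unperturbed zeros, on the support of the cut-off function `ρ i`, the operator `K i`
defines a reduction of the perturbed family. -/
theorem exists_reduction_domain {s : ℝ → ∀ x, E x} {Z : Set (ℝ × B)} {z : ι → ℝ × B}
    {K : ι → EB →L[ℝ] F} {D : ι → Set (ℝ × B)} {ρ : ι → ℝ × B → ℝ} {V : Set (ℝ × B)}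
    [T2Space B]
    (hd : ∀ i, IsReductionDatum s Z (z i) (K i) (D i) (ρ i))
    (hs : ContMDiff (𝓘(ℝ, ℝ).prod 𝓘(ℝ, EB)) (𝓘(ℝ, EB).prod 𝓘(ℝ, F)) 2 (totalFamily F s))
    (hZ : IsCompact Z) (hZ0 : ∀ p ∈ Z, s p.1 p.2 = 0) (hV : IsOpen V) (hZV : Z ⊆ V)
    (hp : ∀ (q : ParamSpace K) (x : B), (q.1, x) ∈ V →
      ContMDiffAt (𝓘(ℝ, ParamSpace K).prod 𝓘(ℝ, EB)) (𝓘(ℝ, EB).prod 𝓘(ℝ, F)) 2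
        (totalFamily F (perturbation s (fun i => (z i).2) K ρ)) (q, x)) (i : ι) :
    ∃ O : Set (ParamSpace K × B), IsOpen O ∧
      (∀ t x, (t, x) ∈ Z → (t, x) ∈ tsupport (ρ i) → (((t, 0), x) : ParamSpace K × B) ∈ O) ∧
      (∀ p ∈ O, p.2 ∈ coordDomain EB F E (z i).2) ∧
      IsReductionDomain (localRep EB F (z i).2 (perturbation s (fun i => (z i).2) K ρ)) (K i)
        (chartImage (z i).2 O) := by
  have hfin : ∀ i, FiniteDimensional ℝ (K i).range := fun i => (hd i).finiteDimensional
  have : CompleteSpace (ParamSpace K) := FiniteDimensional.complete ℝ _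
  let pert := perturbation s (fun i => (z i).2) K ρ
  let j : ℝ × B → ParamSpace K × B := fun p => ((p.1, 0), p.2)
  have hj : Continuous j := by fun_prop
  let A := j '' (Z ∩ tsupport (ρ i))
  have hA : IsCompact A := (hZ.inter_right (isClosed_tsupport _)).image hj
  have hdom : ∀ p ∈ Z ∩ tsupport (ρ i), p.2 ∈ coordDomain EB F E (z i).2 := fun p h =>
    (hd i).mem_coordDomain p ((hd i).tsupport h)
  have hbij : ∀ p ∈ Z ∩ tsupport (ρ i), Function.Bijective
      (fiberDeriv (localRep EB F (z i).2 pert) ((p.1, 0), chartAt EB (z i).2 p.2) + K i) := by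
    intro p h
    rw [fiberDeriv_localRep_perturbation_zero (hdom p h) (hs (p.1, p.2)) (hp _ _ (hZV h.1))]
    exact (hd i).bijective p ((hd i).tsupport h)
  have hloc := fun p (h : p ∈ Z ∩ tsupport (ρ i)) =>
    eventually_bijective_localRep_add (hdom p h) (hp (p.1, 0) p.2 (hZV h.1)) (hbij p h)
  obtain ⟨U, hU, hUinj⟩ : ∃ U ∈ nhdsSet A, InjOn (reductionMap (z i).2 pert (K i)) U := by
    refine InjOn.exists_mem_nhdsSet ?_ hA ?_ ?_
    · rintro _ ⟨p, h, rfl⟩ _ ⟨p', h', rfl⟩ heq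
      have h0 : ∀ p ∈ Z, pert (p.1, 0) p.2 = 0 := fun p h =>
        (perturbedFamily_zero _ _).trans (hZ0 p h)
      rw [reductionMap_of_eq_zero (K i) (p := j p) (hdom p h) (h0 p h.1),
        reductionMap_of_eq_zero (K i) (p := j p') (hdom p' h') (h0 p' h'.1)] at heq
      simp only [j, Prod.mk.injEq, and_true] at heq
      refine congrArg j ((hd i).injOn ((hd i).tsupport h) ((hd i).tsupport h') ?_)
      rw [reductionMap_of_eq_zero (K i) (hdom p h) (hZ0 p h.1),
        reductionMap_of_eq_zero (K i) (hdom p' h') (hZ0 p' h'.1), heq.1, heq.2]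
    · rintro _ ⟨p, h, rfl⟩
      exact continuousAt_reductionMap (K i) (hdom p h) (hp (p.1, 0) p.2 (hZV h.1))
    · rintro _ ⟨p, h, rfl⟩
      exact (hloc p h).2
  have hW : {p : ParamSpace K × B | (p.1.1, p.2) ∈ V ∧ p.2 ∈ coordDomain EB F E (z i).2 ∧
      Function.Bijective
        (fiberDeriv (localRep EB F (z i).2 pert) (p.1, chartAt EB (z i).2 p.2) + K i)} ∈
      nhdsSet A := by
    rw [mem_nhdsSet_iff_forall]
    rintro _ ⟨p, h, rfl⟩
    have h1 : ∀ᶠ p' : ParamSpace K × B in 𝓝 (j p), (p'.1.1, p'.2) ∈ V := by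
      have hc : Continuous fun p' : ParamSpace K × B => (p'.1.1, p'.2) := by fun_prop
      exact hc.continuousAt.eventually (hV.mem_nhds (hZV h.1))
    have h2 : ∀ᶠ p' : ParamSpace K × B in 𝓝 (j p), p'.2 ∈ coordDomain EB F E (z i).2 :=
      continuous_snd.continuousAt.eventually ((isOpen_coordDomain _).mem_nhds (hdom p h))
    exact h1.and (h2.and (hloc p h).1)
  obtain ⟨O, hO, hAO, hOsub⟩ := mem_nhdsSet_iff_exists.1 (Filter.inter_mem hU hW)
  refine ⟨O, hO, fun t x h h' => hAO ⟨(t, x), ⟨h, h'⟩, rfl⟩, fun p h => (hOsub h).2.2.1, ?_⟩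
  exact isReductionDomain_chartImage hO (fun p h => (hOsub h).2.2.1)
    (fun p h => hp _ _ (hOsub h).2.1) (fun p h => (hOsub h).2.2.2)
    (hUinj.mono fun p h => (hOsub h).1)

/-- A family of sections is locally proper near a zero that lies in a reduction domain. -/
theorem exists_isCompact_zeros_nhds {Q : Type*} [NormedAddCommGroup Q] [NormedSpace ℝ Q]
    [FiniteDimensional ℝ Q] {s : Q → ∀ x, E x} {c : B} {K : EB →L[ℝ] F}
    [FiniteDimensional ℝ K.range] {O : Set (Q × B)} (hO : IsOpen O)
    (hdom : ∀ p ∈ O, p.2 ∈ coordDomain EB F E c)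
    (hr : IsReductionDomain (localRep EB F c s) K (chartImage c O)) {p : Q × B} (hp : p ∈ O)
    (h0 : s p.1 p.2 = 0) :
    ∃ C, IsCompact C ∧ (∀ p ∈ C, s p.1 p.2 = 0) ∧
      ∃ N ∈ 𝓝 p, ∀ p' ∈ N, s p'.1 p'.2 = 0 → p' ∈ C := by
  obtain ⟨C, hC, hCsub, U, hU, hUC⟩ := hr.exists_isCompact_zeros
    ((mem_chartImage (q := p.1) (hdom p hp).1).2 hp)
    ((localRep_chart_eq_zero_iff c s p.1 (hdom p hp)).2 h0)
  have hcont : ContinuousOn (fun p : Q × EB => (p.1, (chartAt EB c).symm p.2)) C :=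
    continuousOn_fst.prodMk ((chartAt EB c).continuousOn_symm.comp continuousOn_snd
      fun p h => (hCsub h).1.1)
  refine ⟨_, hC.image_of_continuousOn hcont, ?_, _,
    Filter.inter_mem (hO.mem_nhds hp) (continuousAt_prodMap_chart (hdom p hp) hU), ?_⟩
  · rintro _ ⟨p', h, rfl⟩
    have h1 := hdom _ (hCsub h).1.2
    refine (localRep_chart_eq_zero_iff c s p'.1 h1).1 ?_
    simp only [(chartAt EB c).right_inv (hCsub h).1.1]
    exact (hCsub h).2
  · rintro p' ⟨h1, h2⟩ h
    exact ⟨_, hUC _ h2 ((localRep_chart_eq_zero_iff c s p'.1 (hdom _ h1)).2 h),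
      Prod.ext rfl ((chartAt EB c).left_inv (hdom _ h1).1)⟩

end PerturbationSystem

section PerturbationSystemExistence

set_option linter.unusedSectionVars false

variable {EB : Type*} [NormedAddCommGroup EB] [NormedSpace ℝ EB]
  {F : Type*} [NormedAddCommGroup F] [NormedSpace ℝ F]
  {B : Type*} [TopologicalSpace B] [ChartedSpace EB B]
  {E : B → Type*} [TopologicalSpace (TotalSpace F E)]
  [∀ x, AddCommGroup (E x)] [∀ x, Module ℝ (E x)] [∀ x, TopologicalSpace (E x)]
  [FiberBundle F E] [VectorBundle ℝ F E]
  [IsManifold 𝓘(ℝ, EB) 2 B] [ContMDiffVectorBundle 2 F E 𝓘(ℝ, EB)]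
  [CompleteSpace EB] [CompleteSpace F]

/-- The perturbation of a reduction datum is smooth near the unperturbed zeros. -/
theorem exists_isOpen_contMDiffAt_perturbation {ι : Type*} [Fintype ι] {s : ℝ → ∀ x, E x}
    {Z : Set (ℝ × B)} {z : ι → ℝ × B} {K : ι → EB →L[ℝ] F} {D : ι → Set (ℝ × B)}
    {ρ : ι → ℝ × B → ℝ} (hd : ∀ i, IsReductionDatum s Z (z i) (K i) (D i) (ρ i))
    (hs : ContMDiff (𝓘(ℝ, ℝ).prod 𝓘(ℝ, EB)) (𝓘(ℝ, EB).prod 𝓘(ℝ, F)) 2 (totalFamily F s)) :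
    ∃ V : Set (ℝ × B), IsOpen V ∧ Z ⊆ V ∧ ∀ (q : ParamSpace K) (x : B), (q.1, x) ∈ V →
      ContMDiffAt (𝓘(ℝ, ParamSpace K).prod 𝓘(ℝ, EB)) (𝓘(ℝ, EB).prod 𝓘(ℝ, F)) 2
        (totalFamily F (perturbation s (fun i => (z i).2) K ρ)) (q, x) := by
  have hfin : ∀ i, FiniteDimensional ℝ (K i).range := fun i => (hd i).finiteDimensional
  have hV : {p : ℝ × B | ∀ i, ContMDiffAt (𝓘(ℝ, ℝ).prod 𝓘(ℝ, EB)) 𝓘(ℝ, ℝ) 2 (ρ i) p ∧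
      p ∈ (tsupport (ρ i))ᶜ ∪ D i} ∈ nhdsSet Z := by
    rw [mem_nhdsSet_iff_forall]
    intro p hp
    refine Filter.eventually_all.2 fun i => Filter.Eventually.and ?_ ?_
    · exact (contMDiffAt_iff_contMDiffAt_nhds (by simp)).1 ((hd i).contMDiffAt p hp)
    · refine ((isClosed_tsupport _).isOpen_compl.union (hd i).isOpen).mem_nhds ?_
      by_cases h : p ∈ tsupport (ρ i)
      · exact Or.inr ((hd i).tsupport ⟨hp, h⟩)
      · exact Or.inl h
  obtain ⟨V, hVo, hZV, hVsub⟩ := mem_nhdsSet_iff_exists.1 hV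
  refine ⟨V, hVo, hZV, fun q x hx => contMDiffAt_perturbedFamily (hs _)
    (fun i => (hVsub hx i).1) fun i hi => ?_⟩
  rcases (hVsub hx i).2 with h | h
  · exact absurd hi h
  · exact ((hd i).mem_coordDomain _ h).2

/-- A family of sections over `[0, 1]` with compact set of zeros and fiberwise differentials of
index zero carries a perturbation system. -/
theorem exists_isPerturbationSystem [T2Space B] {s : ℝ → ∀ x, E x}
    (hs : ContMDiff (𝓘(ℝ, ℝ).prod 𝓘(ℝ, EB)) (𝓘(ℝ, EB).prod 𝓘(ℝ, F)) 2 (totalFamily F s))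
    (hZ : IsCompact {p : ℝ × B | p.1 ∈ Icc (0 : ℝ) 1 ∧ s p.1 p.2 = 0})
    (hfred : ∀ t ∈ Icc (0 : ℝ) 1, ∀ x, s t x = 0 →
      (fiberwiseDifferential (EB := EB) (fun y => totalFamily F s (t, y)) x).IsFredholm ∧
        fredholmIndex (fiberwiseDifferential (EB := EB) (fun y => totalFamily F s (t, y)) x) = 0) :
    ∃ (T : Finset {p : ℝ × B | p.1 ∈ Icc (0 : ℝ) 1 ∧ s p.1 p.2 = 0}) (K : T → EB →L[ℝ] F)
      (ρ : T → ℝ × B → ℝ) (V : Set (ℝ × B)) (O : T → Set (ParamSpace K × B)) (r : ℝ)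
      (C : Set (ParamSpace K × B)),
      IsPerturbationSystem s (fun i : T => i.1.1.2) K ρ V O r C := by
  set Z := {p : ℝ × B | p.1 ∈ Icc (0 : ℝ) 1 ∧ s p.1 p.2 = 0} with hZdef
  have hZ0 : ∀ p ∈ Z, s p.1 p.2 = 0 := fun p hp => hp.2
  have hex := fun z : Z => exists_isReductionDatum hs hZ hZ0 z.2
    (hfred _ z.2.1 _ z.2.2).1 (hfred _ z.2.1 _ z.2.2).2
  choose K D ρ hd using hex
  obtain ⟨T, hT⟩ := hZ.elim_nhds_subcover' (fun z hz => {p | ρ ⟨z, hz⟩ =ᶠ[𝓝 p] fun _ => 1})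
    fun z hz => eventually_eventually_nhds.2 (hd ⟨z, hz⟩).eq_one
  have hcover : ∀ p ∈ Z, ∃ i : T, ρ i =ᶠ[𝓝 p] fun _ => 1 := fun p hp => by
    obtain ⟨i, hi, h⟩ := mem_iUnion₂.1 (hT hp)
    exact ⟨⟨i, hi⟩, h⟩
  let K' : T → EB →L[ℝ] F := fun i => K i
  let ρ' : T → ℝ × B → ℝ := fun i => ρ i
  have hd' : ∀ i : T, IsReductionDatum s Z i.1.1 (K' i) (D i) (ρ' i) := fun i => hd i
  have hfin : ∀ i, FiniteDimensional ℝ (K' i).range := fun i => (hd' i).finiteDimensional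
  obtain ⟨V₁, hV₁, hZV₁, hsmooth⟩ := exists_isOpen_contMDiffAt_perturbation hd' hs
  have hO := exists_reduction_domain hd' hs hZ hZ0 hV₁ hZV₁ hsmooth
  choose O hOo hZO hOdom hOred using hO
  let pert := perturbation s (fun i : T => i.1.1.2) K' ρ'
  have hpert0 : ∀ t x, pert (t, 0) x = s t x := perturbedFamily_zero
  let j : ℝ × B → ParamSpace K' × B := fun p => ((p.1, 0), p.2)
  have hj : Continuous j := by fun_prop
  -- a compact set of zeros of the perturbed family around the unperturbed zeros
  have hloc : ∀ p ∈ j '' Z, ∃ C : Set (ParamSpace K' × B), IsCompact C ∧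
      (∀ p ∈ C, pert p.1 p.2 = 0) ∧
      ∃ N : Set (ParamSpace K' × B), IsOpen N ∧ p ∈ N ∧ ∀ p' ∈ N, pert p'.1 p'.2 = 0 → p' ∈ C := by
    rintro _ ⟨p, hp, rfl⟩
    obtain ⟨i, hi⟩ := hcover p hp
    have hsupp : p ∈ tsupport (ρ' i) := subset_tsupport _ (by simp [ρ', hi.self_of_nhds])
    obtain ⟨C, hC, hC0, N, hN, hNC⟩ := exists_isCompact_zeros_nhds (hOo i) (hOdom i) (hOred i)
      (hZO i _ _ hp hsupp) ((hpert0 _ _).trans hp.2)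
    obtain ⟨N', hN'N, hN', hpN'⟩ := mem_nhds_iff.1 hN
    exact ⟨C, hC, hC0, N', hN', hpN', fun p' h => hNC p' (hN'N h)⟩
  choose! C₀ hC₀ hC₀0 N hN hjN hNC using hloc
  obtain ⟨T', hT'Z, hT'⟩ := (hZ.image hj).elim_nhds_subcover N
    fun p hp => (hN p hp).mem_nhds (hjN p hp)
  let C := ⋃ p ∈ T', C₀ p
  have hC : IsCompact C := T'.isCompact_biUnion fun p hp => hC₀ p (hT'Z p hp)
  have hCzero : ∀ p ∈ C, pert p.1 p.2 = 0 := fun p hp => by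
    obtain ⟨p', hp', h⟩ := mem_iUnion₂.1 hp
    exact hC₀0 p' (hT'Z p' hp') p h
  -- the properties required near the unperturbed zeros hold over a tube
  let W : Set ((ℝ × B) × ∀ i, (K' i).range) :=
    {p | (∃ p' ∈ T', ((p.1.1, p.2), p.1.2) ∈ N p') ∧
      ∀ i, p.1 ∈ tsupport (ρ' i) → ((p.1.1, p.2), p.1.2) ∈ O i}
  have hW : W ∈ nhdsSet (Z ×ˢ {(0 : ∀ i, (K' i).range)}) := by
    rw [mem_nhdsSet_iff_forall]
    rintro ⟨p, v⟩ ⟨hp, hv⟩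
    obtain rfl : v = 0 := hv
    have hc : Continuous fun p : (ℝ × B) × ∀ i, (K' i).range =>
        (((p.1.1, p.2), p.1.2) : ParamSpace K' × B) := by fun_prop
    refine Filter.Eventually.and ?_ (Filter.eventually_all.2 fun i => ?_)
    · obtain ⟨p', hp', h⟩ := mem_iUnion₂.1 (hT' ⟨p, hp, rfl⟩)
      exact (hc.continuousAt.eventually ((hN p' (hT'Z p' hp')).mem_nhds h)).mono
        fun _ h => ⟨p', hp', h⟩
    · by_cases h : p ∈ tsupport (ρ' i)
      · exact (hc.continuousAt.eventually ((hOo i).mem_nhds (hZO i _ _ hp h))).mono fun _ h _ => h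
      · have h1 : ∀ᶠ p' in 𝓝 p, p' ∉ tsupport (ρ' i) :=
          (isClosed_tsupport _).isOpen_compl.mem_nhds h
        exact ((continuous_fst (Y := ∀ i, (K' i).range)).continuousAt (x := (p, 0)) |>.eventually
          h1).mono fun _ h h' => absurd h' h
  obtain ⟨W', hW', hZW', hW'W⟩ := mem_nhdsSet_iff_exists.1 hW
  obtain ⟨V₂, U, hV₂, hU, hZV₂, hU0, hVU⟩ :=
    generalized_tube_lemma hZ isCompact_singleton hW' hZW'
  obtain ⟨r₀, hr₀, hr₀U⟩ := Metric.isOpen_iff.1 hU 0 (hU0 rfl)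
  obtain ⟨V₃, hV₃, hZV₃, hone⟩ : ∃ V₃ : Set (ℝ × B), IsOpen V₃ ∧ Z ⊆ V₃ ∧
      ∀ p ∈ V₃, ∃ i, ρ' i =ᶠ[𝓝 p] fun _ => 1 := by
    refine ⟨{p | ∃ i, ρ' i =ᶠ[𝓝 p] fun _ => 1}, isOpen_iff_mem_nhds.2 fun p hp => ?_, hcover,
      fun p hp => hp⟩
    obtain ⟨i, hi⟩ := hp
    exact (eventually_eventually_nhds.2 hi).mono fun p h => ⟨i, h⟩
  let V := V₁ ∩ V₂ ∩ V₃
  have hV : IsOpen V := (hV₁.inter hV₂).inter hV₃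
  have hZV : Z ⊆ V := fun p hp => ⟨⟨hZV₁ hp, hZV₂ hp⟩, hZV₃ hp⟩
  -- zeros in `C` outside of `V` have parameters bounded away from `0`
  let bad : Set (ParamSpace K' × B) := C ∩ {p | p.1.1 ∈ Icc (0 : ℝ) 1 ∧ (p.1.1, p.2) ∉ V}
  have hbad : IsCompact bad := by
    refine hC.inter_right (IsClosed.inter ?_ ?_)
    · exact isClosed_Icc.preimage (by fun_prop : Continuous fun p : ParamSpace K' × B => p.1.1)
    · exact hV.isClosed_compl.preimage
        (by fun_prop : Continuous fun p : ParamSpace K' × B => (p.1.1, p.2))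
  obtain ⟨r₁, hr₁, hr₁b⟩ : ∃ r₁ > 0, ∀ p ∈ bad, r₁ ≤ ‖p.1.2‖ := by
    refine hbad.exists_forall_le' (f := fun p => ‖p.1.2‖) (by fun_prop) ?_
    rintro ⟨⟨t, v⟩, x⟩ ⟨hpC, ht, hpV⟩
    refine norm_pos_iff.2 fun h0 => hpV (hZV ⟨ht, ?_⟩)
    obtain rfl : v = 0 := h0
    exact (hpert0 t x).symm.trans (hCzero _ hpC)
  have hmemW : ∀ (q : ParamSpace K') (x : B), (q.1, x) ∈ V → ‖q.2‖ < min r₀ r₁ →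
      (((q.1, x), q.2) : (ℝ × B) × ∀ i, (K' i).range) ∈ W := fun q x hx hq =>
    hW'W (hVU ⟨hx.1.2, hr₀U (by simpa using hq.trans_le (min_le_left _ _))⟩)
  refine ⟨T, K', ρ', V, O, min r₀ r₁, C, hfin, hV, lt_min hr₀ hr₁,
    fun q x hx => hsmooth q x hx.1.1, hOo, hOdom, hOred,
    fun i q x hx hq h => (hmemW q x hx hq).2 i h, fun p hp => hone p hp.2, hC, hCzero,
    fun q x hx hq h0 => ?_, fun q x hq hqr h => ?_, fun t ht x h0 => hZV ⟨ht, h0⟩⟩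
  · obtain ⟨p', hp', h⟩ := (hmemW q x hx hq).1
    exact mem_iUnion₂.2 ⟨p', hp', hNC p' (hT'Z p' hp') _ h h0⟩
  · by_contra hV
    exact absurd (hr₁b (q, x) ⟨h, hq, hV⟩) (not_le.2 (hqr.trans_le (min_le_right _ _)))

end PerturbationSystemExistence

/-! ### Counting the fibers of a compact set -/

section CompactFibers

variable {Q B : Type*} [TopologicalSpace Q] [T2Space Q] [TopologicalSpace B]
  {C : Set (Q × B)} {q : Q}

/-- A property which holds near the fiber of a compact set over `q` holds on the fibers over the
points close to `q`. -/
theorem IsCompact.eventually_fiber (hC : IsCompact C) {P : Q × B → Prop}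
    (hP : ∀ x, (q, x) ∈ C → ∀ᶠ p in 𝓝 (q, x), P p) :
    ∀ᶠ q' in 𝓝 q, ∀ x, (q', x) ∈ C → P (q', x) := by
  have h1 : IsClosed (Prod.fst '' (C \ interior {p | P p})) :=
    ((hC.diff isOpen_interior).image continuous_fst).isClosed
  have h2 : q ∉ Prod.fst '' (C \ interior {p | P p}) := by
    rintro ⟨⟨q', x⟩, ⟨hxC, hx⟩, rfl⟩
    exact hx (mem_interior_iff_mem_nhds.2 (hP x hxC))
  filter_upwards [h1.isOpen_compl.mem_nhds h2] with q' hq' x hx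
  by_contra h
  exact hq' ⟨(q', x), ⟨hx, fun h' => h (interior_subset (s := {p | P p}) h')⟩, rfl⟩

theorem IsCompact.finite_fiber [T2Space B] (hC : IsCompact C)
    (hiso : ∀ x, (q, x) ∈ C → ∀ᶠ y in 𝓝 x, (q, y) ∈ C → y = x) : {x | (q, x) ∈ C}.Finite := by
  have hcomp : IsCompact {x | (q, x) ∈ C} :=
    (hC.image continuous_snd).of_isClosed_subset
      (hC.isClosed.preimage (by fun_prop : Continuous fun x : B => (q, x)))
      fun x hx => ⟨(q, x), hx, rfl⟩
  obtain ⟨T, -, hT⟩ := hcomp.elim_nhds_subcover (fun x => {y | (q, y) ∈ C → y = x}) hiso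
  refine T.finite_toSet.subset fun y hy => ?_
  obtain ⟨x, hx, h⟩ := mem_iUnion₂.1 (hT hy)
  rwa [h hy]

/-- The number of points of the fibers of a compact set is locally constant where the compact set
is locally a graph. -/
theorem IsCompact.eventually_ncard_fiber_eq [T2Space B] (hC : IsCompact C)
    (hgraph : ∀ x, (q, x) ∈ C → ∃ γ : Q → B, ContinuousAt γ q ∧ γ q = x ∧
      ∀ᶠ p in 𝓝 (q, x), p ∈ C ↔ p.2 = γ p.1) :
    {x | (q, x) ∈ C}.Finite ∧ ∀ᶠ q' in 𝓝 q, {x | (q', x) ∈ C}.ncard = {x | (q, x) ∈ C}.ncard := by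
  replace hgraph : ∀ x, ∃ γ : Q → B, (q, x) ∈ C → ContinuousAt γ q ∧ γ q = x ∧
      ∀ᶠ p in 𝓝 (q, x), p ∈ C ↔ p.2 = γ p.1 := fun x => by
    by_cases hx : (q, x) ∈ C
    · exact (hgraph x hx).imp fun γ h _ => h
    · exact ⟨fun _ => x, fun h => absurd h hx⟩
  choose γ hγ' using hgraph
  have hγc := fun x hx => (hγ' x hx).1
  have hγq := fun x hx => (hγ' x hx).2.1
  have hγ := fun x hx => (hγ' x hx).2.2
  have hfin : {x | (q, x) ∈ C}.Finite := hC.finite_fiber fun x hx => by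
    have h : ∀ᶠ y in 𝓝 x, (q, y) ∈ C ↔ y = γ x q :=
      (Continuous.prodMk_right q).continuousAt.eventually (hγ x hx)
    exact h.mono fun y hy hyC => (hy.1 hyC).trans (hγq x hx)
  refine ⟨hfin, ?_⟩
  obtain ⟨U, hU, hUd⟩ := hfin.t2_separation
  have h1 : ∀ᶠ q' in 𝓝 q, ∀ x ∈ {x | (q, x) ∈ C}, γ x q' ∈ U x ∧ (q', γ x q') ∈ C := by
    refine (Filter.eventually_all_finite hfin).2 fun x hx => ?_
    have hc : Filter.Tendsto (fun q' => (q', γ x q')) (𝓝 q) (𝓝 (q, x)) := by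
      have := continuousAt_id.prodMk (hγc x hx)
      rwa [ContinuousAt, hγq x hx] at this
    have hcγ : Filter.Tendsto (γ x) (𝓝 q) (𝓝 x) := by
      have := hγc x hx
      rwa [ContinuousAt, hγq x hx] at this
    exact (hcγ.eventually ((hU x).2.mem_nhds (hU x).1)).and
      ((hc.eventually (hγ x hx)).mono fun q' h => h.2 rfl)
  have h2 : ∀ᶠ q' in 𝓝 q, ∀ x, (q', x) ∈ C →
      (q', x) ∈ C → ∃ y ∈ {x | (q, x) ∈ C}, x = γ y q' :=
    hC.eventually_fiber (P := fun p => p ∈ C → ∃ y ∈ {x | (q, x) ∈ C}, p.2 = γ y p.1)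
      fun x hx => (hγ x hx).mono fun p h hp => ⟨x, hx, h.1 hp⟩
  filter_upwards [h1, h2] with q' h1 h2
  have himage : {x | (q', x) ∈ C} = (fun x => γ x q') '' {x | (q, x) ∈ C} := by
    ext y
    constructor
    · intro hy
      obtain ⟨x, hx, rfl⟩ := h2 y hy hy
      exact ⟨x, hx, rfl⟩
    · rintro ⟨x, hx, rfl⟩
      exact (h1 x hx).2
  rw [himage]
  refine InjOn.ncard_image fun x hx y hy h => ?_
  by_contra hxy
  refine disjoint_left.1 (hUd hx hy hxy) (h1 x hx).1 ?_
  have h' : γ x q' = γ y q' := h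
  rw [h']
  exact (h1 y hy).1

end CompactFibers

/-! ### Regular zeros -/

section RegularZeros

set_option linter.unusedSectionVars false

variable {Q : Type*} [NormedAddCommGroup Q] [NormedSpace ℝ Q]
  {EB : Type*} [NormedAddCommGroup EB] [NormedSpace ℝ EB]
  {F : Type*} [NormedAddCommGroup F] [NormedSpace ℝ F]
  {B : Type*} [TopologicalSpace B] [ChartedSpace EB B]
  {E : B → Type*} [TopologicalSpace (TotalSpace F E)]
  [∀ x, AddCommGroup (E x)] [∀ x, Module ℝ (E x)] [∀ x, TopologicalSpace (E x)]
  [FiberBundle F E] [VectorBundle ℝ F E]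

variable (EB F) in
/-- The fiberwise differential of the section `s q` at `x` is bijective. -/
def IsRegularAt (s : Q → ∀ x, E x) (q : Q) (x : B) : Prop :=
  Function.Bijective (fiberwiseDifferential (EB := EB) (fun y => totalFamily F s (q, y)) x)

variable [IsManifold 𝓘(ℝ, EB) 2 B] [ContMDiffVectorBundle 2 F E 𝓘(ℝ, EB)]
  [CompleteSpace Q] [CompleteSpace EB] [CompleteSpace F]

theorem IsRegularAt.exists_zero_graph {s : Q → ∀ x, E x} {q : Q} {x : B}
    (hreg : IsRegularAt EB F s q x) (h0 : s q x = 0)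
    (hs : ContMDiffAt (𝓘(ℝ, Q).prod 𝓘(ℝ, EB)) (𝓘(ℝ, EB).prod 𝓘(ℝ, F)) 2 (totalFamily F s)
      (q, x)) :
    ∃ γ : Q → B, ContinuousAt γ q ∧ γ q = x ∧
      ∀ᶠ p in 𝓝 (q, x), s p.1 p.2 = 0 ↔ p.2 = γ p.1 := by
  have hx := mem_coordDomain_self (EB := EB) (F := F) (E := E) x
  let φ := chartAt EB x
  obtain ⟨g, hgc, hgq, hg⟩ := exists_local_zero_graph (contDiffAt_localRep hx hs)
    ((bijective_fiberDeriv_localRep_iff hx hs h0).2 hreg)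
    ((localRep_chart_eq_zero_iff x s q hx).2 h0)
  have hgq' : g q = φ x := hgq
  have htarget : φ.target ∈ 𝓝 (g q) := by
    rw [hgq']
    exact φ.open_target.mem_nhds (φ.map_source hx.1)
  refine ⟨fun q => φ.symm (g q), ?_, ?_, ?_⟩
  · exact ContinuousAt.comp (φ.continuousAt_symm (mem_of_mem_nhds htarget)) hgc
  · change φ.symm (g q) = x
    rw [hgq', φ.left_inv hx.1]
  · have h1 : ∀ᶠ p : Q × B in 𝓝 (q, x), p.2 ∈ coordDomain EB F E x :=
      continuous_snd.continuousAt.eventually ((isOpen_coordDomain x).mem_nhds hx)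
    have h2 : ∀ᶠ p : Q × B in 𝓝 (q, x), g p.1 ∈ φ.target :=
      (ContinuousAt.comp (f := Prod.fst) (x := (q, x)) hgc continuousAt_fst) htarget
    filter_upwards [h1, h2, (continuousAt_prodMap_chart (q := q) hx).eventually hg]
      with p hp hp2 hp3
    rw [← localRep_chart_eq_zero_iff x s p.1 hp, hp3]
    constructor
    · intro h
      rw [← h, φ.left_inv hp.1]
    · intro h
      change φ p.2 = g p.1
      rw [h, φ.right_inv hp2]

theorem IsRegularAt.eventually {s : Q → ∀ x, E x} {q : Q} {x : B}
    (hreg : IsRegularAt EB F s q x) (h0 : s q x = 0)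
    (hs : ∀ᶠ p in 𝓝 (q, x), ContMDiffAt (𝓘(ℝ, Q).prod 𝓘(ℝ, EB)) (𝓘(ℝ, EB).prod 𝓘(ℝ, F)) 2
      (totalFamily F s) p) :
    ∀ᶠ p in 𝓝 (q, x), s p.1 p.2 = 0 → IsRegularAt EB F s p.1 p.2 := by
  have hx := mem_coordDomain_self (EB := EB) (F := F) (E := E) x
  have h1 : ∀ᶠ p : Q × B in 𝓝 (q, x), p.2 ∈ coordDomain EB F E x :=
    continuous_snd.continuousAt.eventually ((isOpen_coordDomain x).mem_nhds hx)
  have h2 := eventually_bijective_fiberDeriv (contDiffAt_localRep hx hs.self_of_nhds)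
    ((bijective_fiberDeriv_localRep_iff hx hs.self_of_nhds h0).2 hreg)
  filter_upwards [h1, hs, (continuousAt_prodMap_chart (q := q) hx).eventually h2]
    with p hp hp2 hp3 hp0
  exact (bijective_fiberDeriv_localRep_iff hp hp2 hp0).1 hp3

end RegularZeros

/-! ### The parity of the number of zeros of the perturbed sections -/

section Parity

set_option linter.unusedSectionVars false

/-- Reduction domains can be pulled back along paths of parameters. -/
theorem IsReductionDomain.comp_path {P Q X F : Type*} [NormedAddCommGroup P] [NormedSpace ℝ P]
    [NormedAddCommGroup Q] [NormedSpace ℝ Q] [NormedAddCommGroup X] [NormedSpace ℝ X]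
    [NormedAddCommGroup F] [NormedSpace ℝ F]
    {f : Q × X → F} {K : X →L[ℝ] F} {D : Set (Q × X)}
    (hD : IsReductionDomain f K D) {g : P → Q} (hg : ContDiff ℝ 2 g) {D' : Set (P × X)}
    (hD' : IsOpen D') (hsub : ∀ p ∈ D', (g p.1, p.2) ∈ D) :
    IsReductionDomain (fun p : P × X => f (g p.1, p.2)) K D' ∧
      ∀ p ∈ D', fiberDeriv (fun p : P × X => f (g p.1, p.2)) p = fiberDeriv f (g p.1, p.2) := by
  have hs : ∀ p ∈ D', ContDiffAt ℝ 2 (fun p : P × X => f (g p.1, p.2)) p := fun p hp =>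
    (hD.contDiffAt _ (hsub p hp)).comp p
      ((hg.comp contDiff_fst).prodMk contDiff_snd).contDiffAt
  have hd : ∀ p ∈ D', fiberDeriv (fun p : P × X => f (g p.1, p.2)) p =
      fiberDeriv f (g p.1, p.2) := fun p hp =>
    (hasFDerivAt_fiberDeriv ((hs p hp).differentiableAt (by norm_num))).unique
      (hasFDerivAt_fiberDeriv ((hD.contDiffAt _ (hsub p hp)).differentiableAt (by norm_num)))
  refine ⟨⟨hD', hs, fun p hp => ?_, fun p hp p' hp' h => ?_⟩, hd⟩
  · rw [hd p hp]
    exact hD.bijective _ (hsub p hp)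
  · simp only [Prod.mk.injEq] at h
    have h1 := hD.injOn (hsub p hp) (hsub p' hp') (Prod.ext (congrArg g h.1) h.2)
    rw [Prod.mk.injEq] at h1
    exact Prod.ext h.1 h1.2

variable {EB : Type*} [NormedAddCommGroup EB] [NormedSpace ℝ EB]
  {F : Type*} [NormedAddCommGroup F] [NormedSpace ℝ F]
  {B : Type*} [TopologicalSpace B] [ChartedSpace EB B] [T2Space B]
  {E : B → Type*} [TopologicalSpace (TotalSpace F E)]
  [∀ x, AddCommGroup (E x)] [∀ x, Module ℝ (E x)] [∀ x, TopologicalSpace (E x)]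
  [FiberBundle F E] [VectorBundle ℝ F E]
  [IsManifold 𝓘(ℝ, EB) 2 B] [ContMDiffVectorBundle 2 F E 𝓘(ℝ, EB)]
  [CompleteSpace EB] [CompleteSpace F]
  {ι : Type*} [Fintype ι]
  {s : ℝ → ∀ x, E x} {c : ι → B} {K : ι → EB →L[ℝ] F}
  {ρ : ι → ℝ × B → ℝ} {V : Set (ℝ × B)} {O : ι → Set (ParamSpace K × B)} {r : ℝ}
  {C : Set (ParamSpace K × B)}

namespace IsPerturbationSystem

variable (h : IsPerturbationSystem s c K ρ V O r C)
include h

theorem mem_iff {t : ℝ} (ht : t ∈ Icc (0 : ℝ) 1) {v : ∀ i, (K i).range} (hv : ‖v‖ < r) {x : B} :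
    ((t, v), x) ∈ C ↔ (t, x) ∈ V ∧ perturbation s c K ρ (t, v) x = 0 :=
  ⟨fun hC => ⟨h.mem_of_mem _ x ht hv hC, h.eq_zero _ hC⟩,
    fun hC => h.mem_of_eq_zero _ x hC.1 hv hC.2⟩

theorem eventually_contMDiffAt {q : ParamSpace K} {x : B} (hx : (q.1, x) ∈ V) :
    ∀ᶠ p in 𝓝 (q, x),
      ContMDiffAt (𝓘(ℝ, ParamSpace K).prod 𝓘(ℝ, EB)) (𝓘(ℝ, EB).prod 𝓘(ℝ, F)) 2
        (totalFamily F (perturbation s c K ρ)) p := by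
  have hc : Continuous fun p : ParamSpace K × B => (p.1.1, p.2) := by fun_prop
  exact (hc.continuousAt.eventually (h.isOpen.mem_nhds hx)).mono fun p hp =>
    h.contMDiffAt p.1 p.2 hp

/-- At a parameter whose zeros are all regular, the zeros are finite in number, and for nearby
parameters the zeros are regular and their number is the same. -/
theorem eventually_ncard_eq {t : ℝ} (ht : t ∈ Icc (0 : ℝ) 1) {v : ∀ i, (K i).range} (hv : ‖v‖ < r)
    (hreg : ∀ x, ((t, v), x) ∈ C → IsRegularAt EB F (perturbation s c K ρ) (t, v) x) :
    {x | ((t, v), x) ∈ C}.Finite ∧ ∀ᶠ q in 𝓝 ((t, v) : ParamSpace K),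
      (∀ x, (q, x) ∈ C → IsRegularAt EB F (perturbation s c K ρ) q x) ∧
        {x | (q, x) ∈ C}.ncard = {x | ((t, v), x) ∈ C}.ncard := by
  have hfin := h.finiteDimensional
  have : CompleteSpace (ParamSpace K) := FiniteDimensional.complete ℝ _
  have h1 := h.isCompact.eventually_fiber (q := (t, v))
    (P := fun p => p ∈ C → IsRegularAt EB F (perturbation s c K ρ) p.1 p.2) fun x hx =>
      ((hreg x hx).eventually (h.eq_zero _ hx)
        (h.eventually_contMDiffAt (h.mem_of_mem _ x ht hv hx))).mono
          fun p hp hpC => hp (h.eq_zero p hpC)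
  have h2 := h.isCompact.eventually_ncard_fiber_eq (q := (t, v)) fun x hx => by
    have hxV := h.mem_of_mem _ x ht hv hx
    obtain ⟨γ, hγc, hγq, hγ⟩ := (hreg x hx).exists_zero_graph (h.eq_zero _ hx)
      (h.contMDiffAt _ x hxV)
    refine ⟨γ, hγc, hγq, ?_⟩
    have hc : Continuous fun p : ParamSpace K × B => (p.1.1, p.2) := by fun_prop
    have hc' : Continuous fun p : ParamSpace K × B => ‖p.1.2‖ := by fun_prop
    filter_upwards [hγ, hc.continuousAt.eventually (h.isOpen.mem_nhds hxV),
      hc'.continuousAt.eventually_lt_const (by exact hv)] with p hp hpV hpr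
    rw [← hp]
    exact ⟨fun hC => h.eq_zero p hC, fun h0 => h.mem_of_eq_zero p.1 p.2 hpV hpr h0⟩
  refine ⟨h2.1, ?_⟩
  filter_upwards [h1, h2.2] with q hq hq'
  exact ⟨fun x hx => hq x hx hx, hq'⟩

end IsPerturbationSystem

end Parity

section ParityDense

set_option linter.unusedSectionVars false

variable {EB : Type*} [NormedAddCommGroup EB] [NormedSpace ℝ EB]
  {F : Type*} [NormedAddCommGroup F] [NormedSpace ℝ F]
  {B : Type*} [TopologicalSpace B] [ChartedSpace EB B] [T2Space B]
  {E : B → Type*} [TopologicalSpace (TotalSpace F E)]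
  [∀ x, AddCommGroup (E x)] [∀ x, Module ℝ (E x)] [∀ x, TopologicalSpace (E x)]
  [FiberBundle F E] [VectorBundle ℝ F E]
  [IsManifold 𝓘(ℝ, EB) 2 B] [ContMDiffVectorBundle 2 F E 𝓘(ℝ, EB)]
  [CompleteSpace EB] [CompleteSpace F]
  {ι : Type*} [Fintype ι]
  {s : ℝ → ∀ x, E x} {c : ι → B} {K : ι → EB →L[ℝ] F}
  {ρ : ι → ℝ × B → ℝ} {V : Set (ℝ × B)} {O : ι → Set (ParamSpace K × B)} {r : ℝ}
  {C : Set (ParamSpace K × B)}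

namespace IsPerturbationSystem

/-- For a dense set of values of the `i`-th parameter, the zeros near which `ρ i = 1` are regular:
there, changing the parameter adds a constant to the local representative, and Sard's theorem
applies. -/
theorem dense_regular [DecidableEq ι] (h : IsPerturbationSystem s c K ρ V O r C) {t : ℝ}
    (ht : t ∈ Icc (0 : ℝ) 1) (v : ∀ i, (K i).range) (i : ι) :
    Dense {a : (K i).range | ‖Function.update v i a‖ < r → ∀ x,
      ((t, Function.update v i a), x) ∈ C → ρ i =ᶠ[𝓝 (t, x)] (fun _ => 1) →
        IsRegularAt EB F (perturbation s c K ρ) (t, Function.update v i a) x} := by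
  have hfin := h.finiteDimensional
  have : CompleteSpace (ParamSpace K) := FiniteDimensional.complete ℝ _
  refine ((h.isReductionDomain i).dense_regular_values (t, Function.update v i 0)).mono ?_
  intro a ha hr x hx hρ
  have hr0 : ‖Function.update v i (0 : (K i).range)‖ < r := by
    have := pi_norm_update_zero_le (Function.update v i a) i
    rw [Function.update_idem] at this
    exact this.trans_lt hr
  have hxV := h.mem_of_mem _ x ht hr hx
  have hsupp : (t, x) ∈ tsupport (ρ i) := subset_tsupport _ (by simp [hρ.self_of_nhds])
  have hxO := h.mem_domain i (t, Function.update v i 0) x hxV hr0 hsupp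
  have hdom := h.mem_coordDomain i _ hxO
  let φ := chartAt EB (c i)
  let f := localRep EB F (c i) (perturbation s c K ρ)
  have hf : ∀ y ∈ coordDomain EB F E (c i), ρ i (t, y) = 1 →
      f ((t, Function.update v i a), φ y) = f ((t, Function.update v i 0), φ y) + (a : F) := by
    intro y hy hρy
    have hadd : perturbation s c K ρ (t, Function.update v i a) y =
        perturbation s c K ρ (t, Function.update v i 0) y +
          (trivializationAt F E (c i)).symmL ℝ y (a : F) :=
      perturbedFamily_update_of_eq_one hρy v a
    simp only [f, φ]
    rw [localRep_chart _ _ _ hy, localRep_chart _ _ _ hy, hadd, map_add]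
    congr 1
    rw [(trivializationAt F E (c i)).symmL_apply hy.2]
    exact ((trivializationAt F E (c i)).continuousLinearEquivAt ℝ y hy.2).apply_symm_apply (a : F)
  have h0 := h.eq_zero _ hx
  have hb := ha (φ x) ((mem_chartImage hdom.1).2 hxO) (by
    refine (hf x hdom hρ.self_of_nhds).symm.trans ?_
    exact (localRep_chart_eq_zero_iff _ _ _ hdom).2 h0)
  refine (bijective_fiberDeriv_localRep_iff hdom (h.contMDiffAt _ x hxV) h0).1 ?_
  have h1 := hasFDerivAt_fiberDeriv ((contDiffAt_localRep hdom
    (h.contMDiffAt (t, Function.update v i a) x hxV)).differentiableAt (by norm_num))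
  have h2 := hasFDerivAt_fiberDeriv ((contDiffAt_localRep hdom
    (h.contMDiffAt (t, Function.update v i 0) x hxV)).differentiableAt (by norm_num))
  have hev : (fun y => f ((t, Function.update v i a), y)) =ᶠ[𝓝 (φ x)]
      fun y => f ((t, Function.update v i 0), y) + (a : F) := by
    have hφc : Filter.Tendsto φ.symm (𝓝 (φ x)) (𝓝 x) := by
      have := φ.continuousAt_symm (φ.map_source hdom.1)
      rwa [ContinuousAt, φ.left_inv hdom.1] at this
    have hρ' : ∀ᶠ y in 𝓝 x, ρ i (t, y) = 1 :=
      (Continuous.prodMk_right t).continuousAt.eventually hρ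
    filter_upwards [hφc.eventually (hρ'.and ((isOpen_coordDomain (c i)).mem_nhds hdom)),
      φ.open_target.mem_nhds (φ.map_source hdom.1)] with y hy hyt
    have := hf (φ.symm y) hy.2 hy.1
    rwa [φ.right_inv hyt] at this
  rw [h1.unique ((h2.add_const (a : F)).congr_of_eventuallyEq hev)]
  exact hb

/-- Near every small parameter there are parameters whose zeros are all regular. -/
theorem frequently_regular [DecidableEq ι] (h : IsPerturbationSystem s c K ρ V O r C) {t : ℝ}
    (ht : t ∈ Icc (0 : ℝ) 1) {v : ∀ i, (K i).range} (hv : ‖v‖ < r) :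
    ∃ᶠ w in 𝓝 v, ∀ x, ((t, w), x) ∈ C → IsRegularAt EB F (perturbation s c K ρ) (t, w) x := by
  have hfin := h.finiteDimensional
  have : CompleteSpace (ParamSpace K) := FiniteDimensional.complete ℝ _
  have : CompleteSpace (∀ i, (K i).range) := FiniteDimensional.complete ℝ _
  obtain ⟨r', hvr', hr'⟩ := exists_between hv
  let Reg : ParamSpace K × B → Prop := fun p => IsRegularAt EB F (perturbation s c K ρ) p.1 p.2
  -- the compact set of irregular zeros
  let N : Set (ParamSpace K × B) := (C ∩ {p | p.1.1 = t ∧ ‖p.1.2‖ ≤ r'}) \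
    interior {p | p ∈ C → Reg p}
  have hN : IsCompact N := by
    refine (h.isCompact.inter_right (IsClosed.inter ?_ ?_)).diff isOpen_interior
    · exact isClosed_singleton.preimage
        (by fun_prop : Continuous fun p : ParamSpace K × B => p.1.1)
    · exact isClosed_le (by fun_prop : Continuous fun p : ParamSpace K × B => ‖p.1.2‖)
        continuous_const
  have hmemN : ∀ w x, ‖w‖ ≤ r' → ((t, w), x) ∈ C →
      (((t, w), x) ∈ N ↔ ¬ Reg ((t, w), x)) := by
    intro w x hw hx
    refine ⟨fun hxN hreg => hxN.2 (mem_interior_iff_mem_nhds.2 ?_),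
      fun hreg => ⟨⟨hx, rfl, hw⟩, fun hi => hreg (interior_subset hi hx)⟩⟩
    have := IsRegularAt.eventually hreg (h.eq_zero _ hx)
      (h.eventually_contMDiffAt (h.mem_of_mem _ x ht (hw.trans_lt hr') hx))
    exact this.mono fun p hp hpC => hp (h.eq_zero p hpC)
  let W : ι → Set (ParamSpace K × B) := fun i => {p | ρ i =ᶠ[𝓝 (p.1.1, p.2)] fun _ => 1}
  have hW : ∀ i, IsOpen (W i) := fun i => by
    have hc : Continuous fun p : ParamSpace K × B => (p.1.1, p.2) := by fun_prop
    exact IsOpen.preimage hc (t := {p | ρ i =ᶠ[𝓝 p] fun _ => 1}) (isOpen_iff_mem_nhds.2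
      fun p hp => eventually_eventually_nhds.2 hp)
  obtain ⟨L, hLc, hLW, hNL⟩ := hN.finite_compact_cover Finset.univ W (fun i _ => hW i) (by
    rintro ⟨⟨t', w⟩, x⟩ ⟨⟨hxC, ht', hw⟩, -⟩
    obtain rfl : t' = t := ht'
    obtain ⟨i, hi⟩ := h.exists_eq_one _ (h.mem_of_mem _ x ht (lt_of_le_of_lt hw hr') hxC)
    exact mem_iUnion₂.2 ⟨i, Finset.mem_univ i, hi⟩)
  let bad : ι → Set (∀ i, (K i).range) := fun i => (fun p => p.1.2) '' L i
  have hbad : ∀ i, IsOpen (bad i)ᶜ := fun i =>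
    ((hLc i).image
      (by fun_prop : Continuous fun p : ParamSpace K × B => p.1.2)).isClosed.isOpen_compl
  have hdense : ∀ i, Dense (bad i)ᶜ := by
    intro i w
    have h1 := (h.dense_regular ht w i) (w i)
    have hc : Continuous fun a : (K i).range => Function.update w i a :=
      continuous_const.update i continuous_id
    have h2 := image_closure_subset_closure_image hc ⟨w i, h1, rfl⟩
    simp only [Function.update_eq_self] at h2
    refine closure_mono ?_ h2
    rintro _ ⟨a, ha, rfl⟩ ⟨⟨⟨t', w'⟩, x⟩, hp, heq⟩
    obtain rfl : w' = Function.update w i a := heq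
    have hpN : ((t', Function.update w i a), x) ∈ N := by
      rw [hNL]
      exact mem_iUnion₂.2 ⟨i, Finset.mem_univ i, hp⟩
    obtain rfl : t' = t := hpN.1.2.1
    have hwr : ‖Function.update w i a‖ ≤ r' := hpN.1.2.2
    exact (hmemN _ x hwr hpN.1.1).1 hpN
      (ha (hwr.trans_lt hr') x hpN.1.1 (hLW i hp))
  have hall : Dense (⋂ i, (bad i)ᶜ) := dense_iInter_of_isOpen hbad hdense
  refine ((mem_closure_iff_frequently.1 (hall v)).and_eventually
    (continuous_norm.continuousAt.eventually_lt_const hvr')).mono ?_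
  rintro w ⟨hw, hwr⟩ x hx
  by_contra hreg
  have hxN := (hmemN w x hwr.le hx).2 hreg
  rw [hNL] at hxN
  obtain ⟨i, -, hi⟩ := mem_iUnion₂.1 hxN
  exact mem_iInter.1 hw i ⟨_, hi, rfl⟩

end IsPerturbationSystem

end ParityDense

section ParityMove

set_option linter.unusedSectionVars false

variable {EB : Type*} [NormedAddCommGroup EB] [NormedSpace ℝ EB]
  {F : Type*} [NormedAddCommGroup F] [NormedSpace ℝ F]
  {B : Type*} [TopologicalSpace B] [ChartedSpace EB B] [T2Space B]
  {E : B → Type*} [TopologicalSpace (TotalSpace F E)]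
  [∀ x, AddCommGroup (E x)] [∀ x, Module ℝ (E x)] [∀ x, TopologicalSpace (E x)]
  [FiberBundle F E] [VectorBundle ℝ F E]
  [IsManifold 𝓘(ℝ, EB) 2 B] [ContMDiffVectorBundle 2 F E 𝓘(ℝ, EB)]
  [CompleteSpace EB] [CompleteSpace F]
  {ι : Type*} [Fintype ι]
  {s : ℝ → ∀ x, E x} {c : ι → B} {K : ι → EB →L[ℝ] F}
  {ρ : ι → ℝ × B → ℝ} {V : Set (ℝ × B)} {O : ι → Set (ParamSpace K × B)} {r : ℝ}
  {C : Set (ParamSpace K × B)}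

namespace IsPerturbationSystem

/-- Changing a single parameter does not change the parity of the number of zeros: the zeros outside
of the support of `ρ i` do not move, and the other ones stay in the `i`-th reduction domain, where
the parity is invariant by the finite-dimensional theory. -/
theorem ncard_update_eq [DecidableEq ι] (h : IsPerturbationSystem s c K ρ V O r C) {t : ℝ}
    (ht : t ∈ Icc (0 : ℝ) 1) {v : ∀ i, (K i).range} (hv : ‖v‖ < r)
    (hreg : ∀ x, ((t, v), x) ∈ C → IsRegularAt EB F (perturbation s c K ρ) (t, v) x)
    (i : ι) (a : (K i).range) (hv' : ‖Function.update v i a‖ < r)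
    (hreg' : ∀ x, ((t, Function.update v i a), x) ∈ C →
      IsRegularAt EB F (perturbation s c K ρ) (t, Function.update v i a) x) :
    ({x | ((t, Function.update v i a), x) ∈ C}.ncard : ZMod 2) =
      ({x | ((t, v), x) ∈ C}.ncard : ZMod 2) := by
  have hfin := h.finiteDimensional
  let pert := perturbation s c K ρ
  let f := localRep EB F (c i) pert
  let φ := chartAt EB (c i)
  let S : Set B := {x | (t, x) ∈ tsupport (ρ i)}
  -- the segment from `v` to its modification
  let w : ℝ → ∀ i, (K i).range := fun θ => Function.update v i (v i + θ • (a - v i))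
  have hw0 : w 0 = v := by simp [w]
  have hw1 : w 1 = Function.update v i a := by simp [w]
  have hwc : ContDiff ℝ 2 w := by
    refine contDiff_pi.2 fun j => ?_
    by_cases hj : j = i
    · subst hj
      simp only [w, Function.update_self]
      fun_prop
    · simp only [w, Function.update_of_ne hj]
      exact contDiff_const
  let g : ℝ → ParamSpace K := fun θ => (t, w θ)
  have hg : ContDiff ℝ 2 g := contDiff_const.prodMk hwc
  have hwr : ∀ θ ∈ Icc (0 : ℝ) 1, ‖w θ‖ < r := by
    intro θ hθ
    have h0 := (norm_le_pi_norm v i).trans_lt hv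
    have h1 := (norm_le_pi_norm (Function.update v i a) i).trans_lt hv'
    rw [Function.update_self] at h1
    refine pi_norm_update_lt hv' ?_
    have := (convex_ball (0 : (K i).range) r).add_smul_sub_mem (mem_ball_zero_iff.2 h0)
      (mem_ball_zero_iff.2 h1) hθ
    exact mem_ball_zero_iff.1 this
  have hoff : ∀ θ, ∀ x ∉ S, pert (g θ) x = pert (t, v) x := fun θ x hx =>
    perturbedFamily_update_of_notMem hx v _
  let E₀ : Set B := {x | ((t, v), x) ∈ C} \ S
  have hE₀ : ∀ θ ∈ Icc (0 : ℝ) 1, {x | (g θ, x) ∈ C} \ S = E₀ := by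
    intro θ hθ
    ext x
    refine and_congr_left fun hx => ?_
    simp only [mem_ofPred_eq, g, h.mem_iff ht (hwr θ hθ), h.mem_iff ht hv]
    exact and_congr_right fun _ => by rw [show perturbation s c K ρ (t, w θ) x = _ from hoff θ x hx]
  have hfin₀ := (h.eventually_ncard_eq ht hv hreg).1
  have hfin₁ := (h.eventually_ncard_eq ht hv' hreg').1
  -- the moving zeros, in coordinates
  let D : Set (ℝ × EB) := {p | p.2 ∈ φ.target ∧
    ((g p.1, φ.symm p.2) ∈ O i ∧ (t, φ.symm p.2) ∈ V ∧ φ.symm p.2 ∉ E₀) ∧ ‖w p.1‖ < r}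
  have hDopen : IsOpen D := by
    have h1 : IsOpen {p : (ℝ × ParamSpace K) × B |
        ((p.1.2, p.2) ∈ O i ∧ (t, p.2) ∈ V ∧ p.2 ∉ E₀) ∧ ‖w p.1.1‖ < r} := by
      refine IsOpen.inter (IsOpen.inter ?_ (IsOpen.inter ?_ ?_)) ?_
      · exact (h.isOpen_domain i).preimage (by fun_prop)
      · exact h.isOpen.preimage (by fun_prop)
      · exact (hfin₀.subset sdiff_subset).isClosed.isOpen_compl.preimage continuous_snd
      · exact isOpen_lt (hwc.continuous.comp (by fun_prop)).norm continuous_const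
    have hc : ContinuousOn (fun p : ℝ × EB => ((p.1, g p.1), φ.symm p.2))
        (Prod.snd ⁻¹' φ.target) :=
      ((continuous_id.prodMk hg.continuous).comp continuous_fst).continuousOn.prodMk
        (φ.continuousOn_symm.comp continuousOn_snd fun _ h => h)
    exact hc.isOpen_inter_preimage (φ.open_target.preimage continuous_snd) h1
  obtain ⟨hD, hDd⟩ := (h.isReductionDomain i).comp_path hg hDopen fun p hp => ⟨hp.1, hp.2.1.1⟩
  have hmemD : ∀ θ ∈ Icc (0 : ℝ) 1, ∀ y, ((θ, y) ∈ D ∧ f (g θ, y) = 0) ↔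
      ∃ x, (g θ, x) ∈ C ∧ x ∈ S ∧ φ x = y := by
    intro θ hθ y
    constructor
    · rintro ⟨⟨hy, ⟨hyO, hyV, hyE⟩, -⟩, h0⟩
      have hdom := h.mem_coordDomain i _ hyO
      have h0' : pert (g θ) (φ.symm y) = 0 := by
        rw [← localRep_chart_eq_zero_iff (c i) pert (g θ) hdom, φ.right_inv hy]
        exact h0
      have hC := h.mem_of_eq_zero (g θ) _ hyV (hwr θ hθ) h0'
      refine ⟨φ.symm y, hC, ?_, φ.right_inv hy⟩
      by_contra hS
      exact hyE ((hE₀ θ hθ).subset ⟨hC, hS⟩)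
    · rintro ⟨x, hx, hxS, rfl⟩
      have hxV := h.mem_of_mem _ x ht (hwr θ hθ) hx
      have hxO := h.mem_domain i (g θ) x hxV (hwr θ hθ) hxS
      have hdom := h.mem_coordDomain i _ hxO
      refine ⟨⟨φ.map_source hdom.1, ?_, hwr θ hθ⟩,
        (localRep_chart_eq_zero_iff (c i) pert (g θ) hdom).2 (h.eq_zero _ hx)⟩
      simp only [φ.left_inv hdom.1]
      exact ⟨hxO, hxV, fun hE => hE.2 hxS⟩
  have hsource : ∀ θ ∈ Icc (0 : ℝ) 1, ∀ x, (g θ, x) ∈ C → x ∈ S →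
      x ∈ coordDomain EB F E (c i) := fun θ hθ x hx hxS =>
    h.mem_coordDomain i _ (h.mem_domain i (g θ) x (h.mem_of_mem _ x ht (hwr θ hθ) hx)
      (hwr θ hθ) hxS)
  have hcomp : IsCompact {p ∈ D | p.1 ∈ Icc (0 : ℝ) 1 ∧ f (g p.1, p.2) = 0} := by
    have h1 : IsCompact {p : ℝ × B | p.1 ∈ Icc (0 : ℝ) 1 ∧ (g p.1, p.2) ∈ C ∧ p.2 ∈ S} := by
      refine (isCompact_Icc.prod (h.isCompact.image continuous_snd)).of_isClosed_subset
        ((isClosed_Icc.preimage continuous_fst).inter (IsClosed.inter ?_ ?_))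
        fun p hp => ⟨hp.1, (g p.1, p.2), hp.2.1, rfl⟩
      · exact h.isCompact.isClosed.preimage
          ((hg.continuous.comp continuous_fst).prodMk continuous_snd)
      · exact (isClosed_tsupport (ρ i)).preimage
          (by fun_prop : Continuous fun p : ℝ × B => (t, p.2))
    convert h1.image_of_continuousOn (f := fun p : ℝ × B => (p.1, φ p.2)) ?_ using 1
    · ext ⟨θ, y⟩
      constructor
      · rintro ⟨hp, hθ, h0⟩
        obtain ⟨x, hx, hxS, rfl⟩ := (hmemD θ hθ y).1 ⟨hp, h0⟩
        exact ⟨(θ, x), ⟨hθ, hx, hxS⟩, rfl⟩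
      · rintro ⟨⟨θ', x⟩, ⟨hθ, hx, hxS⟩, heq⟩
        rw [Prod.mk.injEq] at heq
        obtain ⟨rfl, rfl⟩ := heq
        have := (hmemD θ' hθ _).2 ⟨x, hx, hxS, rfl⟩
        exact ⟨this.1, hθ, this.2⟩
    · exact continuousOn_fst.prodMk (φ.continuousOn.comp continuousOn_snd
        fun p hp => (hsource p.1 hp.1 p.2 hp.2.1 hp.2.2).1)
  have hregD : ∀ θ ∈ Icc (0 : ℝ) 1, (∀ x, (g θ, x) ∈ C → IsRegularAt EB F pert (g θ) x) →
      ∀ y, (θ, y) ∈ D → f (g θ, y) = 0 →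
        Function.Bijective (fiberDeriv (fun p : ℝ × EB => f (g p.1, p.2)) (θ, y)) := by
    intro θ hθ hr y hy h0
    rw [hDd _ hy]
    obtain ⟨x, hx, hxS, rfl⟩ := (hmemD θ hθ y).1 ⟨hy, h0⟩
    exact (bijective_fiberDeriv_localRep_iff (hsource θ hθ x hx hxS)
      (h.contMDiffAt (g θ) x (h.mem_of_mem _ x ht (hwr θ hθ) hx)) (h.eq_zero _ hx)).2 (hr x hx)
  have hparity := hD.ncard_zeros_eq hcomp (by
    rintro _ (rfl | rfl)
    · exact hregD 0 (by simp) (by simpa only [g, hw0] using hreg)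
    · exact hregD 1 (by simp) (by simpa only [g, hw1] using hreg'))
  have hcount : ∀ θ ∈ Icc (0 : ℝ) 1, {y | (θ, y) ∈ D ∧ f (g θ, y) = 0}.ncard =
      ({x | (g θ, x) ∈ C} ∩ S).ncard := by
    intro θ hθ
    have : {y | (θ, y) ∈ D ∧ f (g θ, y) = 0} = φ '' ({x | (g θ, x) ∈ C} ∩ S) := by
      ext y
      refine (hmemD θ hθ y).trans ⟨?_, ?_⟩
      · rintro ⟨x, hx, hxS, rfl⟩
        exact ⟨x, ⟨hx, hxS⟩, rfl⟩
      · rintro ⟨x, ⟨hx, hxS⟩, rfl⟩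
        exact ⟨x, hx, hxS, rfl⟩
    rw [this]
    exact InjOn.ncard_image (φ.injOn.mono fun x hx => (hsource θ hθ x hx.1 hx.2).1)
  have h0 := hcount 0 (by simp)
  have h1 := hcount 1 (by simp)
  have e0 := hE₀ 0 (by simp)
  have e1 := hE₀ 1 (by simp)
  simp only [g, hw0, hw1] at h0 h1 e0 e1 hparity
  rw [← ncard_inter_add_ncard_sdiff_eq_ncard _ S hfin₀,
    ← ncard_inter_add_ncard_sdiff_eq_ncard _ S hfin₁, e0, e1, ← h0, ← h1]
  push_cast
  rw [hparity]

end IsPerturbationSystem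

end ParityMove

/-! ### Persistence of zeros along a homotopy of sections -/

/-- A family of sections over `[0, 1]` with compact set of zeros, fiberwise differentials of index
zero and exactly one zero at time `0`, which is regular, has a zero at time `1`. -/
theorem exists_zero_at_one
    {EB : Type*} [NormedAddCommGroup EB] [NormedSpace ℝ EB] [CompleteSpace EB]
    {F : Type*} [NormedAddCommGroup F] [NormedSpace ℝ F] [CompleteSpace F]
    {B : Type*} [TopologicalSpace B] [ChartedSpace EB B] [T2Space B]
    {E : B → Type*} [TopologicalSpace (TotalSpace F E)]
    [∀ x, AddCommGroup (E x)] [∀ x, Module ℝ (E x)] [∀ x, TopologicalSpace (E x)]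
    [FiberBundle F E] [VectorBundle ℝ F E]
    [IsManifold 𝓘(ℝ, EB) 2 B] [ContMDiffVectorBundle 2 F E 𝓘(ℝ, EB)] {s : ℝ → ∀ x, E x}
    (hs : ContMDiff (𝓘(ℝ, ℝ).prod 𝓘(ℝ, EB)) (𝓘(ℝ, EB).prod 𝓘(ℝ, F)) 2 (totalFamily F s))
    (hZ : IsCompact {p : ℝ × B | p.1 ∈ Icc (0 : ℝ) 1 ∧ s p.1 p.2 = 0})
    (hfred : ∀ t ∈ Icc (0 : ℝ) 1, ∀ x, s t x = 0 →
      (fiberwiseDifferential (EB := EB) (fun y => totalFamily F s (t, y)) x).IsFredholm ∧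
        fredholmIndex (fiberwiseDifferential (EB := EB) (fun y => totalFamily F s (t, y)) x) = 0)
    {x₀ : B} (hx₀ : ∀ x, s 0 x = 0 ↔ x = x₀) (hreg : IsRegularAt EB F s 0 x₀) :
    ∃ x, s 1 x = 0 := by
  classical
  by_contra! hne
  obtain ⟨T, K, ρ, V, O, r, C, h⟩ := exists_isPerturbationSystem hs hZ hfred
  have hr : ‖(0 : ∀ i, (K i).range)‖ < r := by simpa using h.pos
  have hmem : ∀ t ∈ Icc (0 : ℝ) 1, ∀ x, ((t, 0), x) ∈ C ↔ s t x = 0 := by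
    intro t ht x
    rw [h.mem_iff ht hr]
    have h0 : perturbation s (fun i : T => i.1.1.2) K ρ (t, 0) x = s t x := perturbedFamily_zero t x
    rw [h0]
    exact ⟨fun hx => hx.2, fun hx => ⟨h.mem_of_zero t ht x hx, hx⟩⟩
  let G : Set (ParamSpace K) :=
    {q | ∀ x, (q, x) ∈ C → IsRegularAt EB F (perturbation s (fun i : T => i.1.1.2) K ρ) q x}
  let f : ParamSpace K → ZMod 2 := fun q => ({x | (q, x) ∈ C}.ncard : ZMod 2)
  have key : f (0, 0) = f (1, 0) := by
    refine eq_at_endpoints (R := fun i => (K i).range) (G := G) h.pos (fun t ht v hv hvr => ?_)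
      (fun t ht v hvr => h.frequently_regular ht hvr)
      (fun t ht v hv i a hvr hv' hvr' => h.ncard_update_eq ht hvr hv i a hvr' hv') ?_ ?_
    · exact (h.eventually_ncard_eq ht hvr hv).2.mono fun q hq _ =>
        ⟨hq.1, congrArg (Nat.cast : ℕ → ZMod 2) hq.2⟩
    · intro x hx
      obtain rfl := (hx₀ x).1 ((hmem 0 (by simp) x).1 hx)
      have heq : (fun y => totalFamily F (perturbation s (fun i : T => i.1.1.2) K ρ) ((0, 0), y)) =
          fun y => totalFamily F s (0, y) := by
        ext y
        · rfl
        · simp only [totalFamily, perturbedFamily_zero]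
          rfl
      rw [IsRegularAt, heq]
      exact hreg
    · intro x hx
      exact absurd ((hmem 1 (by simp) x).1 hx) (hne x)
  have h0 : {x | (((0, 0) : ParamSpace K), x) ∈ C} = {x₀} := by
    ext x
    exact (hmem 0 (by simp) x).trans (hx₀ x)
  have h1 : {x | (((1, 0) : ParamSpace K), x) ∈ C} = ∅ :=
    eq_empty_iff_forall_notMem.2 fun x hx => hne x ((hmem 1 (by simp) x).1 hx)
  simp only [f, h0, h1, ncard_singleton, ncard_empty] at key
  -- the parity is `1` at time `0` and `0` at time `1`
  exact absurd key (by decide)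

theorem theoremA1
    {EB : Type*} [NormedAddCommGroup EB] [NormedSpace ℝ EB] [CompleteSpace EB]
    {F : Type*} [NormedAddCommGroup F] [NormedSpace ℝ F] [CompleteSpace F]
    {B : Type*} [TopologicalSpace B] [T2Space B] [ChartedSpace EB B]
    [IsManifold 𝓘(ℝ, EB) ∞ B]
    {E : B → Type*} [TopologicalSpace (TotalSpace F E)]
    [∀ x, AddCommGroup (E x)] [∀ x, Module ℝ (E x)] [∀ x, TopologicalSpace (E x)]
    [FiberBundle F E] [VectorBundle ℝ F E] [ContMDiffVectorBundle ∞ F E 𝓘(ℝ, EB)]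
    (S : unitInterval × B → TotalSpace F E)
    (hS : ContMDiff ((𝓡∂ 1).prod 𝓘(ℝ, EB)) (𝓘(ℝ, EB).prod 𝓘(ℝ, F)) 2 S)
    (hsection : ∀ (t : unitInterval) (x : B), (S (t, x)).proj = x)
    (hcompact : IsCompact (S ⁻¹' range (zeroSection F E)))
    (hfredholm : ∀ (t : unitInterval) (x : B), S (t, x) ∈ range (zeroSection F E) →
      (fiberwiseDifferential (EB := EB) (fun y => S (t, y)) x).IsFredholm ∧
        fredholmIndex (fiberwiseDifferential (EB := EB) (fun y => S (t, y)) x) = 0)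
    (x₀ : B)
    (hzero : ∀ x : B, S (0, x) ∈ range (zeroSection F E) ↔ x = x₀)
    (hnondeg : (fiberwiseDifferential (EB := EB) (fun y => S (0, y)) x₀).IsInvertible) :
    Function.Surjective
        (fun p : S ⁻¹' range (zeroSection F E) => ((p : unitInterval × B).1 : unitInterval)) ∧
      ∃ x₁ : B, S (1, x₁) ∈ range (zeroSection F E) := by
  have hle : (2 : WithTop ℕ∞) ≤ ∞ := WithTop.coe_le_coe.2 (le_top (a := (2 : ℕ∞)))
  have : IsManifold 𝓘(ℝ, EB) 2 B := IsManifold.of_le (n := ∞) hle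
  have : ContMDiffVectorBundle 2 F E 𝓘(ℝ, EB) :=
    ContMDiffVectorBundle.of_le (n := ∞) hle
  have hex : ∀ t x, ∃ v : E x, (⟨x, v⟩ : TotalSpace F E) = S (t, x) := fun t x => by
    have h := hsection t x
    generalize S (t, x) = p at h
    obtain ⟨y, v⟩ := p
    obtain rfl : y = x := h
    exact ⟨v, rfl⟩
  choose σ hσ using hex
  have hall : ∀ t : unitInterval, ∃ x, S (t, x) ∈ range (zeroSection F E) := by
    intro t
    -- the interval `[0, t]`, reparametrized smoothly by the real line
    let θ : ℝ → unitInterval := fun τ =>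
      t * ⟨Real.smoothTransition τ, Real.smoothTransition.nonneg τ, Real.smoothTransition.le_one τ⟩
    have hθ : ContMDiff 𝓘(ℝ, ℝ) (𝓡∂ 1) 2 θ := by
      have hc : ContDiff ℝ 2 fun τ => (t : ℝ) * Real.smoothTransition τ :=
        contDiff_const.mul (Real.smoothTransition.contDiff (n := 2))
      refine contMDiff_iff_comp_subtypeVal_Icc.2 ⟨?_, hc.contMDiff⟩
      exact continuous_induced_rng.2 hc.continuous
    have hθ0 : θ 0 = 0 := by
      ext
      simp [θ, Real.smoothTransition.zero]
    have hθ1 : θ 1 = t := by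
      ext
      simp [θ, Real.smoothTransition.one]
    let s : ℝ → ∀ x, E x := fun τ x => σ (θ τ) x
    have hsS : ∀ τ x, totalFamily F s (τ, x) = S (θ τ, x) := fun τ x => hσ (θ τ) x
    have hs0 : ∀ τ x, s τ x = 0 ↔ S (θ τ, x) ∈ range (zeroSection F E) := fun τ x => by
      rw [← hσ (θ τ) x, mem_range_zeroSection_iff]
    have hpair : ContMDiff (𝓘(ℝ, ℝ).prod 𝓘(ℝ, EB)) ((𝓡∂ 1).prod 𝓘(ℝ, EB)) 2
        (fun p : ℝ × B => (θ p.1, p.2)) :=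
      (hθ.comp contMDiff_fst).prodMk contMDiff_snd
    have hs : ContMDiff (𝓘(ℝ, ℝ).prod 𝓘(ℝ, EB)) (𝓘(ℝ, EB).prod 𝓘(ℝ, F)) 2 (totalFamily F s) := by
      rw [show totalFamily F s = S ∘ fun p : ℝ × B => (θ p.1, p.2) from
        funext fun p => hsS p.1 p.2]
      exact hS.comp hpair
    have hfam : ∀ τ, (fun y => totalFamily F s (τ, y)) = fun y => S (θ τ, y) := fun τ =>
      funext fun y => hsS τ y
    have hZ : IsCompact {p : ℝ × B | p.1 ∈ Icc (0 : ℝ) 1 ∧ s p.1 p.2 = 0} := by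
      refine (isCompact_Icc.prod (hcompact.image continuous_snd)).of_isClosed_subset ?_
        fun p hp => ⟨hp.1, (θ p.1, p.2), (hs0 _ _).1 hp.2, rfl⟩
      refine (isClosed_Icc.preimage continuous_fst).inter ?_
      have heq : {p : ℝ × B | s p.1 p.2 = 0} =
          (fun p : ℝ × B => (θ p.1, p.2)) ⁻¹' (S ⁻¹' range (zeroSection F E)) :=
        Set.ext fun p => hs0 p.1 p.2
      have hclosed := hcompact.isClosed.preimage hpair.continuous
      rwa [← heq] at hclosed
    obtain ⟨x, hx⟩ := exists_zero_at_one hs hZ (fun τ _ x hx => by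
        rw [hfam]
        exact hfredholm _ x ((hs0 τ x).1 hx)) (x₀ := x₀)
      (fun x => by rw [hs0, hθ0, hzero]) (by
        rw [IsRegularAt, hfam, hθ0]
        exact hnondeg.bijective)
    exact ⟨x, by rw [← hθ1]; exact (hs0 1 x).1 hx⟩
  exact ⟨fun t => (hall t).elim fun x hx => ⟨⟨(t, x), hx⟩, rfl⟩, hall 1⟩
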